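/- Let $d\ge 1$, and for a function $f$ on $\mathbb R^d$ put $(\mathcal F f)(\xi)=(2\pi)^{-d/2}\int_{\mathbb R^d} f(x)e^{-i\xi\cdot x}\,dx$. Let $\{\phi_\ell\}_{\ell\in\mathbb Z}$ be a family of (complex-valued) Schwartz functions on $\mathbb R^d$ such that $(\mathcal F\phi_0)(\xi)\neq 0$ only if $|\xi|\in(2^{-1},2)$, $(\mathcal F\phi_\ell)(\xi)=(\mathcal F\phi_0)(2^{-\ell}\xi)$ for all $\xi$ and $\ell$, and $\sum_{\ell\in\mathbb Z}(\mathcal F\phi_\ell)(\xi)=1$ for all $\xi\ne0$. Then there is a constant $C<\infty$, depending only on $d$ and on the family $\{\phi_\ell\}$, such that the following holds for all $L>0$, $\kappa>0$, $s\in[0,1]$ and $\ell\in\mathbb Z$. Write $\langle f\rangle=L^{-d}\int_{[0,L]^d}f\,dx$ for the spatial average. All functions of $x$ below are $[0,L]^d$-periodic and measurable. For a periodic vector field $v$ put $\langle|\nabla^s v|^2\rangle=\sum_{m\in\frac{2\pi}{L}\mathbb Z^d}|m|^{2s}|\hat v(m)|^2$, where $\hat v(m)=\langle v\,e^{-im\cdot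 x}\rangle$ (and $0^0=1$). Let $u\in L^2((0,T)\times[0,L]^d;\mathbb R^d)$ for all $T<\infty$, with $\operatorname{div}u(t)=0$ in the sense of distributions for a.e. $t>0$, and with $\langle|\nabla^su(t)|^2\rangle^{1/2}=G_s$ for a.e. $t>0$, where $G_s\in[0,\infty)$ does not depend on $t$. Let $\theta_0\in L^1([0,L]^d)$ and let $\theta$, with $\theta,\nabla\theta\in L^2((0,T)\times[0,L]^d)$ for all $T<\infty$ ($\nabla$ is the weak spatial gradient), be a real-valued weak solution on $(0,\infty)$ of $$\partial_t\theta+u\cdot\nabla\theta-\kappa\Delta\theta=0,\qquad \theta(0,\cdot)=\theta_0,$$ that is, for every smooth $\eta=\eta(t,x)$ that is periodic in $x$ and vanishes for all large $t$, $$\int_0^\infty\!\!\int_{[0,L]^d}\bigl(\theta\,\partial_t\eta-(u\cdot\nabla\theta)\,\eta-\kappa\nabla\theta\cdot\nabla\eta\bigr)\,dx\,dt+\int_{[0,L]^d}\theta_0\,\eta(0,\cdot)\,dx=0 .$$ Let $\varphi:[0,\infty)\to[0,\infty)$ be nondecreasing and locally absolutely continuous, and for a nonnegative function $f=f(t,x)$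 (or $f=f(t)$, in which case $\langle f\rangle=f$) put $$\langle\langle f\rangle\rangle_\varphi=\limsup_{T\to\infty}\frac1T\int_0^T\langle f\rangle\,e^{\varphi(t)}\,dt\in[0,\infty].$$ Let $\theta_\ell=\phi_\ell*\theta$ (convolution in space) be the Littlewood--Paley projection. Then $$\langle\langle|\theta_\ell|\rangle\rangle_\varphi\le C\,\kappa^{-1}\Bigl(2^{-(s+2)\ell}\langle|\nabla^su|^2\rangle^{1/2}+2^{-3\ell}\Bigl\|\frac{d\varphi}{dt}\Bigr\|_{L^\infty(0,\infty)}\Bigr)\,\langle\langle\,\langle|\nabla\theta|^2\rangle^{1/2}\,\rangle\rangle_\varphi ,$$ as an inequality in $[0,\infty]$ with the convention $0\cdot\infty=0$. -/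

import Mathlib

open MeasureTheory Set Filter
open scoped ENNReal NNReal ContDiff SchwartzMap

noncomputable section

namespace PassiveScalar

/-- The Euclidean space of dimension `d`. -/
abbrev Space (d : ℕ) : Type := EuclideanSpace ℝ (Fin d)

/-- The periodicity cell, the box with side length `L`. -/
def cell (d : ℕ) (L : ℝ) : Set (Space d) := {x | ∀ i, x i ∈ Icc (0 : ℝ) L}

/-- `f` is `L`-periodic in every coordinate direction. -/
def IsPeriodic {d : ℕ} {α : Type*} (L : ℝ) (f : Space d → α) : Prop :=
  ∀ (i : Fin d) (x : Space d), f (x + EuclideanSpace.single i L) = f x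

/-- The spatial average of a nonnegative function over the cell. -/
def spaceAvg {d : ℕ} (L : ℝ) (f : Space d → ℝ≥0∞) : ℝ≥0∞ :=
  ENNReal.ofReal ((L ^ d)⁻¹) * ∫⁻ x in cell d L, f x

/-- The weighted long-time average, with weight `exp (φ t)`, of a nonnegative function of time. -/
def longTimeAvg (φ : ℝ → ℝ) (f : ℝ → ℝ≥0∞) : ℝ≥0∞ :=
  limsup (fun T : ℝ => ENNReal.ofReal T⁻¹ *
    ∫⁻ t in Ioc 0 T, f t * ENNReal.ofReal (Real.exp (φ t))) atTop

/-- The wave number `(2 π / L) k` attached to the integer vector `k`. -/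
def waveVector {d : ℕ} (L : ℝ) (k : Fin d → ℤ) : Space d :=
  WithLp.toLp 2 fun i => 2 * Real.pi / L * (k i : ℝ)

/-- The Fourier coefficient of a periodic function at the wave number `(2 π / L) k`. -/
def fourierCoefficient {d : ℕ} (L : ℝ) (f : Space d → ℝ) (k : Fin d → ℤ) : ℂ :=
  (((L ^ d)⁻¹ : ℝ) : ℂ) * ∫ x in cell d L,
    (f x : ℂ) * Complex.exp (-Complex.I * ((inner ℝ (waveVector L k) x : ℝ) : ℂ))

/-- The mean square of the fractional gradient of order `s` of a periodic vector field, defined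
through its Fourier coefficients. -/
def fracGradSq {d : ℕ} (L s : ℝ) (v : Space d → Space d) : ℝ≥0∞ :=
  ∑' k : Fin d → ℤ, ENNReal.ofReal (‖waveVector L k‖ ^ (2 * s)) *
    ∑ i : Fin d, ‖fourierCoefficient L (fun x => v x i) k‖ₑ ^ 2

/-- The Fourier transform on the whole space, in the unitary normalization. -/
def fourierTransform {d : ℕ} (f : Space d → ℂ) (ξ : Space d) : ℂ :=
  (((2 * Real.pi) ^ (-(d : ℝ) / 2) : ℝ) : ℂ) *
    ∫ x, f x * Complex.exp (-Complex.I * ((inner ℝ ξ x : ℝ) : ℂ))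

/-- A family of Schwartz functions generating a (homogeneous) Littlewood--Paley decomposition. -/
structure IsLittlewoodPaleyFamily {d : ℕ} (Φ : ℤ → 𝓢(Space d, ℂ)) : Prop where
  support : ∀ ξ, fourierTransform (Φ 0) ξ ≠ 0 → ‖ξ‖ ∈ Ioo ((2 : ℝ)⁻¹) 2
  scaling : ∀ (l : ℤ) (ξ : Space d),
    fourierTransform (Φ l) ξ = fourierTransform (Φ 0) (((2 : ℝ) ^ (-l)) • ξ)
  partition : ∀ ξ : Space d, ξ ≠ 0 → HasSum (fun l : ℤ => fourierTransform (Φ l) ξ) 1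

/-- The Littlewood--Paley projection: convolution in space with the `l`-th Schwartz function. -/
def lpProj {d : ℕ} (Φ : ℤ → 𝓢(Space d, ℂ)) (l : ℤ) (f : Space d → ℝ) (x : Space d) : ℂ :=
  ∫ y, Φ l y * (f (x - y) : ℂ)

/-- `v` is weakly divergence-free (as a periodic vector field). -/
def WeakDivFree {d : ℕ} (L : ℝ) (v : Space d → Space d) : Prop :=
  ∀ ψ : Space d → ℝ, ContDiff ℝ ∞ ψ → IsPeriodic L ψ →
    ∫ x in cell d L, inner ℝ (v x) (gradient ψ x) = 0

/-- `g` is the weak gradient of `f` (as periodic functions). -/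
def IsWeakGradient {d : ℕ} (L : ℝ) (f : Space d → ℝ) (g : Space d → Space d) : Prop :=
  ∀ ψ : Space d → ℝ, ContDiff ℝ ∞ ψ → IsPeriodic L ψ → ∀ i : Fin d,
    ∫ x in cell d L, f x * gradient ψ x i = -∫ x in cell d L, g x i * ψ x

/-- Square integrability on `(0, T) × cell` for every finite time `T`. -/
def LocallySquareIntegrable {d : ℕ} {F : Type*} [NormedAddCommGroup F] (L : ℝ)
    (f : ℝ → Space d → F) : Prop :=
  ∀ T : ℝ, MemLp (fun p : ℝ × Space d => f p.1 p.2) 2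
    ((volume.restrict (Ioo 0 T)).prod (volume.restrict (cell d L)))

/-- Time-dependent, periodic, divergence-free velocity fields. No smoothness is assumed. -/
structure IsVelocityField {d : ℕ} (L : ℝ) (u : ℝ → Space d → Space d) : Prop where
  measurable : Measurable fun p : ℝ × Space d => u p.1 p.2
  periodic : ∀ t, IsPeriodic L (u t)
  sqIntegrable : LocallySquareIntegrable L u
  divFree : ∀ᵐ t ∂volume.restrict (Ioi (0 : ℝ)), WeakDivFree L (u t)

/-- Space-time test functions: smooth, periodic in space, vanishing for large times (but not
necessarily at the initial time). -/
structure IsTestFunction {d : ℕ} (L : ℝ) (η : ℝ → Space d → ℝ) : Prop where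
  smooth : ContDiff ℝ ∞ fun p : ℝ × Space d => η p.1 p.2
  periodic : ∀ t, IsPeriodic L (η t)
  support : ∃ T : ℝ, ∀ t, T ≤ t → ∀ x, η t x = 0

/-- `θ`, with weak spatial gradient `Dθ`, is a weak solution on the time interval `(0, ∞)` of the
periodic advection-diffusion equation `∂ₜθ + u ⬝ ∇θ - κ Δθ = 0` with initial datum `θ₀`. -/
structure IsWeakSolution {d : ℕ} (L κ : ℝ) (u : ℝ → Space d → Space d) (θ₀ : Space d → ℝ)
    (θ : ℝ → Space d → ℝ) (Dθ : ℝ → Space d → Space d) : Prop where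
  initial_measurable : Measurable θ₀
  initial_periodic : IsPeriodic L θ₀
  initial_integrable : IntegrableOn θ₀ (cell d L)
  measurable : Measurable fun p : ℝ × Space d => θ p.1 p.2
  periodic : ∀ t, IsPeriodic L (θ t)
  sqIntegrable : LocallySquareIntegrable L θ
  grad_measurable : Measurable fun p : ℝ × Space d => Dθ p.1 p.2
  grad_periodic : ∀ t, IsPeriodic L (Dθ t)
  grad_sqIntegrable : LocallySquareIntegrable L Dθ
  weakGradient : ∀ᵐ t ∂volume.restrict (Ioi (0 : ℝ)), IsWeakGradient L (θ t) (Dθ t)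
  equation : ∀ η : ℝ → Space d → ℝ, IsTestFunction L η →
    (∫ t in Ioi (0 : ℝ), ∫ x in cell d L,
        (θ t x * deriv (fun τ => η τ x) t - inner ℝ (u t x) (Dθ t x) * η t x
          - κ * inner ℝ (Dθ t x) (gradient (η t) x)))
      + ∫ x in cell d L, θ₀ x * η 0 x = 0

/-- Time weight exponents: nonnegative, nondecreasing, locally absolutely continuous functions
on `[0, ∞)`. -/
structure IsTimeWeight (φ : ℝ → ℝ) : Prop where
  nonneg : ∀ t, 0 ≤ t → 0 ≤ φ t
  monotone : MonotoneOn φ (Ici 0)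
  absCont : ∀ T : ℝ, 0 < T → AbsolutelyContinuousOnInterval φ 0 T

end PassiveScalar

end

/-!
The Fourier modes of a weak solution satisfy Duhamel's formula, so that the backward heat flow
`k t` of the kernel `Φ l`, with terminal value `Φ l` at time `b`, gives a function `w = k t * θ`
with `∂ₜ w = -k t * (u ⬝ ∇θ)`. As `u` is divergence-free, `u ⬝ ∇w` is orthogonal to every function
of `w`, in particular to the sign of `w`, and the `L¹` norm of `w` grows only through the commutator
`u ⬝ ∇(k t * θ) - k t * (u ⬝ ∇θ)`. This is an average of
`k t y * ((u x - u (x - y)) ⬝ ∇θ (x - y))`, and `‖u - u (· - y)‖₂ ≤ 2 * ‖y‖ ^ s * ‖∇ˢu‖₂`, so its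
`L¹` norm is at most a multiple of `2 ^ (-s * l) * ‖∇ˢu‖₂ * ‖∇θ‖₂`. At time `a = b - τ`, with
`τ = N / (2 ^ (2 * l) * κ)`, the heat flow has reduced the mass of the kernel by a large factor,
whence for `q = ⟨|θ_l|⟩` and a small `δ`
`q (a + τ) ≤ δ * q a + C * 2 ^ (-s * l) * ‖∇ˢu‖₂ * ∫ r in a..a + τ, ‖∇θ r‖₂`.
If `τ * ‖dφ/dt‖ ≤ 1`, the weight `exp φ` grows at most by the factor `e` over time `τ`, and
averaging in time absorbs the first term on the right and gives the term with `∇ˢu`. Otherwise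
Bernstein's inequality `q ≤ C * 2 ^ (-l) * ‖∇θ‖₂` already gives the term with `dφ/dt`.
-/

noncomputable section

namespace PassiveScalar

section Torus

open scoped ComplexConjugate

attribute [local instance] instMeasureSpaceUnitAddCircle

local instance isProbabilityMeasure_unitAddCircle :
    IsProbabilityMeasure (volume : Measure UnitAddCircle) :=
  inferInstanceAs (IsProbabilityMeasure AddCircle.haarAddCircle)

local instance isAddHaarMeasure_unitAddCircle :
    Measure.IsAddHaarMeasure (volume : Measure UnitAddCircle) :=
  inferInstanceAs (Measure.IsAddHaarMeasure AddCircle.haarAddCircle)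

/-- The normalized Lebesgue measure on the periodicity cell: integrals against it are spatial
averages. -/
def cellMeasure (d : ℕ) (L : ℝ) : Measure (Space d) :=
  ENNReal.ofReal ((L ^ d)⁻¹) • volume.restrict (cell d L)

/-- The covering map from the whole space to the unit torus which sends the cell of side length `L`
onto the torus; it transports periodic functions to functions on Mathlib's `UnitAddTorus`. -/
def toTorus {d : ℕ} (L : ℝ) (x : Space d) : UnitAddTorus (Fin d) :=
  fun i => ((x i / L : ℝ) : UnitAddCircle)

/-- A measurable section of the covering map `toTorus`, with values in the half-open cell. -/
def ofTorus {d : ℕ} (L : ℝ) (q : UnitAddTorus (Fin d)) : Space d :=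
  WithLp.toLp 2 fun i => L * (AddCircle.equivIco (1 : ℝ) 0 (q i) : ℝ)

variable {d : ℕ} {L : ℝ}

theorem measurePreserving_div_unitAddCircle (hL : 0 < L) :
    MeasurePreserving (fun x : ℝ => ((x / L : ℝ) : UnitAddCircle))
      (ENNReal.ofReal L⁻¹ • volume.restrict (Icc 0 L)) volume := by
  have hscale : MeasurePreserving (fun x : ℝ => x / L)
      (ENNReal.ofReal L⁻¹ • volume.restrict (Ioc 0 L)) (volume.restrict (Ioc 0 (0 + 1))) := by
    have h : MeasurePreserving (fun x : ℝ => x * L⁻¹) (ENNReal.ofReal |L⁻¹| • volume) volume :=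
      ⟨by fun_prop, by rw [Measure.map_smul, Real.smul_map_volume_mul_right (by positivity)]⟩
    have h' := h.restrict_preimage (measurableSet_Ioc (a := (0 : ℝ)) (b := 0 + 1))
    rw [preimage_mul_const_Ioc₀ _ _ (inv_pos.2 hL), abs_of_pos (inv_pos.2 hL), zero_div, zero_add,
      div_inv_eq_mul, one_mul, Measure.restrict_smul] at h'
    simpa only [div_eq_mul_inv, zero_add] using h'
  have hmk := UnitAddCircle.measurePreserving_mk 0
  rw [AddCircle.volume_eq_smul_haarAddCircle, ENNReal.ofReal_one, one_smul] at hmk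
  rw [Measure.restrict_congr_set Ioc_ae_eq_Icc.symm]
  exact hmk.comp hscale

theorem measurePreserving_ofLp_cellMeasure (hL : 0 < L) :
    MeasurePreserving (MeasurableEquiv.toLp 2 (Fin d → ℝ)).symm (cellMeasure d L)
      (Measure.pi fun _ => ENNReal.ofReal L⁻¹ • volume.restrict (Icc 0 L)) := by
  have := Measure.smul_finite (volume.restrict (Icc 0 L)) (ENNReal.ofReal_ne_top (r := L⁻¹))
  refine ⟨MeasurableEquiv.measurable _, (Measure.pi_eq fun s hs => ?_).symm⟩
  have hpre : (MeasurableEquiv.toLp 2 (Fin d → ℝ)).symm ⁻¹' (univ.pi s) ∩ cell d L =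
      (MeasurableEquiv.toLp 2 (Fin d → ℝ)).symm ⁻¹' (univ.pi fun i => s i ∩ Icc 0 L) := by
    ext x
    simp [cell, forall_and, Set.mem_pi]
  rw [Measure.map_apply (MeasurableEquiv.measurable _) (.univ_pi hs), cellMeasure,
    Measure.smul_apply, Measure.restrict_apply (MeasurableEquiv.measurable _ (.univ_pi hs)), hpre,
    (EuclideanSpace.volume_preserving_symm_measurableEquiv_toLp _).measure_preimage_equiv,
    volume_pi_pi]
  simp only [Measure.smul_apply, Measure.restrict_apply (hs _), smul_eq_mul,
    Finset.prod_mul_distrib, Finset.prod_const, Finset.card_univ, Fintype.card_fin]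
  rw [← ENNReal.ofReal_pow (by positivity), inv_pow]

theorem measurePreserving_toTorus (hL : 0 < L) :
    MeasurePreserving (toTorus L) (cellMeasure d L) volume :=
  have := Measure.smul_finite (volume.restrict (Icc 0 L)) (ENNReal.ofReal_ne_top (r := L⁻¹))
  (measurePreserving_pi _ _ fun _ => measurePreserving_div_unitAddCircle hL).comp
    (measurePreserving_ofLp_cellMeasure hL)

theorem continuous_toTorus : Continuous (toTorus L : Space d → UnitAddTorus (Fin d)) :=
  continuous_pi fun _ => (AddCircle.continuous_mk' (1 : ℝ)).comp (by fun_prop)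

theorem measurable_ofTorus : Measurable (ofTorus L : UnitAddTorus (Fin d) → Space d) :=
  (MeasurableEquiv.toLp 2 (Fin d → ℝ)).measurable.comp <| measurable_pi_lambda _ fun i =>
    ((measurable_subtype_coe.comp (AddCircle.measurableEquivIco 1 0).measurable).comp
      (measurable_pi_apply i)).const_mul L

theorem toTorus_ofTorus (hL : 0 < L) (q : UnitAddTorus (Fin d)) : toTorus L (ofTorus L q) = q := by
  ext i
  simp only [toTorus, ofTorus, mul_div_cancel_left₀ _ hL.ne']
  exact (AddCircle.equivIco (1 : ℝ) 0).symm_apply_apply (q i)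

theorem toTorus_sub (x y : Space d) : toTorus L (x - y) = toTorus L x - toTorus L y := by
  ext i
  simp [toTorus, sub_div]

theorem IsPeriodic.postcomp {α β : Type*} {f : Space d → α} (hf : IsPeriodic L f) (g : α → β) :
    IsPeriodic L fun x => g (f x) :=
  fun i x => congrArg g (hf i x)

theorem IsPeriodic.add_zsmul {α : Type*} {f : Space d → α} (hf : IsPeriodic L f)
    (i : Fin d) (n : ℤ) (x : Space d) : f (x + EuclideanSpace.single i (n * L)) = f x := by
  have hp : Function.Periodic f (EuclideanSpace.single i L) := fun x => hf i x
  rw [← hp.zsmul n x]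
  congr 2
  ext j
  by_cases h : j = i <;> simp [h]

theorem IsPeriodic.add_lattice {α : Type*} {f : Space d → α} (hf : IsPeriodic L f)
    (n : Fin d → ℤ) (x : Space d) (s : Finset (Fin d)) :
    f (x + ∑ i ∈ s, EuclideanSpace.single i (n i * L)) = f x := by
  classical
  induction s using Finset.induction_on with
  | empty => simp
  | insert i s hi ih =>
    rw [Finset.sum_insert hi, add_comm (EuclideanSpace.single i _), ← add_assoc,
      hf.add_zsmul, ih]

theorem exists_eq_add_of_toTorus_eq (hL : 0 < L) {x y : Space d} (h : toTorus L x = toTorus L y)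
    (i : Fin d) : ∃ n : ℤ, x i = y i + n * L := by
  have hi := congrFun h i
  simp only [toTorus] at hi
  rw [← sub_eq_zero, ← AddCircle.coe_sub, AddCircle.coe_eq_zero_iff] at hi
  obtain ⟨n, hn⟩ := hi
  rw [← sub_div, eq_div_iff hL.ne', zsmul_eq_mul, mul_one] at hn
  exact ⟨n, by linarith⟩

theorem IsPeriodic.eq_of_toTorus_eq {α : Type*} {f : Space d → α} (hf : IsPeriodic L f)
    (hL : 0 < L) {x y : Space d} (h : toTorus L x = toTorus L y) : f x = f y := by
  choose n hn using exists_eq_add_of_toTorus_eq hL h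
  rw [← hf.add_lattice n y Finset.univ]
  congr 1
  ext j
  rw [hn j]
  simp [Finset.sum_apply]

theorem IsPeriodic.eq_comp_toTorus {α : Type*} {f : Space d → α} (hf : IsPeriodic L f)
    (hL : 0 < L) : f = (f ∘ ofTorus L) ∘ toTorus L :=
  funext fun _ => hf.eq_of_toTorus_eq hL (toTorus_ofTorus hL _).symm

theorem isPeriodic_comp_toTorus {α : Type*} (hL : 0 < L) (F : UnitAddTorus (Fin d) → α) :
    IsPeriodic L (F ∘ toTorus L) := by
  intro i x
  simp only [Function.comp]
  congr 1
  ext j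
  by_cases h : j = i
  · subst h
    simp [toTorus, add_div, hL.ne']
  · simp [toTorus, h]

theorem isProbabilityMeasure_cellMeasure (hL : 0 < L) :
    IsProbabilityMeasure (cellMeasure d L) := by
  refine ⟨?_⟩
  rw [← preimage_univ (f := toTorus (d := d) L),
    (measurePreserving_toTorus hL).measure_preimage MeasurableSet.univ.nullMeasurableSet]
  exact measure_univ

theorem spaceAvg_eq_lintegral (f : Space d → ℝ≥0∞) :
    spaceAvg L f = ∫⁻ x, f x ∂cellMeasure d L := by
  rw [spaceAvg, cellMeasure, lintegral_smul_measure, smul_eq_mul]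

theorem integral_cellMeasure {E : Type*} [NormedAddCommGroup E] [NormedSpace ℝ E] (hL : 0 < L)
    (f : Space d → E) : ∫ x, f x ∂cellMeasure d L = (L ^ d)⁻¹ • ∫ x in cell d L, f x := by
  rw [cellMeasure, integral_smul_measure, ENNReal.toReal_ofReal (by positivity)]

theorem setIntegral_cell {E : Type*} [NormedAddCommGroup E] [NormedSpace ℝ E] (hL : 0 < L)
    (f : Space d → E) : ∫ x in cell d L, f x = (L ^ d) • ∫ x, f x ∂cellMeasure d L := by
  rw [integral_cellMeasure hL, smul_smul, mul_inv_cancel₀ (by positivity), one_smul]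

theorem IsPeriodic.lintegral_comp_ofTorus (hL : 0 < L) {g : Space d → ℝ≥0∞} (hp : IsPeriodic L g)
    (hg : Measurable g) : ∫⁻ q, g (ofTorus L q) = ∫⁻ x, g x ∂cellMeasure d L := by
  conv_rhs => rw [hp.eq_comp_toTorus hL]
  exact ((measurePreserving_toTorus hL).lintegral_comp (hg.comp measurable_ofTorus)).symm

theorem IsPeriodic.integral_comp_ofTorus (hL : 0 < L) {g : Space d → ℂ} (hp : IsPeriodic L g)
    (hg : Measurable g) : ∫ q, g (ofTorus L q) = ∫ x, g x ∂cellMeasure d L := by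
  conv_rhs => rw [hp.eq_comp_toTorus hL]
  rw [← (measurePreserving_toTorus hL).map_eq]
  exact integral_map continuous_toTorus.aemeasurable
    (hg.comp measurable_ofTorus).aestronglyMeasurable

theorem IsPeriodic.comp_sub {α : Type*} {f : Space d → α} (hp : IsPeriodic L f) (y : Space d) :
    IsPeriodic L fun x => f (x - y) := fun i x => by
  simp only [add_sub_right_comm, hp i]

theorem IsPeriodic.apply_ofTorus_sub (hL : 0 < L) {α : Type*} {f : Space d → α}
    (hp : IsPeriodic L f) (y : Space d) (q : UnitAddTorus (Fin d)) :
    f (ofTorus L q - y) = f (ofTorus L (q - toTorus L y)) :=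
  hp.eq_of_toTorus_eq hL (by simp only [toTorus_sub, toTorus_ofTorus hL])

theorem IsPeriodic.lintegral_comp_sub (hL : 0 < L) {f : Space d → ℝ≥0∞} (hp : IsPeriodic L f)
    (hf : Measurable f) (y : Space d) :
    ∫⁻ x, f (x - y) ∂cellMeasure d L = ∫⁻ x, f x ∂cellMeasure d L := by
  rw [← (hp.comp_sub y).lintegral_comp_ofTorus hL (hf.comp (measurable_id.sub_const _)),
    ← hp.lintegral_comp_ofTorus hL hf]
  simp only [hp.apply_ofTorus_sub hL]
  exact lintegral_sub_right_eq_self (fun q => f (ofTorus L q)) _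

theorem IsPeriodic.integral_comp_sub (hL : 0 < L) {f : Space d → ℂ} (hp : IsPeriodic L f)
    (hf : Measurable f) (y : Space d) :
    ∫ x, f (x - y) ∂cellMeasure d L = ∫ x, f x ∂cellMeasure d L := by
  rw [← (hp.comp_sub y).integral_comp_ofTorus hL (hf.comp (measurable_id.sub_const _)),
    ← hp.integral_comp_ofTorus hL hf]
  simp only [hp.apply_ofTorus_sub hL]
  exact integral_sub_right_eq_self (fun q => f (ofTorus L q)) _

/-- The plane wave `exp (i m ⬝ x)` with wave number `m = (2 π / L) k`. -/
def planeWave {d : ℕ} (L : ℝ) (k : Fin d → ℤ) (x : Space d) : ℂ :=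
  Complex.exp (Complex.I * ((inner ℝ (waveVector L k) x : ℝ) : ℂ))

theorem planeWave_eq_mFourier (k : Fin d → ℤ) (x : Space d) :
    planeWave L k x = UnitAddTorus.mFourier k (toTorus L x) := by
  simp only [planeWave, UnitAddTorus.mFourier, ContinuousMap.coe_mk, toTorus, fourier_coe_apply]
  rw [← Complex.exp_sum]
  congr 1
  simp only [PiLp.inner_apply, waveVector, RCLike.inner_apply, conj_trivial]
  push_cast
  rw [Finset.mul_sum]
  refine Finset.sum_congr rfl fun i _ => ?_
  ring

theorem planeWave_eq_mFourier_comp (k : Fin d → ℤ) :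
    (planeWave L k : Space d → ℂ) = UnitAddTorus.mFourier k ∘ toTorus L :=
  funext (planeWave_eq_mFourier k)

theorem isPeriodic_planeWave (hL : 0 < L) (k : Fin d → ℤ) : IsPeriodic L (planeWave L k) := by
  rw [planeWave_eq_mFourier_comp]
  exact isPeriodic_comp_toTorus hL _

theorem norm_planeWave (k : Fin d → ℤ) (x : Space d) : ‖planeWave L k x‖ = 1 := by
  rw [planeWave, mul_comm, Complex.norm_exp_ofReal_mul_I]

theorem planeWave_sub (k : Fin d → ℤ) (x y : Space d) :
    planeWave L k (x - y) = planeWave L k x * planeWave L k (-y) := by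
  simp only [planeWave, ← Complex.exp_add, ← mul_add, ← Complex.ofReal_add, ← inner_add_right,
    sub_eq_add_neg]

theorem conj_planeWave (k : Fin d → ℤ) (x : Space d) :
    conj (planeWave L k x) = planeWave L k (-x) := by
  simp only [planeWave, ← Complex.exp_conj, map_mul, Complex.conj_I, Complex.conj_ofReal,
    inner_neg_right, Complex.ofReal_neg, neg_mul, mul_neg]

theorem contDiff_planeWave (k : Fin d → ℤ) : ContDiff ℝ ∞ (planeWave L k : Space d → ℂ) := by
  have : ContDiff ℝ ∞ fun x : Space d => ((inner ℝ (waveVector L k) x : ℝ) : ℂ) :=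
    Complex.ofRealCLM.contDiff.comp (contDiff_const.inner ℝ contDiff_id)
  exact (contDiff_const.mul this).cexp

theorem continuous_planeWave (k : Fin d → ℤ) : Continuous (planeWave L k : Space d → ℂ) :=
  (contDiff_planeWave k).continuous

/-- The trigonometric polynomial with coefficients `c k`, for `k` in the finite set `S`. -/
def trigPoly {d : ℕ} (L : ℝ) (S : Finset (Fin d → ℤ)) (c : (Fin d → ℤ) → ℂ) (x : Space d) : ℂ :=
  ∑ k ∈ S, c k * planeWave L k x

theorem continuous_trigPoly (S : Finset (Fin d → ℤ)) (c : (Fin d → ℤ) → ℂ) :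
    Continuous (trigPoly L S c) :=
  continuous_finsetSum _ fun k _ => continuous_const.mul (continuous_planeWave k)

theorem isPeriodic_trigPoly (hL : 0 < L) (S : Finset (Fin d → ℤ)) (c : (Fin d → ℤ) → ℂ) :
    IsPeriodic L (trigPoly L S c) := fun i x => by
  simp only [trigPoly, isPeriodic_planeWave hL _ i x]

/-- The Fourier coefficients of a complex-valued periodic function, as averages over the cell. -/
def cellFourierCoeff {d : ℕ} (L : ℝ) (f : Space d → ℂ) (k : Fin d → ℤ) : ℂ :=
  ∫ x, f x * planeWave L k (-x) ∂cellMeasure d L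

theorem fourierCoefficient_eq_cellFourierCoeff (hL : 0 < L) (f : Space d → ℝ) (k : Fin d → ℤ) :
    fourierCoefficient L f k = cellFourierCoeff L (fun x => (f x : ℂ)) k := by
  rw [fourierCoefficient, cellFourierCoeff, integral_cellMeasure hL, Complex.real_smul]
  simp only [planeWave, inner_neg_right, Complex.ofReal_neg, neg_mul, mul_neg]

theorem cellFourierCoeff_comp_toTorus (hL : 0 < L) {F : UnitAddTorus (Fin d) → ℂ}
    (hF : Measurable F) (k : Fin d → ℤ) :
    cellFourierCoeff L (F ∘ toTorus L) k = UnitAddTorus.mFourierCoeff F k := by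
  have hm : Measurable fun q => UnitAddTorus.mFourier (-k) q • F q :=
    (UnitAddTorus.mFourier (-k)).continuous.measurable.smul hF
  rw [cellFourierCoeff, UnitAddTorus.mFourierCoeff, ← (measurePreserving_toTorus hL).map_eq,
    integral_map continuous_toTorus.aemeasurable hm.aestronglyMeasurable]
  refine integral_congr_ae (ae_of_all _ fun x => ?_)
  simp only [Function.comp_apply, UnitAddTorus.mFourier_neg, ← planeWave_eq_mFourier,
    conj_planeWave, smul_eq_mul, mul_comm]

theorem cellFourierCoeff_planeWave (hL : 0 < L) (n m : Fin d → ℤ) :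
    cellFourierCoeff L (planeWave L n) m = if m = n then 1 else 0 := by
  have hbasis : ContinuousMap.toLp 2 volume ℂ (UnitAddTorus.mFourier n) =
      UnitAddTorus.mFourierBasis (d := Fin d) n := by
    rw [UnitAddTorus.coe_mFourierBasis]
  rw [planeWave_eq_mFourier_comp,
    cellFourierCoeff_comp_toTorus hL (UnitAddTorus.mFourier n).continuous.measurable,
    ← UnitAddTorus.mFourierCoeff_toLp, ← UnitAddTorus.mFourierBasis_repr, hbasis,
    HilbertBasis.repr_self, lp.single_apply]
  by_cases h : m = n
  · subst h; simp
  · simp [h]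

theorem memLp_two_of_lintegral_enorm_sq_ne_top {α E : Type*} [MeasurableSpace α]
    [NormedAddCommGroup E] {μ : Measure α} {f : α → E} (hf : AEStronglyMeasurable f μ)
    (h2 : ∫⁻ x, ‖f x‖ₑ ^ 2 ∂μ ≠ ⊤) : MemLp f 2 μ := by
  refine ⟨hf, ?_⟩
  rw [eLpNorm_lt_top_iff_lintegral_rpow_enorm_lt_top (by simp) (by simp)]
  simpa using h2.lt_top

theorem ofReal_integral_norm_sq_eq_lintegral {α : Type*} [MeasurableSpace α] {μ : Measure α}
    [IsFiniteMeasure μ] {F : α → ℂ} (hF : MemLp F 2 μ) :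
    ENNReal.ofReal (∫ q, ‖F q‖ ^ 2 ∂μ) = ∫⁻ q, ‖F q‖ₑ ^ 2 ∂μ := by
  rw [ofReal_integral_eq_lintegral_ofReal hF.integrable_norm_pow'
    (ae_of_all _ fun _ => by positivity)]
  simp only [ENNReal.ofReal_pow (norm_nonneg _), ofReal_norm]

theorem tsum_enorm_sq_mFourierCoeff {ι : Type*} [Fintype ι] {F : UnitAddTorus ι → ℂ}
    (hF : MemLp F 2) : ∑' k, ‖UnitAddTorus.mFourierCoeff F k‖ₑ ^ 2 = ∫⁻ q, ‖F q‖ₑ ^ 2 := by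
  have hcoe := hF.coeFn_toLp
  have hcoeff (k) : UnitAddTorus.mFourierCoeff (hF.toLp F) k = UnitAddTorus.mFourierCoeff F k :=
    integral_congr_ae <| hcoe.mono fun q hq => by simp only [hq]
  have hnorm : ∫ q, ‖hF.toLp F q‖ ^ 2 = ∫ q, ‖F q‖ ^ 2 :=
    integral_congr_ae <| hcoe.mono fun q hq => by simp only [hq]
  have hsum := UnitAddTorus.hasSum_sq_mFourierCoeff (hF.toLp F)
  simp only [hcoeff, hnorm] at hsum
  rw [← ofReal_integral_norm_sq_eq_lintegral hF, ← hsum.tsum_eq,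
    ENNReal.ofReal_tsum_of_nonneg (fun _ => by positivity) hsum.summable]
  simp only [ENNReal.ofReal_pow (norm_nonneg _), ofReal_norm]

theorem tsum_enorm_sq_cellFourierCoeff (hL : 0 < L) {f : Space d → ℂ} (hf : Measurable f)
    (hp : IsPeriodic L f) (h2 : ∫⁻ x, ‖f x‖ₑ ^ 2 ∂cellMeasure d L ≠ ⊤) :
    ∑' k, ‖cellFourierCoeff L f k‖ₑ ^ 2 = ∫⁻ x, ‖f x‖ₑ ^ 2 ∂cellMeasure d L := by
  have hF : Measurable (f ∘ ofTorus L) := hf.comp measurable_ofTorus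
  rw [← (hp.postcomp (‖·‖ₑ ^ 2)).lintegral_comp_ofTorus hL (hf.enorm.pow_const 2)] at h2 ⊢
  have hmem : MemLp (f ∘ ofTorus L) 2 volume :=
    memLp_two_of_lintegral_enorm_sq_ne_top hF.aestronglyMeasurable h2
  have hcoeff (k) :
      cellFourierCoeff L f k = UnitAddTorus.mFourierCoeff (f ∘ ofTorus L) k := by
    rw [← cellFourierCoeff_comp_toTorus hL hF, ← hp.eq_comp_toTorus hL]
  simp only [hcoeff]
  exact tsum_enorm_sq_mFourierCoeff hmem

theorem exists_mFourier_lintegral_lt {ι : Type*} [Fintype ι] {F : UnitAddTorus ι → ℂ}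
    (hF : MemLp F 1) {ε : ℝ≥0∞} (hε : ε ≠ 0) :
    ∃ (S : Finset (ι → ℤ)) (c : (ι → ℤ) → ℂ),
      ∫⁻ q, ‖F q - ∑ k ∈ S, c k * UnitAddTorus.mFourier k q‖ₑ < ε := by
  have hclosure : hF.toLp F ∈ closure
      (Submodule.span ℂ (range (UnitAddTorus.mFourierLp (d := ι) 1)) : Set _) := by
    rw [← Submodule.topologicalClosure_coe, UnitAddTorus.span_mFourierLp_closure_eq_top (by simp)]
    trivial
  obtain ⟨g, hg, hlt⟩ := EMetric.mem_closure_iff.1 hclosure ε (pos_iff_ne_zero.mpr hε)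
  obtain ⟨c, rfl⟩ := Finsupp.mem_span_range_iff_exists_finsupp.mp hg
  refine ⟨c.support, c, lt_of_eq_of_lt ?_ hlt⟩
  have hterm : ∀ᵐ q, ∀ k ∈ c.support, (c k • UnitAddTorus.mFourierLp (d := ι) 1 k :
      Lp ℂ 1 (volume : Measure (UnitAddTorus ι))) q = c k * UnitAddTorus.mFourier k q := by
    refine (Finset.eventually_all c.support).mpr fun k _ => ?_
    filter_upwards [Lp.coeFn_smul (c k) (UnitAddTorus.mFourierLp (d := ι) 1 k),
      UnitAddTorus.coeFn_mFourierLp (d := ι) 1 k] with q hsmul hmono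
    rw [hsmul, Pi.smul_apply, hmono, smul_eq_mul]
  rw [Lp.edist_def, eLpNorm_one_eq_lintegral_enorm]
  refine lintegral_congr_ae ?_
  filter_upwards [hF.coeFn_toLp, hterm, Lp.coeFn_finsetSum c.support
    fun k => c k • UnitAddTorus.mFourierLp (d := ι) 1 k] with q hFq hq hsum
  rw [Pi.sub_apply, hFq, Finsupp.sum, hsum, Finset.sum_apply, Finset.sum_congr rfl hq]

theorem exists_trigPoly_lintegral_lt (hL : 0 < L) {f : Space d → ℂ} (hf : Measurable f)
    (hp : IsPeriodic L f) (h1 : ∫⁻ x, ‖f x‖ₑ ∂cellMeasure d L ≠ ⊤) {ε : ℝ≥0∞} (hε : ε ≠ 0) :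
    ∃ (S : Finset (Fin d → ℤ)) (c : (Fin d → ℤ) → ℂ),
      ∫⁻ x, ‖f x - trigPoly L S c x‖ₑ ∂cellMeasure d L < ε := by
  have hmem : MemLp (f ∘ ofTorus L) 1 volume := by
    refine ⟨(hf.comp measurable_ofTorus).aestronglyMeasurable, ?_⟩
    rw [eLpNorm_one_eq_lintegral_enorm]
    exact ((hp.postcomp (‖·‖ₑ)).lintegral_comp_ofTorus hL hf.enorm).trans_lt h1.lt_top
  obtain ⟨S, c, h⟩ := exists_mFourier_lintegral_lt hmem hε
  refine ⟨S, c, ?_⟩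
  have hpd : IsPeriodic L fun x => ‖f x - trigPoly L S c x‖ₑ := fun i x => by
    simp only [hp i x, isPeriodic_trigPoly hL S c i x]
  rw [← hpd.lintegral_comp_ofTorus hL (hf.sub (continuous_trigPoly S c).measurable).enorm]
  simpa only [trigPoly, planeWave_eq_mFourier, toTorus_ofTorus hL, Function.comp_apply] using h

end Torus

section Convolution

variable {d : ℕ} {L : ℝ}

theorem isBounded_cell : Bornology.IsBounded (cell d L) :=
  ((PiLp.antilipschitzWith_ofLp 2 fun _ : Fin d => ℝ).isBounded_preimage
    (Metric.isBounded_Icc 0 fun _ => L)).subset fun _ hx => ⟨fun i => (hx i).1, fun i => (hx i).2⟩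

instance isFiniteMeasure_cellMeasure : IsFiniteMeasure (cellMeasure d L) := by
  have : IsFiniteMeasure (volume.restrict (cell d L)) :=
    ⟨by simpa using isBounded_cell.measure_lt_top⟩
  exact Measure.smul_finite _ ENNReal.ofReal_ne_top

/-- Convolution of a kernel on the whole space with a (typically periodic) function. -/
def conv {d : ℕ} (k f : Space d → ℂ) (x : Space d) : ℂ := ∫ y, k y * f (x - y)

/-- The Fourier transform of a kernel on the whole space, without normalizing factor, so that it
turns convolutions into products. -/
def kernelFourier {d : ℕ} (k : Space d → ℂ) (ξ : Space d) : ℂ :=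
  ∫ y, k y * Complex.exp (-Complex.I * ((inner ℝ ξ y : ℝ) : ℂ))

theorem kernelFourier_waveVector (k : Space d → ℂ) (m : Fin d → ℤ) :
    kernelFourier k (waveVector L m) = ∫ y, k y * planeWave L m (-y) := by
  simp only [kernelFourier, planeWave, inner_neg_right, Complex.ofReal_neg, neg_mul, mul_neg]

theorem enorm_conv_le (k f : Space d → ℂ) (x : Space d) :
    ‖conv k f x‖ₑ ≤ ∫⁻ y, ‖k y‖ₑ * ‖f (x - y)‖ₑ := by
  simpa only [conv, enorm_mul] using enorm_integral_le_lintegral_enorm (fun y => k y * f (x - y))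

@[fun_prop]
theorem measurable_conv {k f : Space d → ℂ} (hk : Measurable k) (hf : Measurable f) :
    Measurable (conv k f) :=
  (StronglyMeasurable.integral_prod_right'
    (f := fun p : Space d × Space d => k p.2 * f (p.1 - p.2))
    (Measurable.stronglyMeasurable (by fun_prop))).measurable

theorem lintegral_lintegral_enorm_mul_comp_sub (hL : 0 < L) {k f : Space d → ℂ}
    (hk : Measurable k) (hf : Measurable f) (hp : IsPeriodic L f) :
    ∫⁻ x, (∫⁻ y, ‖k y‖ₑ * ‖f (x - y)‖ₑ) ∂cellMeasure d L =
      (∫⁻ y, ‖k y‖ₑ) * ∫⁻ x, ‖f x‖ₑ ∂cellMeasure d L := by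
  rw [lintegral_lintegral_swap (by fun_prop), ← lintegral_mul_const _ hk.enorm]
  refine lintegral_congr fun y => ?_
  rw [lintegral_const_mul _ (by fun_prop)]
  exact congrArg _ ((hp.postcomp (‖·‖ₑ)).lintegral_comp_sub hL hf.enorm y)

theorem lintegral_enorm_conv_le (hL : 0 < L) {k f : Space d → ℂ} (hk : Measurable k)
    (hf : Measurable f) (hp : IsPeriodic L f) :
    ∫⁻ x, ‖conv k f x‖ₑ ∂cellMeasure d L ≤
      (∫⁻ y, ‖k y‖ₑ) * ∫⁻ x, ‖f x‖ₑ ∂cellMeasure d L := by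
  rw [← lintegral_lintegral_enorm_mul_comp_sub hL hk hf hp]
  exact lintegral_mono fun x => enorm_conv_le k f x

theorem ae_integrable_conv (hL : 0 < L) {k f : Space d → ℂ} (hk : Measurable k)
    (hki : Integrable k) (hf : Measurable f) (hp : IsPeriodic L f)
    (hfi : Integrable f (cellMeasure d L)) :
    ∀ᵐ x ∂cellMeasure d L, Integrable fun y => k y * f (x - y) := by
  have hfin : ∫⁻ x, (∫⁻ y, ‖k y‖ₑ * ‖f (x - y)‖ₑ) ∂cellMeasure d L ≠ ⊤ := by
    rw [lintegral_lintegral_enorm_mul_comp_sub hL hk hf hp]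
    exact ENNReal.mul_ne_top hki.2.ne hfi.2.ne
  have hm : Measurable fun x => ∫⁻ y, ‖k y‖ₑ * ‖f (x - y)‖ₑ :=
    Measurable.lintegral_prod_right'
      (f := fun p : Space d × Space d => ‖k p.2‖ₑ * ‖f (p.1 - p.2)‖ₑ) (by fun_prop)
  filter_upwards [ae_lt_top hm hfin] with x hx
  refine ⟨by fun_prop, ?_⟩
  simpa only [HasFiniteIntegral, enorm_mul] using hx

theorem integrable_mul_planeWave {μ : Measure (Space d)} {f : Space d → ℂ} (hf : Integrable f μ)
    (k : Fin d → ℤ) : Integrable (fun x => f x * planeWave L k (-x)) μ :=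
  hf.mul_bdd (c := 1) ((continuous_planeWave k).comp continuous_neg).aestronglyMeasurable
    (ae_of_all _ fun _ => (norm_planeWave k _).le)

theorem integrable_planeWave (k : Fin d → ℤ) : Integrable (planeWave L k) (cellMeasure d L) :=
  Integrable.of_bound (continuous_planeWave k).aestronglyMeasurable 1
    (ae_of_all _ fun _ => (norm_planeWave k _).le)

theorem integrable_trigPoly (S : Finset (Fin d → ℤ)) (c : (Fin d → ℤ) → ℂ) :
    Integrable (trigPoly L S c) (cellMeasure d L) :=
  integrable_finsetSum _ fun m _ => (integrable_planeWave m).const_mul _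

theorem cellFourierCoeff_sub {f g : Space d → ℂ} (hf : Integrable f (cellMeasure d L))
    (hg : Integrable g (cellMeasure d L)) (k : Fin d → ℤ) :
    cellFourierCoeff L (fun x => f x - g x) k =
      cellFourierCoeff L f k - cellFourierCoeff L g k := by
  simp only [cellFourierCoeff, sub_mul]
  exact integral_sub (integrable_mul_planeWave hf k) (integrable_mul_planeWave hg k)

theorem enorm_planeWave (k : Fin d → ℤ) (x : Space d) : ‖planeWave L k x‖ₑ = 1 := by
  rw [← ofReal_norm, norm_planeWave, ENNReal.ofReal_one]

theorem enorm_cellFourierCoeff_le (f : Space d → ℂ) (k : Fin d → ℤ) :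
    ‖cellFourierCoeff L f k‖ₑ ≤ ∫⁻ x, ‖f x‖ₑ ∂cellMeasure d L := by
  refine (enorm_integral_le_lintegral_enorm _).trans_eq (lintegral_congr fun y => ?_)
  rw [enorm_mul, enorm_planeWave, mul_one]

theorem cellFourierCoeff_trigPoly (hL : 0 < L) (S : Finset (Fin d → ℤ)) (c : (Fin d → ℤ) → ℂ)
    (m : Fin d → ℤ) : cellFourierCoeff L (trigPoly L S c) m = if m ∈ S then c m else 0 := by
  have hsum : cellFourierCoeff L (trigPoly L S c) m =
      ∑ k ∈ S, c k * cellFourierCoeff L (planeWave L k) m := by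
    simp only [cellFourierCoeff, trigPoly, Finset.sum_mul, mul_assoc]
    rw [integral_finsetSum _ fun k _ =>
      (integrable_mul_planeWave (integrable_planeWave k) m).const_mul _]
    simp only [integral_const_mul]
  simp only [hsum, cellFourierCoeff_planeWave hL, mul_ite, mul_one, mul_zero,
    Finset.sum_ite_eq S m c]

theorem trigPoly_sub (S : Finset (Fin d → ℤ)) (b c : (Fin d → ℤ) → ℂ) (x : Space d) :
    trigPoly L S (fun m => b m - c m) x = trigPoly L S b x - trigPoly L S c x := by
  simp only [trigPoly, sub_mul, Finset.sum_sub_distrib]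

theorem enorm_trigPoly_le (S : Finset (Fin d → ℤ)) (c : (Fin d → ℤ) → ℂ) (x : Space d) :
    ‖trigPoly L S c x‖ₑ ≤ ∑ m ∈ S, ‖c m‖ₑ := by
  simpa only [trigPoly, enorm_mul, enorm_planeWave, mul_one] using
    enorm_sum_le S fun m => c m * planeWave L m x

theorem conv_trigPoly {k : Space d → ℂ} (hki : Integrable k) (S : Finset (Fin d → ℤ))
    (c : (Fin d → ℤ) → ℂ) (x : Space d) :
    conv k (trigPoly L S c) x =
      trigPoly L S (fun m => kernelFourier k (waveVector L m) * c m) x := by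
  have hmode (m : Fin d → ℤ) (y : Space d) : k y * (c m * planeWave L m (x - y)) =
      k y * planeWave L m (-y) * (c m * planeWave L m x) := by
    rw [planeWave_sub]
    ring
  simp only [conv, trigPoly, Finset.mul_sum, hmode]
  rw [integral_finsetSum _ fun m _ => (integrable_mul_planeWave hki m).mul_const _]
  refine Finset.sum_congr rfl fun m _ => ?_
  rw [integral_mul_const, kernelFourier_waveVector, mul_assoc]

/-- The Fourier multiplier with symbol the Fourier transform of the kernel `k`, restricted to the
modes in `S`. If the transform of `k` vanishes at the other modes it is the convolution with `k`,
see `conv_ae_eq_bandMultiplier`. -/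
def bandMultiplier {d : ℕ} (L : ℝ) (S : Finset (Fin d → ℤ)) (k f : Space d → ℂ) :
    Space d → ℂ :=
  trigPoly L S fun m => kernelFourier k (waveVector L m) * cellFourierCoeff L f m

theorem lintegral_enorm_bandMultiplier_le (hL : 0 < L) (S : Finset (Fin d → ℤ))
    (k f : Space d → ℂ) :
    ∫⁻ x, ‖bandMultiplier L S k f x‖ₑ ∂cellMeasure d L ≤
      (∑ m ∈ S, ‖kernelFourier k (waveVector L m)‖ₑ) * ∫⁻ x, ‖f x‖ₑ ∂cellMeasure d L := by
  have := isProbabilityMeasure_cellMeasure (d := d) hL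
  calc ∫⁻ x, ‖bandMultiplier L S k f x‖ₑ ∂cellMeasure d L
      ≤ ∫⁻ _, ∑ m ∈ S, ‖kernelFourier k (waveVector L m)‖ₑ *
          ∫⁻ x, ‖f x‖ₑ ∂cellMeasure d L ∂cellMeasure d L := by
        refine lintegral_mono fun x => (enorm_trigPoly_le _ _ _).trans ?_
        refine Finset.sum_le_sum fun m _ => ?_
        rw [enorm_mul]
        gcongr
        exact enorm_cellFourierCoeff_le f m
    _ = _ := by rw [lintegral_const, measure_univ, mul_one, Finset.sum_mul]

theorem conv_trigPoly_eq_bandMultiplier (hL : 0 < L) {k : Space d → ℂ} (hki : Integrable k)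
    {S : Finset (Fin d → ℤ)} (hS : ∀ m, m ∉ S → kernelFourier k (waveVector L m) = 0)
    (T : Finset (Fin d → ℤ)) (c : (Fin d → ℤ) → ℂ) (x : Space d) :
    conv k (trigPoly L T c) x = bandMultiplier L S k (trigPoly L T c) x := by
  rw [conv_trigPoly hki]
  simp only [bandMultiplier, trigPoly, cellFourierCoeff_trigPoly hL]
  have hT : ∑ m ∈ T ∩ S, kernelFourier k (waveVector L m) * c m * planeWave L m x =
      ∑ m ∈ T, kernelFourier k (waveVector L m) * c m * planeWave L m x :=
    Finset.sum_subset Finset.inter_subset_left fun m hmT hm => by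
      rw [hS m fun hmS => hm (Finset.mem_inter.2 ⟨hmT, hmS⟩), zero_mul, zero_mul]
  simp only [mul_ite, ite_mul, mul_zero, zero_mul, ← hT]
  rw [Finset.inter_comm, ← Finset.filter_mem_eq_inter, Finset.sum_filter]

theorem lintegral_enorm_conv_sub_bandMultiplier_le (hL : 0 < L) {k f : Space d → ℂ}
    (hk : Measurable k) (hki : Integrable k) (hf : Measurable f) (hp : IsPeriodic L f)
    (hfi : Integrable f (cellMeasure d L)) {S : Finset (Fin d → ℤ)}
    (hS : ∀ m, m ∉ S → kernelFourier k (waveVector L m) = 0) (T : Finset (Fin d → ℤ))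
    (c : (Fin d → ℤ) → ℂ) :
    ∫⁻ x, ‖conv k f x - bandMultiplier L S k f x‖ₑ ∂cellMeasure d L ≤
      ((∫⁻ y, ‖k y‖ₑ) + ∑ m ∈ S, ‖kernelFourier k (waveVector L m)‖ₑ) *
        ∫⁻ x, ‖f x - trigPoly L T c x‖ₑ ∂cellMeasure d L := by
  set g : Space d → ℂ := fun x => f x - trigPoly L T c x
  have hpm : Measurable (trigPoly L T c) := (continuous_trigPoly T c).measurable
  have hgm : Measurable g := hf.sub hpm
  have hgp : IsPeriodic L g := fun i x => by simp only [g, hp i x, isPeriodic_trigPoly hL T c i x]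
  have hlinear : ∀ᵐ x ∂cellMeasure d L, conv k f x - bandMultiplier L S k f x =
      conv k g x - bandMultiplier L S k g x := by
    filter_upwards [ae_integrable_conv hL hk hki hf hp hfi,
      ae_integrable_conv hL hk hki hpm (isPeriodic_trigPoly hL T c) (integrable_trigPoly T c)]
      with x hfx hpx
    have hconv : conv k g x = conv k f x - conv k (trigPoly L T c) x := by
      simp only [conv, g, mul_sub, integral_sub hfx hpx]
    have hband : bandMultiplier L S k g x =
        bandMultiplier L S k f x - bandMultiplier L S k (trigPoly L T c) x := by
      simp only [bandMultiplier, g, cellFourierCoeff_sub hfi (integrable_trigPoly T c), mul_sub,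
        trigPoly_sub]
    rw [hconv, hband, conv_trigPoly_eq_bandMultiplier hL hki hS, sub_sub_sub_cancel_right]
  calc ∫⁻ x, ‖conv k f x - bandMultiplier L S k f x‖ₑ ∂cellMeasure d L
      = ∫⁻ x, ‖conv k g x - bandMultiplier L S k g x‖ₑ ∂cellMeasure d L :=
        lintegral_congr_ae (hlinear.mono fun x hx => congrArg (‖·‖ₑ) hx)
    _ ≤ ∫⁻ x, (‖conv k g x‖ₑ + ‖bandMultiplier L S k g x‖ₑ) ∂cellMeasure d L :=
        lintegral_mono fun _ => enorm_sub_le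
    _ ≤ _ := by
        rw [lintegral_add_left (by fun_prop), add_mul]
        exact add_le_add (lintegral_enorm_conv_le hL hk hgm hgp)
          (lintegral_enorm_bandMultiplier_le hL S k g)

theorem conv_ae_eq_bandMultiplier (hL : 0 < L) {k f : Space d → ℂ} (hk : Measurable k)
    (hki : Integrable k) (hf : Measurable f) (hp : IsPeriodic L f)
    (hfi : Integrable f (cellMeasure d L)) {S : Finset (Fin d → ℤ)}
    (hS : ∀ m, m ∉ S → kernelFourier k (waveVector L m) = 0) :
    conv k f =ᵐ[cellMeasure d L] bandMultiplier L S k f := by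
  set I := ∫⁻ x, ‖conv k f x - bandMultiplier L S k f x‖ₑ ∂cellMeasure d L
  set A : ℝ≥0∞ := (∫⁻ y, ‖k y‖ₑ) + ∑ m ∈ S, ‖kernelFourier k (waveVector L m)‖ₑ with hA
  have hAfin : A + 1 ≠ ⊤ := by
    simp [hA, hki.2.ne, ENNReal.sum_eq_top]
  have hzero : I = 0 := by
    by_contra hI
    obtain ⟨T, c, hTc⟩ := exists_trigPoly_lintegral_lt hL hf hp hfi.2.ne
      (ENNReal.div_pos hI hAfin).ne'
    rw [ENNReal.lt_div_iff_mul_lt (.inl (by simp)) (.inl hAfin), mul_comm] at hTc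
    have hle := lintegral_enorm_conv_sub_bandMultiplier_le hL hk hki hf hp hfi hS T c
    exact hTc.not_ge (hle.trans (mul_le_mul_left le_self_add _))
  have hmeas : Measurable fun x => ‖conv k f x - bandMultiplier L S k f x‖ₑ :=
    ((measurable_conv hk hf).sub (continuous_trigPoly _ _).measurable).enorm
  filter_upwards [(lintegral_eq_zero_iff hmeas).1 hzero] with x hx
  exact sub_eq_zero.1 (enorm_eq_zero.1 hx)

end Convolution

section FixedTime

variable {d : ℕ} {L : ℝ}

theorem IsPeriodic.mul {f g : Space d → ℂ} (hf : IsPeriodic L f) (hg : IsPeriodic L g) :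
    IsPeriodic L fun x => f x * g x :=
  fun i x => congrArg₂ (· * ·) (hf i x) (hg i x)

theorem planeWave_neg (k : Fin d → ℤ) (x : Space d) : planeWave L k (-x) = planeWave L (-k) x := by
  have hneg : waveVector L (-k) = -waveVector L k := by
    ext i
    simp [waveVector]
  rw [planeWave, planeWave, hneg, inner_neg_right, inner_neg_left]

theorem cellFourierCoeff_comp_sub (hL : 0 < L) {f : Space d → ℂ} (hf : Measurable f)
    (hp : IsPeriodic L f) (y : Space d) (k : Fin d → ℤ) :
    cellFourierCoeff L (fun x => f (x - y)) k = planeWave L k (-y) * cellFourierCoeff L f k := by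
  have hwave : IsPeriodic L fun x : Space d => planeWave L k (-x) := by
    simp only [planeWave_neg]
    exact isPeriodic_planeWave hL _
  rw [cellFourierCoeff, cellFourierCoeff, ← (hp.mul hwave).integral_comp_sub hL
    (hf.mul ((continuous_planeWave k).measurable.comp measurable_neg)) y, ← integral_const_mul]
  congr 1
  ext x
  rw [show -x = -(x - y) - y by abel, planeWave_sub]
  ring

theorem norm_planeWave_sub_one_le {s : ℝ} (hs : s ∈ Icc (0 : ℝ) 1) (k : Fin d → ℤ) (y : Space d) :
    ‖planeWave L k (-y) - 1‖ ≤ 2 * (‖waveVector L k‖ * ‖y‖) ^ s := by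
  set b := ‖waveVector L k‖ * ‖y‖
  have hb0 : 0 ≤ b := by positivity
  have hlinear : ‖planeWave L k (-y) - 1‖ ≤ b := by
    refine Real.norm_exp_I_mul_ofReal_sub_one_le.trans ((abs_real_inner_le_norm _ _).trans_eq ?_)
    rw [norm_neg]
  have hbounded : ‖planeWave L k (-y) - 1‖ ≤ 2 := by
    refine (norm_sub_le _ _).trans_eq ?_
    rw [norm_planeWave, norm_one]
    norm_num
  rcases le_total b 1 with h | h
  · have hpow : b ≤ b ^ s := by simpa using Real.rpow_le_rpow_of_exponent_ge' hb0 h hs.1 hs.2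
    linarith
  · have hpow : 1 ≤ b ^ s := Real.one_le_rpow h hs.1
    linarith

theorem lintegral_enorm_le_sqrt {E : Type*} [NormedAddCommGroup E] [MeasurableSpace E]
    [BorelSpace E] (hL : 0 < L) {f : Space d → E} (hf : Measurable f) :
    ∫⁻ x, ‖f x‖ₑ ∂cellMeasure d L ≤ (∫⁻ x, ‖f x‖ₑ ^ 2 ∂cellMeasure d L) ^ (1 / 2 : ℝ) := by
  have := isProbabilityMeasure_cellMeasure (d := d) hL
  simpa using ENNReal.lintegral_mul_le_Lp_mul_Lq (cellMeasure d L) Real.HolderConjugate.two_two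
    (f := fun x => ‖f x‖ₑ) (g := fun _ => 1) hf.enorm.aemeasurable aemeasurable_const

theorem integrable_of_lintegral_enorm_sq_ne_top {E : Type*} [NormedAddCommGroup E] {f : Space d → E}
    (hf : AEStronglyMeasurable f (cellMeasure d L))
    (h2 : ∫⁻ x, ‖f x‖ₑ ^ 2 ∂cellMeasure d L ≠ ⊤) : Integrable f (cellMeasure d L) :=
  (memLp_two_of_lintegral_enorm_sq_ne_top hf h2).integrable one_le_two

theorem lintegral_enorm_sq_sub_ne_top {f g : Space d → ℂ} (hf : Measurable f) (hg : Measurable g)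
    (hf2 : ∫⁻ x, ‖f x‖ₑ ^ 2 ∂cellMeasure d L ≠ ⊤) (hg2 : ∫⁻ x, ‖g x‖ₑ ^ 2 ∂cellMeasure d L ≠ ⊤) :
    ∫⁻ x, ‖f x - g x‖ₑ ^ 2 ∂cellMeasure d L ≠ ⊤ := by
  have h := ((memLp_two_of_lintegral_enorm_sq_ne_top hf.aestronglyMeasurable hf2).sub
    (memLp_two_of_lintegral_enorm_sq_ne_top hg.aestronglyMeasurable hg2)).2
  rw [eLpNorm_lt_top_iff_lintegral_rpow_enorm_lt_top (by simp) (by simp)] at h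
  simpa using h.ne

theorem lintegral_enorm_sq_translate_sub_le (hL : 0 < L) {s : ℝ} (hs : s ∈ Icc (0 : ℝ) 1)
    {f : Space d → ℂ} (hf : Measurable f) (hp : IsPeriodic L f)
    (h2 : ∫⁻ x, ‖f x‖ₑ ^ 2 ∂cellMeasure d L ≠ ⊤) (y : Space d) :
    ∫⁻ x, ‖f (x - y) - f x‖ₑ ^ 2 ∂cellMeasure d L ≤ ENNReal.ofReal ((2 * ‖y‖ ^ s) ^ 2) *
      ∑' k, ENNReal.ofReal (‖waveVector L k‖ ^ (2 * s)) * ‖cellFourierCoeff L f k‖ₑ ^ 2 := by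
  have hfy : Measurable fun x => f (x - y) := hf.comp (measurable_id.sub_const y)
  have h2y : ∫⁻ x, ‖f (x - y)‖ₑ ^ 2 ∂cellMeasure d L ≠ ⊤ := by
    rwa [(hp.postcomp (‖·‖ₑ ^ 2)).lintegral_comp_sub hL (hf.enorm.pow_const 2)]
  have hpd : IsPeriodic L fun x => f (x - y) - f x :=
    fun i x => congrArg₂ (· - ·) (hp.comp_sub y i x) (hp i x)
  have hcoeff (k : Fin d → ℤ) : cellFourierCoeff L (fun x => f (x - y) - f x) k =
      (planeWave L k (-y) - 1) * cellFourierCoeff L f k := by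
    rw [cellFourierCoeff_sub
      (integrable_of_lintegral_enorm_sq_ne_top hfy.aestronglyMeasurable h2y)
      (integrable_of_lintegral_enorm_sq_ne_top hf.aestronglyMeasurable h2),
      cellFourierCoeff_comp_sub hL hf hp, ← sub_one_mul]
  rw [← tsum_enorm_sq_cellFourierCoeff hL (f := fun x => f (x - y) - f x) (hfy.sub hf) hpd
    (lintegral_enorm_sq_sub_ne_top hfy hf h2y h2), ← ENNReal.tsum_mul_left]
  refine ENNReal.tsum_le_tsum fun k => ?_
  rw [hcoeff, enorm_mul, mul_pow, ← mul_assoc]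
  gcongr
  rw [← ENNReal.ofReal_mul (by positivity), ← ofReal_norm, ← ENNReal.ofReal_pow (norm_nonneg _)]
  refine ENNReal.ofReal_le_ofReal ?_
  refine (pow_le_pow_left₀ (norm_nonneg _) (norm_planeWave_sub_one_le hs k y) 2).trans_eq ?_
  rw [Real.mul_rpow (norm_nonneg _) (norm_nonneg _), two_mul s,
    Real.rpow_add_of_nonneg (norm_nonneg _) hs.1 hs.1]
  ring

theorem enorm_sq_eq_sum (v : Space d) : ‖v‖ₑ ^ 2 = ∑ i, ‖(v i : ℂ)‖ₑ ^ 2 := by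
  rw [← ofReal_norm, ← ENNReal.ofReal_pow (norm_nonneg _), EuclideanSpace.norm_sq_eq,
    ENNReal.ofReal_sum_of_nonneg fun _ _ => by positivity]
  refine Finset.sum_congr rfl fun i _ => ?_
  rw [ENNReal.ofReal_pow (norm_nonneg _), ← ofReal_norm, Complex.norm_real]

theorem measurable_coord {v : Space d → Space d} (hv : Measurable v) (i : Fin d) :
    Measurable fun x => (v x i : ℂ) := by
  fun_prop

theorem lintegral_enorm_sq_coord_ne_top {v : Space d → Space d}
    (h2 : ∫⁻ x, ‖v x‖ₑ ^ 2 ∂cellMeasure d L ≠ ⊤) (i : Fin d) :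
    ∫⁻ x, ‖(v x i : ℂ)‖ₑ ^ 2 ∂cellMeasure d L ≠ ⊤ := by
  refine ne_top_of_le_ne_top h2 (lintegral_mono fun x => ?_)
  rw [enorm_sq_eq_sum]
  exact Finset.single_le_sum (f := fun i => ‖(v x i : ℂ)‖ₑ ^ 2) (fun _ _ => bot_le)
    (Finset.mem_univ i)

theorem lintegral_enorm_sq_translate_sub_le_fracGradSq (hL : 0 < L) {s : ℝ}
    (hs : s ∈ Icc (0 : ℝ) 1) {v : Space d → Space d} (hv : Measurable v) (hp : IsPeriodic L v)
    (h2 : ∫⁻ x, ‖v x‖ₑ ^ 2 ∂cellMeasure d L ≠ ⊤) (y : Space d) :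
    ∫⁻ x, ‖v (x - y) - v x‖ₑ ^ 2 ∂cellMeasure d L ≤ ENNReal.ofReal ((2 * ‖y‖ ^ s) ^ 2) *
      fracGradSq L s v := by
  simp only [enorm_sq_eq_sum, PiLp.sub_apply, Complex.ofReal_sub, fracGradSq, Finset.mul_sum]
  rw [lintegral_finsetSum _ fun i _ => by fun_prop,
    Summable.tsum_finsetSum fun _ _ => ENNReal.summable, Finset.mul_sum]
  refine Finset.sum_le_sum fun i _ => ?_
  simp only [fourierCoefficient_eq_cellFourierCoeff hL]
  exact lintegral_enorm_sq_translate_sub_le hL hs (measurable_coord hv i)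
    (hp.postcomp fun z => (z i : ℂ)) (lintegral_enorm_sq_coord_ne_top h2 i) y

theorem hasFDerivAt_planeWave (k : Fin d → ℤ) (x : Space d) :
    HasFDerivAt (planeWave L k)
      ((Complex.I * planeWave L k x) • Complex.ofRealCLM.comp (innerSL ℝ (waveVector L k))) x := by
  have hphase : HasFDerivAt (fun x : Space d => ((inner ℝ (waveVector L k) x : ℝ) : ℂ))
      (Complex.ofRealCLM.comp (innerSL ℝ (waveVector L k))) x :=
    (Complex.ofRealCLM.comp (innerSL ℝ (waveVector L k))).hasFDerivAt
  convert! (hphase.const_mul Complex.I).cexp using 1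
  rw [smul_smul, mul_comm]
  rfl

theorem gradient_apply_eq {ψ : Space d → ℝ} {ψ' : Space d →L[ℝ] ℝ} {x : Space d}
    (h : HasFDerivAt ψ ψ' x) (i : Fin d) :
    gradient ψ x i = ψ' (EuclideanSpace.single i 1) := by
  have hinner : inner ℝ (gradient ψ x) (EuclideanSpace.single i 1) =
      ψ' (EuclideanSpace.single i 1) := by
    rw [gradient, h.fderiv, InnerProductSpace.toDual_symm_apply]
  rw [← hinner, EuclideanSpace.inner_single_right]
  simp

/-- The real part of a trigonometric polynomial: the test functions in space from which all
information is extracted. -/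
def reTrigPoly {d : ℕ} (L : ℝ) (S : Finset (Fin d → ℤ)) (c : (Fin d → ℤ) → ℂ) (x : Space d) : ℝ :=
  (trigPoly L S c x).re

theorem contDiff_reTrigPoly (S : Finset (Fin d → ℤ)) (c : (Fin d → ℤ) → ℂ) :
    ContDiff ℝ ∞ (reTrigPoly L S c) :=
  Complex.reCLM.contDiff.comp (ContDiff.sum fun k _ => contDiff_const.mul (contDiff_planeWave k))

theorem isPeriodic_reTrigPoly (hL : 0 < L) (S : Finset (Fin d → ℤ)) (c : (Fin d → ℤ) → ℂ) :
    IsPeriodic L (reTrigPoly L S c) :=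
  (isPeriodic_trigPoly hL S c).postcomp Complex.re

theorem hasFDerivAt_reTrigPoly (S : Finset (Fin d → ℤ)) (c : (Fin d → ℤ) → ℂ) (x : Space d) :
    HasFDerivAt (reTrigPoly L S c) (Complex.reCLM.comp (∑ k ∈ S, c k •
      ((Complex.I * planeWave L k x) •
        Complex.ofRealCLM.comp (innerSL ℝ (waveVector L k))))) x :=
  Complex.reCLM.hasFDerivAt.comp x
    (HasFDerivAt.fun_sum fun k _ => (hasFDerivAt_planeWave k x).const_mul (c k))

theorem gradient_reTrigPoly (S : Finset (Fin d → ℤ)) (c : (Fin d → ℤ) → ℂ) (x : Space d)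
    (i : Fin d) :
    gradient (reTrigPoly L S c) x i =
      reTrigPoly L S (fun k => c k * (Complex.I * (waveVector L k i : ℝ))) x := by
  rw [gradient_apply_eq (hasFDerivAt_reTrigPoly S c x), reTrigPoly, trigPoly]
  simp only [ContinuousLinearMap.comp_apply, Complex.reCLM_apply, _root_.sum_apply,
    _root_.smul_apply, smul_eq_mul, innerSL_apply_apply, Complex.ofRealCLM_apply,
    EuclideanSpace.inner_single_right, one_mul, conj_trivial]
  congr 1
  refine Finset.sum_congr rfl fun k _ => ?_
  ring

theorem integral_mul_re_const_mul {α : Type*} [MeasurableSpace α] {μ : Measure α} {g : α → ℝ}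
    {z : α → ℂ} (hz : Integrable (fun x => (g x : ℂ) * z x) μ) (c : ℂ) :
    ∫ x, g x * (c * z x).re ∂μ = (c * ∫ x, (g x : ℂ) * z x ∂μ).re := by
  have hre := integral_re (hz.const_mul c)
  simp only [RCLike.re_eq_complex_re] at hre
  rw [← integral_const_mul, ← hre]
  simp only [mul_left_comm c, Complex.re_ofReal_mul]

theorem IsWeakGradient.cellFourierCoeff_eq (hL : 0 < L) {f : Space d → ℝ} {g : Space d → Space d}
    (h : IsWeakGradient L f g) (hf : Integrable (fun x => (f x : ℂ)) (cellMeasure d L))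
    (hg : ∀ i, Integrable (fun x => (g x i : ℂ)) (cellMeasure d L)) (k : Fin d → ℤ) (i : Fin d) :
    cellFourierCoeff L (fun x => (g x i : ℂ)) k =
      Complex.I * (waveVector L k i : ℝ) * cellFourierCoeff L (fun x => (f x : ℂ)) k := by
  have hneg : waveVector L (-k) i = -waveVector L k i := by simp [waveVector]
  have htest (c : ℂ) : (c * (Complex.I * (waveVector L (-k) i : ℝ)) *
      cellFourierCoeff L (fun x => (f x : ℂ)) k).re =
        -(c * cellFourierCoeff L (fun x => (g x i : ℂ)) k).re := by
    have hweak := h (reTrigPoly L {-k} fun _ => c) (contDiff_reTrigPoly _ _)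
      (isPeriodic_reTrigPoly hL _ _) i
    simp_rw [gradient_reTrigPoly] at hweak
    rw [setIntegral_cell hL, setIntegral_cell hL, ← smul_neg,
      smul_right_inj (by positivity : L ^ d ≠ 0)] at hweak
    simp only [reTrigPoly, trigPoly, Finset.sum_singleton, ← planeWave_neg] at hweak
    rwa [integral_mul_re_const_mul (integrable_mul_planeWave hf k),
      integral_mul_re_const_mul (integrable_mul_planeWave (hg i) k)] at hweak
  rw [hneg] at htest
  have hre := htest 1
  have him := htest Complex.I
  apply Complex.ext
  · simp at hre ⊢; linarith
  · simp at him ⊢; linarith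

theorem ofReal_norm_waveVector_rpow_two (k : Fin d → ℤ) :
    ENNReal.ofReal (‖waveVector L k‖ ^ (2 * (1 : ℝ))) =
      ∑ i, ‖Complex.I * ((waveVector L k i : ℝ) : ℂ)‖ₑ ^ 2 := by
  rw [mul_one, Real.rpow_ofNat, ENNReal.ofReal_pow (norm_nonneg _), ofReal_norm, enorm_sq_eq_sum]
  refine Finset.sum_congr rfl fun i _ => ?_
  rw [enorm_mul, ← ofReal_norm Complex.I, Complex.norm_I, ENNReal.ofReal_one, one_mul]

theorem IsWeakGradient.tsum_eq (hL : 0 < L) {f : Space d → ℝ} {g : Space d → Space d}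
    (h : IsWeakGradient L f g) (hf : Integrable (fun x => (f x : ℂ)) (cellMeasure d L))
    (hgm : Measurable g) (hgp : IsPeriodic L g) (hg2 : ∫⁻ x, ‖g x‖ₑ ^ 2 ∂cellMeasure d L ≠ ⊤) :
    ∑' k, ENNReal.ofReal (‖waveVector L k‖ ^ (2 * (1 : ℝ))) *
        ‖cellFourierCoeff L (fun x => (f x : ℂ)) k‖ₑ ^ 2 =
      ∫⁻ x, ‖g x‖ₑ ^ 2 ∂cellMeasure d L := by
  have hgi (i : Fin d) : Integrable (fun x => (g x i : ℂ)) (cellMeasure d L) :=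
    integrable_of_lintegral_enorm_sq_ne_top (measurable_coord hgm i).aestronglyMeasurable
      (lintegral_enorm_sq_coord_ne_top hg2 i)
  simp only [enorm_sq_eq_sum (g _), ofReal_norm_waveVector_rpow_two, Finset.sum_mul]
  rw [lintegral_finsetSum _ fun i _ => (measurable_coord hgm i).enorm.pow_const 2,
    Summable.tsum_finsetSum fun _ _ => ENNReal.summable]
  refine Finset.sum_congr rfl fun i _ => ?_
  rw [← tsum_enorm_sq_cellFourierCoeff hL (measurable_coord hgm i)
    (hgp.postcomp fun z => (z i : ℂ)) (lintegral_enorm_sq_coord_ne_top hg2 i)]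
  simp only [h.cellFourierCoeff_eq hL hf hgi, enorm_mul, mul_pow]

theorem ofReal_sq_mul_rpow_half {a : ℝ} (ha : 0 ≤ a) (b : ℝ≥0∞) :
    (ENNReal.ofReal (a ^ 2) * b) ^ (1 / 2 : ℝ) = ENNReal.ofReal a * b ^ (1 / 2 : ℝ) := by
  rw [ENNReal.mul_rpow_of_nonneg _ _ (by norm_num), ENNReal.ofReal_pow ha, ← ENNReal.rpow_natCast,
    ← ENNReal.rpow_mul]
  norm_num

theorem enorm_conv_le_of_integral_eq_zero {k f : Space d → ℂ} {x : Space d} (hki : Integrable k)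
    (hk0 : ∫ y, k y = 0) (hx : Integrable fun y => k y * f (x - y)) :
    ‖conv k f x‖ₑ ≤ ∫⁻ y, ‖k y‖ₑ * ‖f (x - y) - f x‖ₑ := by
  have hconv : conv k f x = ∫ y, k y * (f (x - y) - f x) := by
    simp only [mul_sub]
    rw [integral_sub hx (hki.mul_const _), integral_mul_const, hk0, zero_mul, sub_zero, conv]
  rw [hconv]
  refine (enorm_integral_le_lintegral_enorm _).trans_eq ?_
  simp only [enorm_mul]

theorem lintegral_enorm_conv_le_gradient (hL : 0 < L) {f : Space d → ℝ} {g : Space d → Space d}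
    (h : IsWeakGradient L f g) (hfm : Measurable f) (hfp : IsPeriodic L f)
    (hf2 : ∫⁻ x, ‖f x‖ₑ ^ 2 ∂cellMeasure d L ≠ ⊤)
    (hgm : Measurable g) (hgp : IsPeriodic L g) (hg2 : ∫⁻ x, ‖g x‖ₑ ^ 2 ∂cellMeasure d L ≠ ⊤)
    {k : Space d → ℂ} (hk : Measurable k) (hki : Integrable k) (hk0 : ∫ y, k y = 0) :
    ∫⁻ x, ‖conv k (fun x => (f x : ℂ)) x‖ₑ ∂cellMeasure d L ≤
      (∫⁻ y, ‖k y‖ₑ * ENNReal.ofReal (2 * ‖y‖)) *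
        (∫⁻ x, ‖g x‖ₑ ^ 2 ∂cellMeasure d L) ^ (1 / 2 : ℝ) := by
  set F : Space d → ℂ := fun x => (f x : ℂ) with hF
  have hFm : Measurable F := Complex.measurable_ofReal.comp hfm
  have hFp : IsPeriodic L F := hfp.postcomp _
  have hF2 : ∫⁻ x, ‖F x‖ₑ ^ 2 ∂cellMeasure d L ≠ ⊤ := by
    simpa only [hF, ← ofReal_norm, Complex.norm_real] using hf2
  have hFi := integrable_of_lintegral_enorm_sq_ne_top hFm.aestronglyMeasurable hF2
  have hconv : ∀ᵐ x ∂cellMeasure d L, ‖conv k F x‖ₑ ≤ ∫⁻ y, ‖k y‖ₑ * ‖F (x - y) - F x‖ₑ :=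
    (ae_integrable_conv hL hk hki hFm hFp hFi).mono fun x hx =>
      enorm_conv_le_of_integral_eq_zero hki hk0 hx
  refine (lintegral_mono_ae hconv).trans ?_
  rw [lintegral_lintegral_swap (by fun_prop), ← lintegral_mul_const _ (by fun_prop)]
  refine lintegral_mono fun y => ?_
  rw [lintegral_const_mul _ (by fun_prop), mul_assoc]
  gcongr
  refine (lintegral_enorm_le_sqrt hL (by fun_prop)).trans ?_
  refine (ENNReal.rpow_le_rpow (lintegral_enorm_sq_translate_sub_le hL (s := 1) (by simp) hFm hFp
    hF2 y) (by norm_num)).trans_eq ?_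
  rw [Real.rpow_one, ofReal_sq_mul_rpow_half (by positivity), h.tsum_eq hL hFi hgm hgp hg2]

end FixedTime

section Transport

variable {d : ℕ} {L : ℝ}

theorem enorm_ofReal_inner_le (v w : Space d) : ‖((inner ℝ v w : ℝ) : ℂ)‖ₑ ≤ ‖v‖ₑ * ‖w‖ₑ := by
  rw [← ofReal_norm, Complex.norm_real, ← ofReal_norm v, ← ofReal_norm w,
    ← ENNReal.ofReal_mul (norm_nonneg _)]
  exact ENNReal.ofReal_le_ofReal (norm_inner_le_norm v w)

theorem measurable_ofReal_inner {v w : Space d → Space d} (hv : Measurable v) (hw : Measurable w) :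
    Measurable fun x => ((inner ℝ (v x) (w x) : ℝ) : ℂ) :=
  Complex.measurable_ofReal.comp (hv.inner hw)

theorem lintegral_enorm_mul_enorm_le {v w : Space d → Space d} (hv : Measurable v)
    (hw : Measurable w) :
    ∫⁻ x, ‖v x‖ₑ * ‖w x‖ₑ ∂cellMeasure d L ≤ (∫⁻ x, ‖v x‖ₑ ^ 2 ∂cellMeasure d L) ^ (1 / 2 : ℝ) *
      (∫⁻ x, ‖w x‖ₑ ^ 2 ∂cellMeasure d L) ^ (1 / 2 : ℝ) := by
  simpa using ENNReal.lintegral_mul_le_Lp_mul_Lq (cellMeasure d L) Real.HolderConjugate.two_two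
    hv.enorm.aemeasurable hw.enorm.aemeasurable

theorem integrable_ofReal_inner {v w : Space d → Space d} (hv : Measurable v) (hw : Measurable w)
    (hv2 : ∫⁻ x, ‖v x‖ₑ ^ 2 ∂cellMeasure d L ≠ ⊤) (hw2 : ∫⁻ x, ‖w x‖ₑ ^ 2 ∂cellMeasure d L ≠ ⊤) :
    Integrable (fun x => ((inner ℝ (v x) (w x) : ℝ) : ℂ)) (cellMeasure d L) := by
  refine ⟨(measurable_ofReal_inner hv hw).aestronglyMeasurable,
    ((lintegral_mono fun x => enorm_ofReal_inner_le _ _).trans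
      (lintegral_enorm_mul_enorm_le hv hw)).trans_lt ?_⟩
  exact ENNReal.mul_lt_top (ENNReal.rpow_lt_top_of_nonneg (by norm_num) hv2)
    (ENNReal.rpow_lt_top_of_nonneg (by norm_num) hw2)

theorem lintegral_commutator_le (hL : 0 < L) {s : ℝ} (hs : s ∈ Icc (0 : ℝ) 1)
    {u g : Space d → Space d} (hu : Measurable u) (hup : IsPeriodic L u)
    (hu2 : ∫⁻ x, ‖u x‖ₑ ^ 2 ∂cellMeasure d L ≠ ⊤) (hg : Measurable g) (hgp : IsPeriodic L g)
    {k : Space d → ℂ} (hk : Measurable k) :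
    ∫⁻ x, (∫⁻ y, ‖k y‖ₑ * (‖u (x - y) - u x‖ₑ * ‖g (x - y)‖ₑ)) ∂cellMeasure d L ≤
      (∫⁻ y, ‖k y‖ₑ * ENNReal.ofReal (2 * ‖y‖ ^ s)) * fracGradSq L s u ^ (1 / 2 : ℝ) *
        (∫⁻ x, ‖g x‖ₑ ^ 2 ∂cellMeasure d L) ^ (1 / 2 : ℝ) := by
  have : 0 ≤ s := hs.1
  rw [lintegral_lintegral_swap (by fun_prop), mul_assoc, ← lintegral_mul_const _ (by fun_prop)]
  refine lintegral_mono fun y => ?_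
  rw [lintegral_const_mul _ (by fun_prop), mul_assoc]
  gcongr
  refine (lintegral_enorm_mul_enorm_le (v := fun x => u (x - y) - u x) (w := fun x => g (x - y))
    (by fun_prop) (by fun_prop)).trans ?_
  rw [(hgp.postcomp (‖·‖ₑ ^ 2)).lintegral_comp_sub hL (hg.enorm.pow_const 2), ← mul_assoc]
  gcongr
  refine (ENNReal.rpow_le_rpow (lintegral_enorm_sq_translate_sub_le_fracGradSq hL hs hu hup hu2 y)
    (by norm_num)).trans_eq ?_
  rw [ofReal_sq_mul_rpow_half (by positivity)]

theorem norm_reTrigPoly_le (S : Finset (Fin d → ℤ)) (c : (Fin d → ℤ) → ℂ) (x : Space d) :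
    ‖reTrigPoly L S c x‖ ≤ ∑ m ∈ S, ‖c m‖ := by
  refine (Complex.abs_re_le_norm _).trans ((norm_sum_le _ _).trans_eq ?_)
  simp only [norm_mul, norm_planeWave, mul_one]

theorem integrable_inner_gradient_reTrigPoly {u : Space d → Space d}
    (hu : Integrable u (cellMeasure d L)) (S : Finset (Fin d → ℤ)) (c : (Fin d → ℤ) → ℂ) :
    Integrable (fun x => inner ℝ (u x) (gradient (reTrigPoly L S c) x)) (cellMeasure d L) := by
  simp only [PiLp.inner_apply, RCLike.inner_apply, conj_trivial, gradient_reTrigPoly]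
  exact integrable_finsetSum _ fun i _ => ((EuclideanSpace.proj (𝕜 := ℝ) i).integrable_comp hu
    ).bdd_mul (contDiff_reTrigPoly _ _).continuous.aestronglyMeasurable
      (ae_of_all _ (norm_reTrigPoly_le _ _))

/-- The smoothing of a real function by a kernel `k` whose Fourier transform vanishes off the finite
set `S` of frequencies, written as a trigonometric polynomial so as to be smooth by construction. -/
def reBandMultiplier {d : ℕ} (L : ℝ) (S : Finset (Fin d → ℤ)) (k : Space d → ℂ)
    (f : Space d → ℝ) : Space d → ℝ :=
  reTrigPoly L S fun m =>
    kernelFourier k (waveVector L m) * cellFourierCoeff L (fun x => (f x : ℂ)) m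

theorem reBandMultiplier_ae_eq (hL : 0 < L) {k : Space d → ℂ} (hk : Measurable k)
    (hki : Integrable k) {f : Space d → ℝ} (hf : Measurable f) (hp : IsPeriodic L f)
    (hfi : Integrable (fun x => (f x : ℂ)) (cellMeasure d L)) {S : Finset (Fin d → ℤ)}
    (hS : ∀ m, m ∉ S → kernelFourier k (waveVector L m) = 0) :
    ∀ᵐ x ∂cellMeasure d L, reBandMultiplier L S k f x = (conv k (fun x => (f x : ℂ)) x).re :=
  (conv_ae_eq_bandMultiplier hL hk hki (Complex.measurable_ofReal.comp hf) (hp.postcomp _) hfi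
    hS).mono fun _ hx => (congrArg Complex.re hx).symm

theorem gradient_reBandMultiplier_ae_eq (hL : 0 < L) {θ : Space d → ℝ} {g : Space d → Space d}
    (h : IsWeakGradient L θ g) (hθ : Integrable (fun x => (θ x : ℂ)) (cellMeasure d L))
    (hg : Measurable g) (hgp : IsPeriodic L g)
    (hgi : ∀ i, Integrable (fun x => (g x i : ℂ)) (cellMeasure d L))
    {k : Space d → ℂ} (hk : Measurable k) (hki : Integrable k) {S : Finset (Fin d → ℤ)}
    (hS : ∀ m, m ∉ S → kernelFourier k (waveVector L m) = 0) :
    ∀ᵐ x ∂cellMeasure d L, ∀ i,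
      gradient (reBandMultiplier L S k θ) x i = (conv k (fun x => (g x i : ℂ)) x).re := by
  refine ae_all_iff.mpr fun i => ?_
  filter_upwards [conv_ae_eq_bandMultiplier hL hk hki (measurable_coord hg i)
    (hgp.postcomp fun z => (z i : ℂ)) (hgi i) hS] with x hx
  rw [reBandMultiplier, gradient_reTrigPoly, hx, reTrigPoly, bandMultiplier]
  simp only [h.cellFourierCoeff_eq hL hθ hgi, mul_assoc, mul_left_comm, mul_comm]

theorem gradient_comp {F : Type*} [NormedAddCommGroup F] [InnerProductSpace ℝ F] [CompleteSpace F]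
    {B : ℝ → ℝ} {w : F → ℝ} {x : F} (hB : DifferentiableAt ℝ B (w x))
    (hw : DifferentiableAt ℝ w x) : gradient (B ∘ w) x = deriv B (w x) • gradient w x := by
  rw [gradient, (hB.hasDerivAt.comp_hasFDerivAt x hw.hasFDerivAt).fderiv, map_smulₛₗ, gradient]
  rfl

theorem WeakDivFree.integral_deriv_comp_mul_inner_gradient (hL : 0 < L) {u : Space d → Space d}
    (hdiv : WeakDivFree L u) {B : ℝ → ℝ} (hB : ContDiff ℝ ∞ B) {w : Space d → ℝ}
    (hw : ContDiff ℝ ∞ w) (hp : IsPeriodic L w) :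
    ∫ x, deriv B (w x) * inner ℝ (u x) (gradient w x) ∂cellMeasure d L = 0 := by
  have hzero := hdiv (B ∘ w) (hB.comp hw) (hp.postcomp B)
  rw [setIntegral_cell hL, smul_eq_zero] at hzero
  simpa only [gradient_comp (hB.differentiable (by simp) _) (hw.differentiable (by simp) _),
    inner_smul_right] using hzero.resolve_left (by positivity)

theorem ofReal_mul_inner_eq_sum (a : ℂ) (v w : Space d) :
    a * ((inner ℝ v w : ℝ) : ℂ) = ∑ i, (v i : ℂ) * (a * (w i : ℂ)) := by
  simp only [PiLp.inner_apply, RCLike.inner_apply, conj_trivial, Complex.ofReal_sum,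
    Complex.ofReal_mul, Finset.mul_sum]
  exact Finset.sum_congr rfl fun i _ => by ring

theorem enorm_re_sub_inner_le {u g : Space d → Space d} {k : Space d → ℂ} {x v : Space d}
    (hug : Integrable fun y => k y * ((inner ℝ (u (x - y)) (g (x - y)) : ℝ) : ℂ))
    (hg : ∀ i, Integrable fun y => k y * (g (x - y) i : ℂ))
    (hv : ∀ i, v i = (conv k (fun x => (g x i : ℂ)) x).re) :
    ‖(conv k (fun x => ((inner ℝ (u x) (g x) : ℝ) : ℂ)) x).re - inner ℝ (u x) v‖ₑ ≤
      ∫⁻ y, ‖k y‖ₑ * (‖u (x - y) - u x‖ₑ * ‖g (x - y)‖ₑ) := by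
  have hfrozen : inner ℝ (u x) v =
      (∫ y, k y * ((inner ℝ (u x) (g (x - y)) : ℝ) : ℂ)).re := by
    simp only [ofReal_mul_inner_eq_sum]
    rw [integral_finsetSum _ fun i _ => (hg i).const_mul _, PiLp.inner_apply, Complex.re_sum]
    refine Finset.sum_congr rfl fun i _ => ?_
    rw [integral_const_mul, Complex.re_ofReal_mul, hv i, conv]
    simp [mul_comm]
  have hint : Integrable fun y => k y * ((inner ℝ (u x) (g (x - y)) : ℝ) : ℂ) := by
    simp only [ofReal_mul_inner_eq_sum]
    exact integrable_finsetSum _ fun i _ => (hg i).const_mul _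
  have hre (z : ℂ) : ‖z.re‖ₑ ≤ ‖z‖ₑ := by
    rw [← ofReal_norm, ← ofReal_norm]
    exact ENNReal.ofReal_le_ofReal (Complex.abs_re_le_norm z)
  rw [hfrozen, ← Complex.sub_re, conv, ← integral_sub hug hint]
  refine (hre _).trans ((enorm_integral_le_lintegral_enorm _).trans (lintegral_mono fun y => ?_))
  rw [← mul_sub, enorm_mul, ← Complex.ofReal_sub, ← inner_sub_left]
  gcongr
  exact enorm_ofReal_inner_le _ _

theorem ae_enorm_reBandMultiplier_inner_sub_le (hL : 0 < L) {u g : Space d → Space d}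
    {θ : Space d → ℝ} (hu : Measurable u) (hup : IsPeriodic L u)
    (hu2 : ∫⁻ x, ‖u x‖ₑ ^ 2 ∂cellMeasure d L ≠ ⊤) (hg : Measurable g) (hgp : IsPeriodic L g)
    (hg2 : ∫⁻ x, ‖g x‖ₑ ^ 2 ∂cellMeasure d L ≠ ⊤)
    (hθ : Integrable (fun x => (θ x : ℂ)) (cellMeasure d L)) (h : IsWeakGradient L θ g)
    {k : Space d → ℂ} (hk : Measurable k) (hki : Integrable k) {S : Finset (Fin d → ℤ)}
    (hS : ∀ m, m ∉ S → kernelFourier k (waveVector L m) = 0) :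
    ∀ᵐ x ∂cellMeasure d L,
      ‖reBandMultiplier L S k (fun x => inner ℝ (u x) (g x)) x -
          inner ℝ (u x) (gradient (reBandMultiplier L S k θ) x)‖ₑ ≤
        ∫⁻ y, ‖k y‖ₑ * (‖u (x - y) - u x‖ₑ * ‖g (x - y)‖ₑ) := by
  have hgi (i : Fin d) : Integrable (fun x => (g x i : ℂ)) (cellMeasure d L) :=
    integrable_of_lintegral_enorm_sq_ne_top (measurable_coord hg i).aestronglyMeasurable
      (lintegral_enorm_sq_coord_ne_top hg2 i)
  have hug := integrable_ofReal_inner hu hg hu2 hg2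
  have hugp : IsPeriodic L fun x => inner ℝ (u x) (g x) :=
    fun i x => congrArg₂ (inner ℝ) (hup i x) (hgp i x)
  have hgconv := ae_all_iff.mpr fun i => ae_integrable_conv hL hk hki (measurable_coord hg i)
    (hgp.postcomp fun z => (z i : ℂ)) (hgi i)
  filter_upwards [reBandMultiplier_ae_eq hL hk hki (hu.inner hg) hugp hug hS,
    gradient_reBandMultiplier_ae_eq hL h hθ hg hgp hgi hk hki hS,
    ae_integrable_conv hL hk hki (measurable_ofReal_inner hu hg) (hugp.postcomp _) hug,
    hgconv] with x hinner hgrad hugx hgx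
  rw [hinner]
  exact enorm_re_sub_inner_le hugx hgx hgrad

/- Since `u` is divergence-free, `u ⬝ ∇w` is orthogonal to every function of the projection `w`, so
only the commutator of `u ⬝ ∇` with the projection contributes. -/
theorem enorm_integral_transport_le (hL : 0 < L) {s : ℝ} (hs : s ∈ Icc (0 : ℝ) 1)
    {u g : Space d → Space d} {θ : Space d → ℝ} (hu : Measurable u) (hup : IsPeriodic L u)
    (hu2 : ∫⁻ x, ‖u x‖ₑ ^ 2 ∂cellMeasure d L ≠ ⊤) (hdiv : WeakDivFree L u)
    (hg : Measurable g) (hgp : IsPeriodic L g) (hg2 : ∫⁻ x, ‖g x‖ₑ ^ 2 ∂cellMeasure d L ≠ ⊤)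
    (hθ : Integrable (fun x => (θ x : ℂ)) (cellMeasure d L)) (h : IsWeakGradient L θ g)
    {k : Space d → ℂ} (hk : Measurable k) (hki : Integrable k) {S : Finset (Fin d → ℤ)}
    (hS : ∀ m, m ∉ S → kernelFourier k (waveVector L m) = 0)
    {B : ℝ → ℝ} (hB : ContDiff ℝ ∞ B) (hB1 : ∀ r, |deriv B r| ≤ 1) :
    ‖∫ x, deriv B (reBandMultiplier L S k θ x) *
        reBandMultiplier L S k (fun x => inner ℝ (u x) (g x)) x ∂cellMeasure d L‖ₑ ≤
      (∫⁻ y, ‖k y‖ₑ * ENNReal.ofReal (2 * ‖y‖ ^ s)) * fracGradSq L s u ^ (1 / 2 : ℝ) *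
        (∫⁻ x, ‖g x‖ₑ ^ 2 ∂cellMeasure d L) ^ (1 / 2 : ℝ) := by
  set w := reBandMultiplier L S k θ
  set H := reBandMultiplier L S k fun x => inner ℝ (u x) (g x)
  have hw : ContDiff ℝ ∞ w := contDiff_reTrigPoly _ _
  have hBw : AEStronglyMeasurable (fun x => deriv B (w x)) (cellMeasure d L) :=
    ((hB.continuous_deriv (by simp)).comp hw.continuous).aestronglyMeasurable
  have hB1' : ∀ᵐ x ∂cellMeasure d L, ‖deriv B (w x)‖ ≤ 1 := ae_of_all _ fun x => hB1 _
  have hH : Integrable H (cellMeasure d L) := (integrable_trigPoly S _).re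
  have hwi : Integrable (fun x => inner ℝ (u x) (gradient w x)) (cellMeasure d L) :=
    integrable_inner_gradient_reTrigPoly
      (integrable_of_lintegral_enorm_sq_ne_top hu.aestronglyMeasurable hu2) S _
  have hcommutator : ∫ x, deriv B (w x) * H x ∂cellMeasure d L =
      ∫ x, deriv B (w x) * (H x - inner ℝ (u x) (gradient w x)) ∂cellMeasure d L := by
    simp only [mul_sub]
    rw [integral_sub (hH.bdd_mul hBw hB1') (hwi.bdd_mul hBw hB1'),
      hdiv.integral_deriv_comp_mul_inner_gradient hL hB hw (isPeriodic_reTrigPoly hL _ _), sub_zero]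
  rw [hcommutator]
  refine (enorm_integral_le_lintegral_enorm _).trans ((lintegral_mono_ae ?_).trans
    (lintegral_commutator_le hL hs hu hup hu2 hg hgp hk))
  filter_upwards [hB1', ae_enorm_reBandMultiplier_inner_sub_le hL hu hup hu2 hg hgp hg2 hθ h hk hki
    hS] with x hx1 hx2
  rw [enorm_mul]
  refine (mul_le_mul' ?_ hx2).trans_eq (one_mul _)
  rw [← ofReal_norm, ← ENNReal.ofReal_one]
  exact ENNReal.ofReal_le_ofReal hx1

end Transport

section Kernels

variable {d : ℕ}

theorem fourierTransform_eq_kernelFourier (f : Space d → ℂ) (ξ : Space d) :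
    fourierTransform f ξ = (((2 * Real.pi) ^ (-(d : ℝ) / 2) : ℝ) : ℂ) * kernelFourier f ξ := rfl

/-- The `L¹` norm of a kernel with weight `1 + ‖y‖`. -/
def weightedNorm {d : ℕ} (k : Space d → ℂ) : ℝ≥0∞ := ∫⁻ y, ‖k y‖ₑ * ENNReal.ofReal (1 + ‖y‖)

theorem lintegral_enorm_le_weightedNorm (k : Space d → ℂ) : ∫⁻ y, ‖k y‖ₑ ≤ weightedNorm k := by
  refine lintegral_mono fun y => le_mul_of_one_le_right bot_le ?_
  rw [← ENNReal.ofReal_one]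
  exact ENNReal.ofReal_le_ofReal (by linarith [norm_nonneg y])

theorem integrable_of_weightedNorm_ne_top {k : Space d → ℂ} (hk : Measurable k)
    (h : weightedNorm k ≠ ⊤) : Integrable k :=
  ⟨hk.aestronglyMeasurable, (lintegral_enorm_le_weightedNorm k).trans_lt h.lt_top⟩

/-- The `L¹`-normalized dilation of a kernel. -/
def dilate {d : ℕ} (lam : ℝ) (k : Space d → ℂ) (y : Space d) : ℂ :=
  ((lam ^ d : ℝ) : ℂ) * k (lam • y)

theorem measurable_dilate (lam : ℝ) {k : Space d → ℂ} (hk : Measurable k) :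
    Measurable (dilate lam k) :=
  (hk.comp (measurable_const_smul lam)).const_mul _

theorem lintegral_comp_smul {lam : ℝ} (hl : 0 < lam) {f : Space d → ℝ≥0∞} (hf : Measurable f) :
    ∫⁻ y, f (lam • y) = ENNReal.ofReal ((lam ^ d)⁻¹) * ∫⁻ y, f y := by
  have h := Measure.map_addHaar_smul (volume : Measure (Space d)) hl.ne'
  rw [← lintegral_map hf (measurable_const_smul lam), h, lintegral_smul_measure]
  simp [abs_of_pos (pow_pos hl d)]

theorem lintegral_enorm_dilate_mul {lam : ℝ} (hl : 0 < lam) {k : Space d → ℂ} (hk : Measurable k)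
    {w : Space d → ℝ≥0∞} (hw : Measurable w) :
    ∫⁻ y, ‖dilate lam k y‖ₑ * w y = ∫⁻ y, ‖k y‖ₑ * w (lam⁻¹ • y) := by
  have h1 := lintegral_comp_smul hl (f := fun y => ‖k y‖ₑ * w (lam⁻¹ • y))
    (hk.enorm.mul (hw.comp (measurable_const_smul _)))
  have hl' : 0 < lam ^ d := pow_pos hl d
  have h2 : ∀ y, ‖dilate lam k y‖ₑ * w y =
      ENNReal.ofReal (lam ^ d) * (‖k (lam • y)‖ₑ * w (lam⁻¹ • (lam • y))) := by
    intro y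
    rw [inv_smul_smul₀ hl.ne', dilate, enorm_mul, ← ofReal_norm ((lam ^ d : ℝ) : ℂ),
      Complex.norm_real, Real.norm_of_nonneg hl'.le, mul_assoc]
  simp_rw [h2]
  rw [lintegral_const_mul _ (by fun_prop), h1, ← mul_assoc, ← ENNReal.ofReal_mul hl'.le,
    mul_inv_cancel₀ hl'.ne', ENNReal.ofReal_one, one_mul]

theorem lintegral_enorm_dilate {lam : ℝ} (hl : 0 < lam) {k : Space d → ℂ} (hk : Measurable k) :
    ∫⁻ y, ‖dilate lam k y‖ₑ = ∫⁻ y, ‖k y‖ₑ := by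
  simpa using lintegral_enorm_dilate_mul hl hk (w := fun _ => 1) measurable_const

theorem kernelFourier_dilate {lam : ℝ} (hl : 0 < lam) (k : Space d → ℂ) (ξ : Space d) :
    kernelFourier (dilate lam k) ξ = kernelFourier k (lam⁻¹ • ξ) := by
  have h := Measure.integral_comp_smul (volume : Measure (Space d))
    (fun y => k y * Complex.exp (-Complex.I * ((inner ℝ (lam⁻¹ • ξ) y : ℝ) : ℂ))) lam
  have hl' : 0 < lam ^ d := pow_pos hl d
  rw [kernelFourier, kernelFourier]
  have h2 : ∀ y, dilate lam k y * Complex.exp (-Complex.I * ((inner ℝ ξ y : ℝ) : ℂ)) =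
      ((lam ^ d : ℝ) : ℂ) * (k (lam • y) *
        Complex.exp (-Complex.I * ((inner ℝ (lam⁻¹ • ξ) (lam • y) : ℝ) : ℂ))) := by
    intro y
    rw [dilate, real_inner_smul_left, real_inner_smul_right, inv_mul_cancel_left₀ hl.ne', mul_assoc]
  simp_rw [h2]
  rw [integral_const_mul, h, ← Complex.real_smul, smul_smul]
  simp [abs_of_pos hl', hl'.ne']

theorem integrable_mul_exp {k : Space d → ℂ} (hk : Integrable k) (ξ : Space d) :
    Integrable fun y => k y * Complex.exp (-Complex.I * ((inner ℝ ξ y : ℝ) : ℂ)) := by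
  refine hk.mul_bdd (c := 1) (Continuous.aestronglyMeasurable (by fun_prop))
    (ae_of_all _ fun y => ?_)
  have : -Complex.I * ((inner ℝ ξ y : ℝ) : ℂ) = ((-inner ℝ ξ y : ℝ) : ℂ) * Complex.I := by
    push_cast; ring
  rw [this, Complex.norm_exp_ofReal_mul_I]

theorem kernelFourier_conv {h f : Space d → ℂ} (hh : Integrable h) (hf : Integrable f)
    (ξ : Space d) :
    kernelFourier (conv h f) ξ = kernelFourier h ξ * kernelFourier f ξ := by
  have h1 := integral_convolution (ContinuousLinearMap.mul ℂ ℂ) (μ := (volume : Measure (Space d)))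
    (ν := volume) (integrable_mul_exp hh ξ) (integrable_mul_exp hf ξ)
  simp only [ContinuousLinearMap.mul_apply'] at h1
  rw [kernelFourier, kernelFourier, kernelFourier, ← h1]
  congr 1
  ext x
  rw [convolution_def, conv, ← integral_mul_const]
  congr 1
  ext z
  simp only [ContinuousLinearMap.mul_apply']
  have : Complex.exp (-Complex.I * ((inner ℝ ξ x : ℝ) : ℂ)) =
      Complex.exp (-Complex.I * ((inner ℝ ξ z : ℝ) : ℂ)) *
        Complex.exp (-Complex.I * ((inner ℝ ξ (x - z) : ℝ) : ℂ)) := by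
    rw [← Complex.exp_add, inner_sub_right]
    push_cast
    ring_nf
  rw [this]
  ring

theorem weightedNorm_conv_le {h f : Space d → ℂ} (hh : Measurable h) (hf : Measurable f) :
    weightedNorm (conv h f) ≤ weightedNorm h * weightedNorm f := by
  have h1 : ∀ x, ‖conv h f x‖ₑ * ENNReal.ofReal (1 + ‖x‖) ≤
      ∫⁻ z, (‖h z‖ₑ * ENNReal.ofReal (1 + ‖z‖)) *
        (‖f (x - z)‖ₑ * ENNReal.ofReal (1 + ‖x - z‖)) := by
    intro x
    refine (mul_le_mul_left (enorm_conv_le h f x) _).trans ?_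
    rw [← lintegral_mul_const _ (by fun_prop)]
    refine lintegral_mono fun z => ?_
    have : ENNReal.ofReal (1 + ‖x‖) ≤ ENNReal.ofReal (1 + ‖z‖) * ENNReal.ofReal (1 + ‖x - z‖) := by
      rw [← ENNReal.ofReal_mul (by positivity)]
      refine ENNReal.ofReal_le_ofReal ?_
      have h2 : ‖x‖ ≤ ‖z‖ + ‖x - z‖ := by
        simpa using norm_add_le z (x - z)
      nlinarith [norm_nonneg z, norm_nonneg (x - z)]
    calc ‖h z‖ₑ * ‖f (x - z)‖ₑ * ENNReal.ofReal (1 + ‖x‖)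
        ≤ ‖h z‖ₑ * ‖f (x - z)‖ₑ * (ENNReal.ofReal (1 + ‖z‖) * ENNReal.ofReal (1 + ‖x - z‖)) := by
          gcongr
      _ = _ := by ring
  refine (lintegral_mono h1).trans_eq ?_
  rw [lintegral_lintegral_swap (by fun_prop), weightedNorm, ← lintegral_mul_const _ (by fun_prop)]
  refine lintegral_congr fun z => ?_
  rw [lintegral_const_mul _ (by fun_prop),
    lintegral_sub_right_eq_self (fun x => ‖f x‖ₑ * ENNReal.ofReal (1 + ‖x‖)) z, weightedNorm]

/-- The heat kernel at time one. -/
def gaussKernel {d : ℕ} (z : Space d) : ℂ :=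
  (((4 * Real.pi) ^ (-(d : ℝ) / 2) * Real.exp (-(‖z‖ ^ 2 / 4)) : ℝ) : ℂ)

@[fun_prop]
theorem measurable_gaussKernel : Measurable (gaussKernel : Space d → ℂ) := by
  unfold gaussKernel; fun_prop

theorem kernelFourier_gaussKernel (ξ : Space d) :
    kernelFourier gaussKernel ξ = ((Real.exp (-‖ξ‖ ^ 2) : ℝ) : ℂ) := by
  have h := GaussianFourier.integral_cexp_neg_mul_sq_norm_add (V := Space d) (b := 1 / 4)
    (by norm_num) (-Complex.I) ξ
  rw [kernelFourier]
  have e : ∀ y : Space d, gaussKernel y * Complex.exp (-Complex.I * ((inner ℝ ξ y : ℝ) : ℂ)) =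
      (((4 * Real.pi) ^ (-(d : ℝ) / 2) : ℝ) : ℂ) *
        Complex.exp (-(1 / 4) * (‖y‖ : ℂ) ^ 2 + -Complex.I * ((inner ℝ ξ y : ℝ) : ℂ)) := by
    intro y
    rw [gaussKernel, Complex.exp_add]
    push_cast
    ring_nf
  simp_rw [e]
  rw [integral_const_mul, h]
  have hpi : (0 : ℝ) < 4 * Real.pi := by positivity
  have h2 : ((Real.pi : ℂ) / (1 / 4)) ^ ((Module.finrank ℝ (Space d) : ℂ) / 2) =
      (((4 * Real.pi) ^ ((d : ℝ) / 2) : ℝ) : ℂ) := by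
    rw [Complex.ofReal_cpow hpi.le]
    congr 1
    · push_cast; ring
    · simp
  rw [h2, ← mul_assoc, ← Complex.ofReal_mul, ← Real.rpow_add hpi]
  have h3 : -(d : ℝ) / 2 + d / 2 = 0 := by ring
  rw [h3, Real.rpow_zero]
  push_cast
  rw [one_mul, neg_sq, Complex.I_sq]
  congr 1
  ring

theorem norm_gaussKernel_eq (z : Space d) :
    ‖gaussKernel z‖ = (4 * Real.pi) ^ (-(d : ℝ) / 2) * Real.exp (-(‖z‖ ^ 2 / 4)) := by
  rw [gaussKernel, Complex.norm_real, Real.norm_of_nonneg (by positivity)]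

theorem integrable_exp_neg_sq {b : ℝ} (hb : 0 < b) :
    Integrable fun z : Space d => Real.exp (-(b * ‖z‖ ^ 2)) := by
  have h := (GaussianFourier.integrable_cexp_neg_mul_sq_norm_add (V := Space d) (b := (b : ℂ))
    (by simpa using hb) 0 0).norm
  refine h.congr (ae_of_all _ fun z => ?_)
  simp only [Complex.norm_exp]
  congr 1
  simp [← Complex.ofReal_pow]

theorem exp_neg_sq_mul_one_add_le (x : ℝ) :
    Real.exp (-(x ^ 2 / 4)) * (1 + x) ≤ 3 * Real.exp (-(1 / 8 * x ^ 2)) := by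
  have hx : 1 + x ≤ 3 * Real.exp (x ^ 2 / 8) := by
    nlinarith [Real.add_one_le_exp (x ^ 2 / 8), sq_nonneg (x - 4 / 3)]
  calc Real.exp (-(x ^ 2 / 4)) * (1 + x)
      ≤ Real.exp (-(x ^ 2 / 4)) * (3 * Real.exp (x ^ 2 / 8)) := by gcongr
    _ = 3 * Real.exp (-(1 / 8 * x ^ 2)) := by
        rw [mul_left_comm, ← Real.exp_add]
        ring_nf

theorem weightedNorm_gaussKernel_ne_top : weightedNorm (gaussKernel : Space d → ℂ) ≠ ⊤ := by
  have h : Integrable fun z : Space d =>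
      (4 * Real.pi) ^ (-(d : ℝ) / 2) * (3 * Real.exp (-(1 / 8 * ‖z‖ ^ 2))) :=
    ((integrable_exp_neg_sq (by norm_num)).const_mul _).const_mul _
  refine ne_top_of_le_ne_top h.2.ne (lintegral_mono fun z => ?_)
  rw [← ofReal_norm, ← ofReal_norm, ← ENNReal.ofReal_mul (norm_nonneg _), norm_gaussKernel_eq,
    mul_assoc, Real.norm_of_nonneg (by positivity)]
  exact ENNReal.ofReal_le_ofReal
    (mul_le_mul_of_nonneg_left (exp_neg_sq_mul_one_add_le ‖z‖) (by positivity))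

theorem integrable_gaussKernel : Integrable (gaussKernel : Space d → ℂ) :=
  integrable_of_weightedNorm_ne_top measurable_gaussKernel weightedNorm_gaussKernel_ne_top

/-- The heat kernel at time `σ ^ 2`. -/
def heatKernel {d : ℕ} (σ : ℝ) : Space d → ℂ := dilate σ⁻¹ gaussKernel

theorem measurable_heatKernel (σ : ℝ) : Measurable (heatKernel σ : Space d → ℂ) :=
  measurable_dilate _ measurable_gaussKernel

theorem kernelFourier_heatKernel {σ : ℝ} (hσ : 0 < σ) (ξ : Space d) :
    kernelFourier (heatKernel σ) ξ = ((Real.exp (-(σ ^ 2 * ‖ξ‖ ^ 2)) : ℝ) : ℂ) := by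
  rw [heatKernel, kernelFourier_dilate (inv_pos.mpr hσ), kernelFourier_gaussKernel, inv_inv,
    norm_smul, Real.norm_of_nonneg hσ.le, mul_pow]

theorem weightedNorm_heatKernel_le {σ M : ℝ} (hσ : 0 < σ) (hM : σ ≤ M) (hM1 : 1 ≤ M) :
    weightedNorm (heatKernel σ : Space d → ℂ) ≤
      ENNReal.ofReal M * weightedNorm (gaussKernel : Space d → ℂ) := by
  rw [weightedNorm, heatKernel, lintegral_enorm_dilate_mul (inv_pos.mpr hσ) measurable_gaussKernel
    (by fun_prop), weightedNorm, ← lintegral_const_mul _ (by fun_prop)]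
  refine lintegral_mono fun y => ?_
  rw [← mul_assoc, mul_comm (ENNReal.ofReal M), mul_assoc, ← ENNReal.ofReal_mul (by linarith)]
  gcongr
  rw [inv_inv, norm_smul, Real.norm_of_nonneg hσ.le]
  nlinarith [norm_nonneg y]

theorem weightedNorm_heatKernel_ne_top {σ : ℝ} (hσ : 0 < σ) :
    weightedNorm (heatKernel σ : Space d → ℂ) ≠ ⊤ :=
  ne_top_of_le_ne_top (ENNReal.mul_ne_top ENNReal.ofReal_ne_top weightedNorm_gaussKernel_ne_top)
    (weightedNorm_heatKernel_le hσ (le_max_left σ 1) (le_max_right σ 1))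

theorem integrable_heatKernel {σ : ℝ} (hσ : 0 < σ) : Integrable (heatKernel σ : Space d → ℂ) :=
  integrable_of_weightedNorm_ne_top (measurable_heatKernel σ) (weightedNorm_heatKernel_ne_top hσ)

theorem exists_kernel_heat_flow {f : Space d → ℂ} (hf : Measurable f)
    (hfw : weightedNorm f ≠ ⊤) (M : ℝ) (hM : 1 ≤ M) :
    ∃ C : ℝ≥0, ∀ ρ : ℝ, 0 < ρ → ρ ≤ M → ∃ K : Space d → ℂ, Measurable K ∧ weightedNorm K ≤ C ∧
      ∀ ξ, kernelFourier K ξ = ((Real.exp (-(ρ * ‖ξ‖ ^ 2)) : ℝ) : ℂ) * kernelFourier f ξ := by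
  have hfin : ENNReal.ofReal M * weightedNorm (gaussKernel : Space d → ℂ) * weightedNorm f ≠ ⊤ :=
    ENNReal.mul_ne_top
      (ENNReal.mul_ne_top ENNReal.ofReal_ne_top weightedNorm_gaussKernel_ne_top) hfw
  refine ⟨(ENNReal.ofReal M * weightedNorm (gaussKernel : Space d → ℂ) * weightedNorm f).toNNReal,
    fun ρ hρ hρM => ⟨conv (heatKernel (Real.sqrt ρ)) f,
      measurable_conv (measurable_heatKernel _) hf, ?_, ?_⟩⟩
  · rw [ENNReal.coe_toNNReal hfin]
    refine (weightedNorm_conv_le (measurable_heatKernel _) hf).trans ?_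
    gcongr
    refine weightedNorm_heatKernel_le (Real.sqrt_pos.mpr hρ) ?_ hM
    exact Real.sqrt_le_iff.mpr ⟨by linarith, by nlinarith⟩
  · intro ξ
    rw [kernelFourier_conv (integrable_heatKernel (Real.sqrt_pos.mpr hρ))
        (integrable_of_weightedNorm_ne_top hf hfw),
      kernelFourier_heatKernel (Real.sqrt_pos.mpr hρ), Real.sq_sqrt hρ.le]

theorem abs_exp_neg_sub_le {p q : ℝ} :
    |Real.exp (-p) - Real.exp (-q)| ≤ |p - q| * (Real.exp (-p) + Real.exp (-q)) := by
  wlog h : p ≤ q generalizing p q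
  · rw [abs_sub_comm, abs_sub_comm p q, add_comm]
    exact this (not_le.mp h).le
  have h1 : Real.exp (-q) ≤ Real.exp (-p) := Real.exp_le_exp.mpr (by linarith)
  rw [abs_of_nonneg (by linarith), abs_of_nonpos (by linarith)]
  have h2 : Real.exp (-q) = Real.exp (-p) * Real.exp (p - q) := by
    rw [← Real.exp_add]; congr 1; ring
  have h3 := Real.add_one_le_exp (p - q)
  have h4 := Real.exp_pos (-p)
  have h5 := Real.exp_pos (-q)
  nlinarith [mul_nonneg (by linarith : 0 ≤ q - p) h5.le,
    mul_nonneg h4.le (by linarith : 0 ≤ Real.exp (p - q) - (p - q + 1))]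

theorem abs_norm_sub_sq_sub_norm_sq_le {E : Type*} [SeminormedAddCommGroup E] (z h : E) :
    |‖z - h‖ ^ 2 - ‖z‖ ^ 2| ≤ ‖h‖ * (‖z - h‖ + ‖z‖) := by
  have key : |‖z - h‖ - ‖z‖| ≤ ‖h‖ := by simpa using abs_norm_sub_norm_le (z - h) z
  rw [sq_sub_sq, abs_mul, abs_of_nonneg (by positivity), mul_comm]
  gcongr

theorem norm_gaussKernel_sub_le (z h : Space d) :
    ‖gaussKernel (z - h) - gaussKernel z‖ ≤ (‖h‖ * (2 + ‖h‖)) *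
      (‖gaussKernel (z - h)‖ * (1 + ‖z - h‖) + ‖gaussKernel z‖ * (1 + ‖z‖)) := by
  rw [norm_gaussKernel_eq, norm_gaussKernel_eq, gaussKernel, gaussKernel, ← Complex.ofReal_sub,
    Complex.norm_real, Real.norm_eq_abs, ← mul_sub, abs_mul]
  set c := (4 * Real.pi) ^ (-(d : ℝ) / 2)
  set p := ‖z - h‖ ^ 2 / 4
  set q := ‖z‖ ^ 2 / 4
  have hc : 0 ≤ c := by positivity
  have hpq : |p - q| ≤ ‖h‖ * (‖z - h‖ + ‖z‖) := by
    rw [← sub_div, abs_div, abs_of_pos (by norm_num : (0 : ℝ) < 4)]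
    exact (div_le_self (abs_nonneg _) (by norm_num)).trans (abs_norm_sub_sq_sub_norm_sq_le z h)
  have hz1 : ‖z‖ ≤ ‖z - h‖ + ‖h‖ := by simpa using norm_add_le (z - h) h
  have hz2 : ‖z - h‖ ≤ ‖z‖ + ‖h‖ := norm_sub_le z h
  have hw1 : ‖z - h‖ + ‖z‖ ≤ (2 + ‖h‖) * (1 + ‖z - h‖) := by
    nlinarith [mul_nonneg (norm_nonneg h) (norm_nonneg (z - h))]
  have hw2 : ‖z - h‖ + ‖z‖ ≤ (2 + ‖h‖) * (1 + ‖z‖) := by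
    nlinarith [mul_nonneg (norm_nonneg h) (norm_nonneg z)]
  calc |c| * |Real.exp (-p) - Real.exp (-q)|
      ≤ c * (‖h‖ * (‖z - h‖ + ‖z‖) * (Real.exp (-p) + Real.exp (-q))) := by
        rw [abs_of_nonneg hc]
        exact mul_le_mul_of_nonneg_left (abs_exp_neg_sub_le.trans (by gcongr)) hc
    _ = c * ‖h‖ * ((‖z - h‖ + ‖z‖) * Real.exp (-p) + (‖z - h‖ + ‖z‖) * Real.exp (-q)) := by ring
    _ ≤ c * ‖h‖ * ((2 + ‖h‖) * (1 + ‖z - h‖) * Real.exp (-p)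
          + (2 + ‖h‖) * (1 + ‖z‖) * Real.exp (-q)) := by gcongr
    _ = _ := by ring

theorem lintegral_enorm_gaussKernel_sub_le (h : Space d) :
    ∫⁻ z, ‖gaussKernel (z - h) - gaussKernel z‖ₑ ≤
      ENNReal.ofReal (‖h‖ * (2 + ‖h‖)) * (2 * weightedNorm (gaussKernel : Space d → ℂ)) := by
  have hpt : ∀ z, ‖gaussKernel (z - h) - gaussKernel z‖ₑ ≤ ENNReal.ofReal (‖h‖ * (2 + ‖h‖)) *
      (‖gaussKernel (z - h)‖ₑ * ENNReal.ofReal (1 + ‖z - h‖) +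
        ‖gaussKernel z‖ₑ * ENNReal.ofReal (1 + ‖z‖)) := by
    intro z
    have := ENNReal.ofReal_le_ofReal (norm_gaussKernel_sub_le z h)
    rw [ENNReal.ofReal_mul (by positivity), ENNReal.ofReal_add (by positivity) (by positivity),
      ENNReal.ofReal_mul (norm_nonneg (gaussKernel _)),
      ENNReal.ofReal_mul (norm_nonneg (gaussKernel _))] at this
    simpa only [ofReal_norm] using this
  refine (lintegral_mono hpt).trans_eq ?_
  rw [lintegral_const_mul _ (by fun_prop), lintegral_add_left (by fun_prop),
    lintegral_sub_right_eq_self (fun z => ‖gaussKernel z‖ₑ * ENNReal.ofReal (1 + ‖z‖)) h, two_mul,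
    weightedNorm]

theorem integrable_mul_gaussKernel_sub {k : Space d → ℂ} (hk : Integrable k) (x : Space d) :
    Integrable fun y => k y * gaussKernel (x - y) := by
  refine hk.mul_bdd (c := (4 * Real.pi) ^ (-(d : ℝ) / 2))
    (measurable_gaussKernel.comp (measurable_const.sub measurable_id)).aestronglyMeasurable
    (ae_of_all _ fun y => ?_)
  rw [norm_gaussKernel_eq]
  refine mul_le_of_le_one_right (by positivity) (Real.exp_le_one_iff.mpr ?_)
  rw [neg_nonpos]
  positivity

/-- The `L¹` norm of a kernel with the weight `‖y‖ * (2 + ‖y‖)` vanishing at the origin; it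
controls the convolution of a mean-zero kernel with the heat kernel. -/
def momentNorm {d : ℕ} (k : Space d → ℂ) : ℝ≥0∞ :=
  ∫⁻ y, ‖k y‖ₑ * ENNReal.ofReal (‖y‖ * (2 + ‖y‖))

theorem lintegral_enorm_conv_gaussKernel_le {k : Space d → ℂ} (hk : Measurable k)
    (hki : Integrable k) (hk0 : ∫ y, k y = 0) :
    ∫⁻ x, ‖conv k gaussKernel x‖ₑ ≤
      momentNorm k * (2 * weightedNorm (gaussKernel : Space d → ℂ)) := by
  calc ∫⁻ x, ‖conv k gaussKernel x‖ₑ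
      ≤ ∫⁻ x, ∫⁻ y, ‖k y‖ₑ * ‖gaussKernel (x - y) - gaussKernel x‖ₑ :=
        lintegral_mono fun x => enorm_conv_le_of_integral_eq_zero hki hk0
          (integrable_mul_gaussKernel_sub hki x)
    _ = ∫⁻ y, ‖k y‖ₑ * ∫⁻ x, ‖gaussKernel (x - y) - gaussKernel x‖ₑ := by
        rw [lintegral_lintegral_swap (by fun_prop)]
        exact lintegral_congr fun y => lintegral_const_mul _ (by fun_prop)
    _ ≤ ∫⁻ y, ‖k y‖ₑ * ENNReal.ofReal (‖y‖ * (2 + ‖y‖)) *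
          (2 * weightedNorm (gaussKernel : Space d → ℂ)) := by
        refine lintegral_mono fun y => ?_
        rw [mul_assoc]
        gcongr
        exact lintegral_enorm_gaussKernel_sub_le y
    _ = _ := lintegral_mul_const _ (by fun_prop)

theorem momentNorm_dilate_le {lam : ℝ} (hl : 1 ≤ lam) {k : Space d → ℂ} (hk : Measurable k) :
    momentNorm (dilate lam k) ≤ ENNReal.ofReal lam⁻¹ * momentNorm k := by
  have hl0 : 0 < lam := by linarith
  rw [momentNorm, lintegral_enorm_dilate_mul hl0 hk (by fun_prop), momentNorm,
    ← lintegral_const_mul _ (by fun_prop)]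
  refine lintegral_mono fun y => ?_
  rw [mul_left_comm, ← ENNReal.ofReal_mul (by positivity), norm_smul,
    Real.norm_of_nonneg (by positivity), mul_assoc]
  gcongr
  exact mul_le_of_le_one_left (norm_nonneg _) (inv_le_one_of_one_le₀ hl)

theorem integrable_dilate {lam : ℝ} (hl : 0 < lam) {k : Space d → ℂ} (hk : Measurable k)
    (hki : Integrable k) : Integrable (dilate lam k) := by
  refine ⟨(measurable_dilate lam hk).aestronglyMeasurable, ?_⟩
  rw [HasFiniteIntegral, lintegral_enorm_dilate hl hk]
  exact hki.2

theorem kernelFourier_zero (k : Space d → ℂ) : kernelFourier k 0 = ∫ y, k y := by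
  simp [kernelFourier]

theorem integral_dilate {lam : ℝ} (hl : 0 < lam) (k : Space d → ℂ) :
    ∫ y, dilate lam k y = ∫ y, k y := by
  rw [← kernelFourier_zero, kernelFourier_dilate hl, smul_zero, kernelFourier_zero]

theorem lintegral_enorm_conv_dilate_gaussKernel_le {k : Space d → ℂ} (hk : Measurable k)
    (hki : Integrable k) (hk0 : ∫ y, k y = 0) {σ : ℝ} (hσ : 1 ≤ σ) :
    ∫⁻ x, ‖conv (dilate σ k) gaussKernel x‖ₑ ≤ ENNReal.ofReal σ⁻¹ *
      (momentNorm k * (2 * weightedNorm (gaussKernel : Space d → ℂ))) := by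
  have hσ0 : 0 < σ := by linarith
  refine (lintegral_enorm_conv_gaussKernel_le (measurable_dilate σ hk)
    (integrable_dilate hσ0 hk hki) (by rw [integral_dilate hσ0, hk0])).trans ?_
  rw [← mul_assoc (ENNReal.ofReal _)]
  exact mul_le_mul_left (momentNorm_dilate_le hσ hk) _

/- The heat flow contracts mean-zero kernels: after rescaling space by `σ` it runs for unit time,
and the kernel, concentrated at scale `σ⁻¹`, is integrated against increments of the Gaussian. -/
theorem exists_contracting_kernel {f : Space d → ℂ} (hf : Measurable f) (hfi : Integrable f)
    (hf0 : ∫ y, f y = 0) (hfw : momentNorm f ≠ ⊤) {δ : ℝ} (hδ : 0 < δ) :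
    ∃ N : ℝ, 1 ≤ N ∧ ∃ A : Space d → ℂ, Measurable A ∧ Integrable A ∧
      ∫⁻ y, ‖A y‖ₑ ≤ ENNReal.ofReal δ ∧
      ∀ ξ, kernelFourier A ξ = ((Real.exp (-(N * ‖ξ‖ ^ 2)) : ℝ) : ℂ) * kernelFourier f ξ := by
  set V : ℝ≥0∞ := momentNorm f * (2 * weightedNorm (gaussKernel : Space d → ℂ))
  have hV : V ≠ ⊤ :=
    ENNReal.mul_ne_top hfw (ENNReal.mul_ne_top (by simp) weightedNorm_gaussKernel_ne_top)
  set σ : ℝ := max 1 (V.toReal / δ)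
  have hσ1 : 1 ≤ σ := le_max_left _ _
  have hσ0 : 0 < σ := by linarith
  have hDi : Integrable (dilate σ f) := integrable_dilate hσ0 hf hfi
  have hm : Measurable (conv (dilate σ f) gaussKernel) :=
    measurable_conv (measurable_dilate σ hf) measurable_gaussKernel
  have hle : ∫⁻ x, ‖dilate σ⁻¹ (conv (dilate σ f) gaussKernel) x‖ₑ ≤ ENNReal.ofReal δ := by
    rw [lintegral_enorm_dilate (inv_pos.mpr hσ0) hm]
    refine (lintegral_enorm_conv_dilate_gaussKernel_le hf hfi hf0 hσ1).trans ?_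
    change ENNReal.ofReal σ⁻¹ * V ≤ _
    rw [← ENNReal.ofReal_toReal hV, ← ENNReal.ofReal_mul (by positivity)]
    refine ENNReal.ofReal_le_ofReal ((inv_mul_le_iff₀ hσ0).mpr ?_)
    exact (div_le_iff₀ hδ).mp (le_max_right _ _)
  refine ⟨σ ^ 2, one_le_pow₀ hσ1, dilate σ⁻¹ (conv (dilate σ f) gaussKernel),
    measurable_dilate _ hm, ⟨(measurable_dilate _ hm).aestronglyMeasurable,
      hle.trans_lt ENNReal.ofReal_lt_top⟩, hle, fun ξ => ?_⟩
  rw [kernelFourier_dilate (inv_pos.mpr hσ0), inv_inv,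
    kernelFourier_conv hDi integrable_gaussKernel, kernelFourier_gaussKernel,
    kernelFourier_dilate hσ0, inv_smul_smul₀ hσ0.ne', norm_smul,
    Real.norm_of_nonneg hσ0.le, mul_pow, mul_comm]

end Kernels

section LittlewoodPaley

variable {d : ℕ} {Φ : ℤ → 𝓢(Space d, ℂ)}

theorem finite_waveVector_le {L : ℝ} (hL : 0 < L) (R : ℝ) :
    {m : Fin d → ℤ | ‖waveVector L m‖ ≤ R}.Finite := by
  set B : ℤ := ⌈R * L / (2 * Real.pi)⌉
  refine (Set.finite_Icc (fun _ => -B : Fin d → ℤ) (fun _ => B)).subset fun m hm => ?_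
  have h : ∀ i, |m i| ≤ B := by
    intro i
    have hcoord : ‖2 * Real.pi / L * (m i : ℝ)‖ ≤ R :=
      (PiLp.norm_apply_le (waveVector L m) i).trans hm
    rw [norm_mul, Real.norm_of_nonneg (by positivity), Real.norm_eq_abs, div_mul_eq_mul_div,
      div_le_iff₀ hL] at hcoord
    have hle : |(m i : ℝ)| ≤ R * L / (2 * Real.pi) := by
      rw [le_div_iff₀ (by positivity)]
      linarith
    exact_mod_cast hle.trans (Int.le_ceil _)
  exact ⟨fun i => (abs_le.mp (h i)).1, fun i => (abs_le.mp (h i)).2⟩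

theorem fourierTransform_ne_zero_iff (f : Space d → ℂ) (ξ : Space d) :
    fourierTransform f ξ ≠ 0 ↔ kernelFourier f ξ ≠ 0 := by
  have hc : (((2 * Real.pi) ^ (-(d : ℝ) / 2) : ℝ) : ℂ) ≠ 0 :=
    Complex.ofReal_ne_zero.mpr (by positivity)
  rw [fourierTransform_eq_kernelFourier, mul_ne_zero_iff_left hc]

theorem IsLittlewoodPaleyFamily.kernelFourier_eq (hΦ : IsLittlewoodPaleyFamily Φ) (l : ℤ)
    (ξ : Space d) :
    kernelFourier (Φ l) ξ = kernelFourier (dilate ((2 : ℝ) ^ l) (Φ 0)) ξ := by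
  have h := hΦ.scaling l ξ
  rw [fourierTransform_eq_kernelFourier, fourierTransform_eq_kernelFourier] at h
  rw [kernelFourier_dilate (by positivity), ← zpow_neg]
  exact mul_left_cancel₀ (Complex.ofReal_ne_zero.mpr (by positivity)) h

theorem IsLittlewoodPaleyFamily.zpow_mul_norm_mem (hΦ : IsLittlewoodPaleyFamily Φ) (l : ℤ)
    {ξ : Space d} (h : kernelFourier (Φ l) ξ ≠ 0) : (2 : ℝ) ^ (-l) * ‖ξ‖ ∈ Ioo ((2 : ℝ)⁻¹) 2 := by
  rw [← fourierTransform_ne_zero_iff, hΦ.scaling] at h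
  have := hΦ.support _ h
  rwa [norm_smul, Real.norm_of_nonneg (by positivity)] at this

theorem IsLittlewoodPaleyFamily.exists_finset (hΦ : IsLittlewoodPaleyFamily Φ) {L : ℝ}
    (hL : 0 < L) (l : ℤ) :
    ∃ S : Finset (Fin d → ℤ), ∀ m, m ∉ S → kernelFourier (Φ l) (waveVector L m) = 0 := by
  refine ⟨(finite_waveVector_le hL (2 * 2 ^ l)).toFinset, fun m hm => ?_⟩
  by_contra h
  refine hm ((Set.Finite.mem_toFinset _).mpr ?_)
  have hle := (hΦ.zpow_mul_norm_mem l h).2.le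
  rwa [zpow_neg, inv_mul_le_iff₀ (by positivity), mul_comm] at hle

theorem IsLittlewoodPaleyFamily.kernelFourier_zero (hΦ : IsLittlewoodPaleyFamily Φ) (l : ℤ) :
    kernelFourier (Φ l) 0 = 0 := by
  by_contra h
  have := (hΦ.zpow_mul_norm_mem l h).1
  rw [norm_zero, mul_zero] at this
  norm_num at this

theorem IsLittlewoodPaleyFamily.integral_dilate_eq_zero (hΦ : IsLittlewoodPaleyFamily Φ)
    (l : ℤ) : ∫ y, dilate ((2 : ℝ) ^ l) (Φ 0) y = 0 := by
  rw [integral_dilate (by positivity), ← PassiveScalar.kernelFourier_zero, hΦ.kernelFourier_zero]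

theorem measurable_schwartz (f : 𝓢(Space d, ℂ)) : Measurable (f : Space d → ℂ) :=
  f.continuous.measurable

theorem lintegral_schwartz_ne_top (f : 𝓢(Space d, ℂ)) :
    ∫⁻ y, ‖f y‖ₑ * ENNReal.ofReal ((1 + ‖y‖) ^ 2) ≠ ⊤ := by
  have h0 := f.integrable_pow_mul volume 0
  have h1 := f.integrable_pow_mul volume 1
  have h2 := f.integrable_pow_mul volume 2
  have h := (h0.add (h1.const_mul 2)).add h2
  refine ne_top_of_le_ne_top h.2.ne (lintegral_mono fun y => ?_)
  rw [← ofReal_norm, ← ofReal_norm, ← ENNReal.ofReal_mul (norm_nonneg _)]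
  refine ENNReal.ofReal_le_ofReal (le_trans (le_of_eq ?_) (le_abs_self _))
  simp only [Pi.add_apply, pow_zero, pow_one]
  ring

theorem weightedNorm_schwartz_ne_top (f : 𝓢(Space d, ℂ)) :
    weightedNorm (f : Space d → ℂ) ≠ ⊤ := by
  refine ne_top_of_le_ne_top (lintegral_schwartz_ne_top f) (lintegral_mono fun y => ?_)
  refine mul_le_mul_right (ENNReal.ofReal_le_ofReal ?_) _
  nlinarith [norm_nonneg y]

theorem momentNorm_schwartz_ne_top (f : 𝓢(Space d, ℂ)) : momentNorm (f : Space d → ℂ) ≠ ⊤ := by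
  refine ne_top_of_le_ne_top (lintegral_schwartz_ne_top f) (lintegral_mono fun y => ?_)
  refine mul_le_mul_right (ENNReal.ofReal_le_ofReal ?_) _
  nlinarith [norm_nonneg y]

theorem rpow_le_one_add {x s : ℝ} (hx : 0 ≤ x) (hs : s ∈ Icc (0 : ℝ) 1) : x ^ s ≤ 1 + x := by
  calc x ^ s ≤ (1 + x) ^ s := Real.rpow_le_rpow hx (by linarith) hs.1
    _ ≤ (1 + x) ^ (1 : ℝ) := Real.rpow_le_rpow_of_exponent_le (by linarith) hs.2
    _ = 1 + x := Real.rpow_one _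

theorem lintegral_dilate_rpow_le {lam s : ℝ} (hl : 0 < lam) (hs : s ∈ Icc (0 : ℝ) 1)
    {k : Space d → ℂ} (hk : Measurable k) :
    ∫⁻ y, ‖dilate lam k y‖ₑ * ENNReal.ofReal (2 * ‖y‖ ^ s) ≤
      2 * weightedNorm k * ENNReal.ofReal (lam ^ (-s)) := by
  rw [lintegral_enorm_dilate_mul hl hk (by fun_prop), weightedNorm,
    ← lintegral_const_mul _ (by fun_prop), ← lintegral_mul_const _ (by fun_prop)]
  refine lintegral_mono fun y => ?_
  have hpow : 2 * ‖lam⁻¹ • y‖ ^ s ≤ 2 * (1 + ‖y‖) * lam ^ (-s) := by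
    rw [norm_smul, Real.norm_of_nonneg (by positivity),
      Real.mul_rpow (by positivity) (norm_nonneg _), Real.inv_rpow hl.le, ← Real.rpow_neg hl.le,
      mul_comm (lam ^ (-s)), ← mul_assoc]
    gcongr
    exact rpow_le_one_add (norm_nonneg y) hs
  calc ‖k y‖ₑ * ENNReal.ofReal (2 * ‖lam⁻¹ • y‖ ^ s)
      ≤ ‖k y‖ₑ * ENNReal.ofReal (2 * (1 + ‖y‖) * lam ^ (-s)) := by gcongr
    _ = _ := by
      rw [ENNReal.ofReal_mul (by positivity), ENNReal.ofReal_mul (by norm_num),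
        ENNReal.ofReal_ofNat]
      ring

/-- For all times `ρ ≤ R`, the heat flow of the kernel `k₀` at time `ρ` has commutator constant at
most `D`: this is the constant which `enorm_integral_transport_le` attaches to a kernel. -/
def HasHeatFlowBound {d : ℕ} (k₀ : Space d → ℂ) (s R : ℝ) (D : ℝ≥0∞) : Prop :=
  ∀ ρ : ℝ, 0 < ρ → ρ ≤ R → ∃ k : Space d → ℂ, Measurable k ∧ Integrable k ∧
    (∀ ξ, kernelFourier k ξ = ((Real.exp (-(ρ * ‖ξ‖ ^ 2)) : ℝ) : ℂ) * kernelFourier k₀ ξ) ∧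
    ∫⁻ y, ‖k y‖ₑ * ENNReal.ofReal (2 * ‖y‖ ^ s) ≤ D

theorem IsLittlewoodPaleyFamily.exists_hasHeatFlowBound (hΦ : IsLittlewoodPaleyFamily Φ) {N : ℝ}
    (hN : 1 ≤ N) :
    ∃ C : ℝ≥0, ∀ l : ℤ, ∀ s ∈ Icc (0 : ℝ) 1, HasHeatFlowBound (Φ l) s (N / ((2 : ℝ) ^ l) ^ 2)
      (C * ENNReal.ofReal (((2 : ℝ) ^ l) ^ (-s))) := by
  obtain ⟨C, hC⟩ := exists_kernel_heat_flow (measurable_schwartz (Φ 0))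
    (weightedNorm_schwartz_ne_top _) N hN
  refine ⟨2 * C, fun l s hs ρ hρ hρN => ?_⟩
  have hl : (0 : ℝ) < 2 ^ l := by positivity
  obtain ⟨K, hKm, hKw, hKF⟩ := hC (ρ * ((2 : ℝ) ^ l) ^ 2) (by positivity)
    ((le_div_iff₀ (by positivity)).1 hρN)
  refine ⟨dilate (2 ^ l) K, measurable_dilate _ hKm, integrable_dilate hl hKm
    (integrable_of_weightedNorm_ne_top hKm (ne_top_of_le_ne_top ENNReal.coe_ne_top hKw)), ?_, ?_⟩
  · intro ξ
    rw [hΦ.kernelFourier_eq, kernelFourier_dilate hl, kernelFourier_dilate hl, hKF, norm_smul,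
      norm_inv, Real.norm_of_nonneg hl.le]
    congr 4
    field_simp
  · refine (lintegral_dilate_rpow_le hl hs hKm).trans ?_
    push_cast
    gcongr

/-- A kernel whose Fourier transform is one on the annulus carrying that of `Φ 0`. The scalar
converts the unitary normalization of `fourierTransform` into that of `kernelFourier`. -/
def fattenedKernel (Φ : ℤ → 𝓢(Space d, ℂ)) : 𝓢(Space d, ℂ) :=
  (((2 * Real.pi) ^ (-(d : ℝ) / 2) : ℝ) : ℂ) • ∑ j ∈ {-1, 0, 1}, Φ j

theorem kernelFourier_fattenedKernel (Φ : ℤ → 𝓢(Space d, ℂ)) (ξ : Space d) :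
    kernelFourier (fattenedKernel Φ) ξ = ∑ j ∈ {-1, 0, 1}, fourierTransform (Φ j) ξ := by
  simp only [fourierTransform_eq_kernelFourier, kernelFourier, ← Finset.mul_sum]
  rw [← integral_finsetSum _ fun j _ => integrable_mul_exp (Φ j).integrable ξ,
    ← integral_const_mul]
  refine integral_congr_ae (ae_of_all _ fun y => ?_)
  simp only [fattenedKernel, _root_.smul_apply, _root_.sum_apply, smul_eq_mul,
    ← Finset.sum_mul, mul_assoc]

theorem IsLittlewoodPaleyFamily.integral_fattenedKernel (hΦ : IsLittlewoodPaleyFamily Φ) :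
    ∫ y, fattenedKernel Φ y = 0 := by
  rw [← PassiveScalar.kernelFourier_zero, kernelFourier_fattenedKernel]
  exact Finset.sum_eq_zero fun j _ => by
    rw [fourierTransform_eq_kernelFourier, hΦ.kernelFourier_zero, mul_zero]

theorem IsLittlewoodPaleyFamily.mem_of_kernelFourier_ne_zero (hΦ : IsLittlewoodPaleyFamily Φ)
    {η : Space d} (hη : ‖η‖ ∈ Ioo ((2 : ℝ)⁻¹) 2) {j : ℤ} (hj : kernelFourier (Φ j) η ≠ 0) :
    j ∈ ({-1, 0, 1} : Finset ℤ) := by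
  have hb := hΦ.zpow_mul_norm_mem j hj
  have hlow : (2 : ℝ) ^ (-j) < 2 ^ (2 : ℤ) := by
    have : (2 : ℝ) ^ (-j) * 2⁻¹ < 2 :=
      (mul_le_mul_of_nonneg_left hη.1.le (by positivity)).trans_lt hb.2
    norm_num at this ⊢
    linarith
  have hhigh : (2 : ℝ) ^ (-2 : ℤ) < 2 ^ (-j) := by
    have : (2 : ℝ)⁻¹ < (2 : ℝ) ^ (-j) * 2 :=
      hb.1.trans_le (mul_le_mul_of_nonneg_left hη.2.le (by positivity))
    norm_num at this ⊢
    linarith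
  have h1 := (zpow_lt_zpow_iff_right₀ (by norm_num : (1 : ℝ) < 2)).mp hlow
  have h2 := (zpow_lt_zpow_iff_right₀ (by norm_num : (1 : ℝ) < 2)).mp hhigh
  simp only [Finset.mem_insert, Finset.mem_singleton]
  omega

theorem IsLittlewoodPaleyFamily.kernelFourier_fattenedKernel_eq_one
    (hΦ : IsLittlewoodPaleyFamily Φ) {η : Space d} (hη : ‖η‖ ∈ Ioo ((2 : ℝ)⁻¹) 2) :
    kernelFourier (fattenedKernel Φ) η = 1 := by
  have hη0 : η ≠ 0 := norm_pos_iff.mp ((by norm_num : (0 : ℝ) < 2⁻¹).trans hη.1)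
  have hsum : HasSum (fun j : ℤ => fourierTransform (Φ j) η)
      (∑ j ∈ {-1, 0, 1}, fourierTransform (Φ j) η) :=
    hasSum_sum_of_ne_finset_zero fun j hj => by
      by_contra hne
      rw [← ne_eq, fourierTransform_ne_zero_iff] at hne
      exact hj (hΦ.mem_of_kernelFourier_ne_zero hη hne)
  rw [kernelFourier_fattenedKernel, hsum.unique (hΦ.partition η hη0)]

/-- On the frequencies of `k₀`, the heat flow at time `R` is convolution with a kernel of mass at
most `δ`. -/
def HasHeatContraction {d : ℕ} (k₀ : Space d → ℂ) (R : ℝ) (δ : ℝ≥0∞) : Prop :=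
  ∃ A : Space d → ℂ, Measurable A ∧ Integrable A ∧ ∫⁻ y, ‖A y‖ₑ ≤ δ ∧
    ∀ ξ, kernelFourier A ξ * kernelFourier k₀ ξ =
      ((Real.exp (-(R * ‖ξ‖ ^ 2)) : ℝ) : ℂ) * kernelFourier k₀ ξ

theorem IsLittlewoodPaleyFamily.exists_hasHeatContraction (hΦ : IsLittlewoodPaleyFamily Φ) {δ : ℝ}
    (hδ : 0 < δ) :
    ∃ N : ℝ, 1 ≤ N ∧ ∀ l : ℤ,
      HasHeatContraction (Φ l) (N / ((2 : ℝ) ^ l) ^ 2) (ENNReal.ofReal δ) := by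
  obtain ⟨N, hN, A, hAm, hAi, hAle, hAF⟩ := exists_contracting_kernel
    (measurable_schwartz (fattenedKernel Φ)) (fattenedKernel Φ).integrable
    hΦ.integral_fattenedKernel (momentNorm_schwartz_ne_top _) hδ
  refine ⟨N, hN, fun l => ?_⟩
  have hl : (0 : ℝ) < 2 ^ l := by positivity
  refine ⟨dilate (2 ^ l) A, measurable_dilate _ hAm, integrable_dilate hl hAm hAi,
    (lintegral_enorm_dilate hl hAm).trans_le hAle, fun ξ => ?_⟩
  by_cases hξ : kernelFourier (Φ l) ξ = 0
  · rw [hξ, mul_zero, mul_zero]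
  congr 1
  have hnorm : ‖((2 : ℝ) ^ l)⁻¹ • ξ‖ = (2 : ℝ) ^ (-l) * ‖ξ‖ := by
    rw [norm_smul, norm_inv, Real.norm_of_nonneg hl.le, zpow_neg]
  rw [kernelFourier_dilate hl, hAF, hΦ.kernelFourier_fattenedKernel_eq_one
    (hnorm ▸ hΦ.zpow_mul_norm_mem l hξ), mul_one, hnorm, zpow_neg]
  congr 3
  field_simp

end LittlewoodPaley

section RealLine

variable {R f g V Q χ : ℝ → ℝ} {a b t T : ℝ}

theorem exists_Icc_of_isCompact {K : Set ℝ} (hK : IsCompact K) (h0 : K ⊆ Ioi 0) :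
    ∃ a b : ℝ, 0 < a ∧ a ≤ b ∧ K ⊆ Icc a b := by
  have hK' : IsCompact (K ∪ {1}) := hK.union isCompact_singleton
  have hne : (K ∪ {1}).Nonempty := ⟨1, Or.inr rfl⟩
  have hpos : K ∪ {1} ⊆ Ioi 0 := union_subset h0 (singleton_subset_iff.mpr (mem_Ioi.mpr one_pos))
  exact ⟨sInf (K ∪ {1}), sSup (K ∪ {1}), hpos (hK'.sInf_mem hne),
    csInf_le_csSup hne hK'.bddBelow hK'.bddAbove,
    fun x hx => ⟨csInf_le hK'.bddBelow (Or.inl hx), le_csSup hK'.bddAbove (Or.inl hx)⟩⟩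

theorem eq_zero_of_tsupport_subset_Icc (h : tsupport f ⊆ Icc a b) (ht : t ∉ Icc a b) :
    f t = 0 :=
  image_eq_zero_of_notMem_tsupport fun hm => ht (h hm)

theorem tsupport_subset_Icc_of_forall_eq_zero (h : ∀ t ∉ Icc a b, f t = 0) :
    tsupport f ⊆ Icc a b :=
  closure_minimal (fun t ht => by_contra fun hn => ht (h t hn)) isClosed_Icc

theorem setIntegral_Ioi_eq_integral (ha : 0 < a) (h : ∀ t ∉ Icc a b, f t = 0) :
    ∫ t in Ioi (0 : ℝ), f t = ∫ t, f t :=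
  setIntegral_eq_integral_of_forall_compl_eq_zero fun t ht =>
    h t fun hab => ht (ha.trans_le hab.1)

theorem setIntegral_Ioi_eq_intervalIntegral (hb : 0 ≤ b) (h : ∀ t, b < t → f t = 0) :
    ∫ t in Ioi (0 : ℝ), f t = ∫ t in (0 : ℝ)..b, f t := by
  rw [intervalIntegral.integral_of_le hb]
  exact setIntegral_eq_of_subset_of_forall_sdiff_eq_zero measurableSet_Ioi Ioc_subset_Ioi_self
    fun t ht => h t (not_le.mp fun hn => ht.2 ⟨ht.1, hn⟩)

theorem intervalIntegrable_of_integrableOn (hf : ∀ T, IntegrableOn f (Ioc 0 T)) (hT : 0 ≤ T) :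
    IntervalIntegrable f volume 0 T :=
  (intervalIntegrable_iff_integrableOn_Ioc_of_le hT).mpr (hf T)

theorem locallyIntegrableOn_Ioi (hf : ∀ T, IntegrableOn f (Ioc 0 T)) :
    LocallyIntegrableOn f (Ioi 0) := by
  rw [locallyIntegrableOn_iff isOpen_Ioi.isLocallyClosed]
  intro K hK hK2
  obtain ⟨a, b, ha, -, hKab⟩ := exists_Icc_of_isCompact hK2 hK
  exact (hf b).mono_set fun t ht => ⟨ha.trans_le (hKab ht).1, (hKab ht).2⟩

theorem integrableOn_Ioi_mul_of_continuous (hR : ∀ T, IntegrableOn R (Ioc 0 T))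
    (hf : Continuous f) (hf0 : ∀ t, b < t → f t = 0) :
    IntegrableOn (fun t => R t * f t) (Ioi 0) := by
  obtain ⟨M, hM⟩ :=
    (isCompact_Icc (a := 0) (b := b)).exists_bound_of_continuousOn hf.continuousOn
  have h1 : IntegrableOn (fun t => R t * f t) (Ioc 0 b) :=
    (hR b).mul_bdd hf.aestronglyMeasurable
      (ae_restrict_of_forall_mem measurableSet_Ioc fun t ht => hM t (Ioc_subset_Icc_self ht))
  refine h1.of_forall_sdiff_eq_zero measurableSet_Ioi fun t ht => ?_
  rw [hf0 t (not_le.mp fun h2 => ht.2 ⟨ht.1, h2⟩), mul_zero]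

theorem exists_contDiff_deriv_eq (hg : ContDiff ℝ ∞ g) (hg0 : ∀ t ∉ Icc a b, g t = 0)
    (hgi : ∫ t, g t = 0) :
    ∃ χ : ℝ → ℝ, ContDiff ℝ ∞ χ ∧ (∀ t ∉ Icc a b, χ t = 0) ∧ deriv χ = g := by
  have hderiv : ∀ t, HasDerivAt (fun t => ∫ r in (a - 1)..t, g r) (g t) t := fun t =>
    intervalIntegral.integral_hasDerivAt_right (hg.continuous.intervalIntegrable _ _)
      (hg.continuous.stronglyMeasurableAtFilter _ _) hg.continuous.continuousAt
  have hderiv_eq : deriv (fun t => ∫ r in (a - 1)..t, g r) = g := funext fun t => (hderiv t).deriv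
  refine ⟨_, contDiff_infty_iff_deriv.mpr ⟨fun t => (hderiv t).differentiableAt, ?_⟩,
    fun t ht => ?_, hderiv_eq⟩
  · rwa [hderiv_eq]
  rcases lt_or_ge t a with hta | hta
  · refine intervalIntegral.integral_zero_ae (ae_of_all _ fun r hr => hg0 r fun hr2 => ?_)
    exact absurd hr2.1 (not_le.mpr (hr.2.trans_lt (max_lt (by linarith) hta)))
  · have hbt : b < t := not_le.mp fun h3 => ht ⟨hta, h3⟩
    rw [← hgi, intervalIntegral.integral_of_le (by linarith)]
    exact setIntegral_eq_integral_of_forall_compl_eq_zero fun r hr => hg0 r fun hr2 =>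
      hr ⟨by linarith [hr2.1], by linarith [hr2.2]⟩

/-- The weak derivative of `V` on the half line `(0, ∞)` is `Q`, in the sense of distributions;
both functions are meant to be integrable near `0`. -/
def HasWeakDerivIoi (V Q : ℝ → ℝ) : Prop :=
  ∀ χ : ℝ → ℝ, ContDiff ℝ ∞ χ → HasCompactSupport χ → tsupport χ ⊆ Ioi 0 →
    ∫ t in Ioi (0 : ℝ), (V t * deriv χ t + Q t * χ t) = 0

theorem HasWeakDerivIoi.integral_mul_eq_mul_integral (h : HasWeakDerivIoi R 0)
    (hR : ∀ T, IntegrableOn R (Ioc 0 T)) (ha : 0 < a) (hf : ContDiff ℝ ∞ f)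
    (hf0 : ∀ t ∉ Icc a b, f t = 0) (hg : ContDiff ℝ ∞ g) (hg0 : ∀ t ∉ Icc a b, g t = 0)
    (hf1 : ∫ t, f t = 1) :
    ∫ t in Ioi (0 : ℝ), R t * g t = (∫ t in Ioi (0 : ℝ), R t * f t) * ∫ t, g t := by
  have integrable_of : ∀ {e : ℝ → ℝ}, ContDiff ℝ ∞ e → (∀ t ∉ Icc a b, e t = 0) → Integrable e :=
    fun he he0 => he.continuous.integrable_of_hasCompactSupport (.intro isCompact_Icc he0)
  have integrable_mul_of : ∀ {e : ℝ → ℝ}, ContDiff ℝ ∞ e → (∀ t ∉ Icc a b, e t = 0) →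
      IntegrableOn (fun t => R t * e t) (Ioi 0) :=
    fun he he0 => integrableOn_Ioi_mul_of_continuous hR he.continuous fun t ht =>
      he0 t fun hab => absurd hab.2 (not_le.mpr ht)
  set m := ∫ t, g t
  obtain ⟨χ, hχ, hχ0, hderiv⟩ := exists_contDiff_deriv_eq (a := a) (b := b)
    (g := fun t => g t - m * f t) (hg.sub (contDiff_const.mul hf))
    (fun t ht => by rw [hf0 t ht, hg0 t ht, mul_zero, sub_zero])
    (by rw [integral_sub (integrable_of hg hg0) ((integrable_of hf hf0).const_mul _),
      integral_const_mul, hf1, mul_one, sub_self])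
  have hzero := h χ hχ (.intro isCompact_Icc hχ0)
    ((tsupport_subset_Icc_of_forall_eq_zero hχ0).trans fun t ht => ha.trans_le ht.1)
  have hsplit : ∀ t, R t * deriv χ t + (0 : ℝ → ℝ) t * χ t = R t * g t - m * (R t * f t) :=
    fun t => by
      rw [hderiv, Pi.zero_apply]
      ring
  simp only [hsplit] at hzero
  rw [integral_sub (integrable_mul_of hg hg0) ((integrable_mul_of hf hf0).const_mul _),
    integral_const_mul] at hzero
  linarith

theorem HasWeakDerivIoi.ae_eq_const (h : HasWeakDerivIoi R 0)
    (hR : ∀ T, IntegrableOn R (Ioc 0 T)) :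
    ∃ c : ℝ, ∀ᵐ t ∂volume.restrict (Ioi (0 : ℝ)), R t = c := by
  let bump : ContDiffBump (2 : ℝ) := ⟨1 / 2, 1, by norm_num, by norm_num⟩
  have hbump : tsupport (bump.normed volume) = Icc 1 3 := by
    rw [bump.tsupport_normed_eq, Real.closedBall_eq_Icc]
    norm_num [bump]
  set c := ∫ t in Ioi (0 : ℝ), R t * bump.normed volume t
  have hRc : ∀ T, IntegrableOn (fun t => R t - c) (Ioc 0 T) := fun T =>
    (hR T).sub (integrableOn_const (by simp))
  have hae := isOpen_Ioi.ae_eq_zero_of_integral_contDiff_smul_eq_zero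
    (locallyIntegrableOn_Ioi hRc) fun g hg hgc hgs => ?_
  · refine ⟨c, (ae_restrict_iff' measurableSet_Ioi).mpr ?_⟩
    filter_upwards [hae] with t ht ht0
    exact sub_eq_zero.mp (ht ht0)
  obtain ⟨a, b, ha, -, hab⟩ := exists_Icc_of_isCompact
    (hgc.isCompact.union (isCompact_Icc (a := (1 : ℝ)) (b := 3)))
    (union_subset hgs fun t ht => one_pos.trans_le ht.1)
  have hg0 : ∀ t ∉ Icc a b, g t = 0 := fun t =>
    eq_zero_of_tsupport_subset_Icc (subset_union_left.trans hab)
  have hRg := h.integral_mul_eq_mul_integral hR ha bump.contDiff_normed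
    (fun t => eq_zero_of_tsupport_subset_Icc (hbump ▸ subset_union_right.trans hab)) hg hg0
    bump.integral_normed
  calc ∫ t, g t • (R t - c)
      = ∫ t in Ioi (0 : ℝ), g t • (R t - c) :=
        (setIntegral_Ioi_eq_integral ha fun t ht => by rw [hg0 t ht, zero_smul]).symm
    _ = (∫ t in Ioi (0 : ℝ), R t * g t) - c * ∫ t in Ioi (0 : ℝ), g t := by
        rw [← integral_const_mul, ← integral_sub
          (integrableOn_Ioi_mul_of_continuous hR hg.continuous fun t ht =>
            hg0 t fun htb => absurd htb.2 (not_le.mpr ht))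
          ((hg.continuous.integrable_of_hasCompactSupport hgc).integrableOn.const_mul _)]
        exact integral_congr_ae (ae_of_all _ fun t => by simp only [smul_eq_mul]; ring)
    _ = 0 := by rw [hRg, setIntegral_Ioi_eq_integral ha hg0, sub_self]

theorem absolutelyContinuousOnInterval_primitive (hQ : ∀ T, IntegrableOn Q (Ioc 0 T))
    (hT : 0 ≤ T) : AbsolutelyContinuousOnInterval (fun t => ∫ r in (0 : ℝ)..t, Q r) 0 T :=
  (intervalIntegrable_of_integrableOn hQ hT).absolutelyContinuousOnInterval_intervalIntegral
    left_mem_uIcc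

theorem integrableOn_primitive (hQ : ∀ T, IntegrableOn Q (Ioc 0 T)) (T : ℝ) :
    IntegrableOn (fun t => ∫ r in (0 : ℝ)..t, Q r) (Ioc 0 T) := by
  rcases le_total 0 T with hT | hT
  · have hcont := (absolutelyContinuousOnInterval_primitive hQ hT).continuousOn
    rw [uIcc_of_le hT] at hcont
    exact hcont.integrableOn_Icc.mono_set Ioc_subset_Icc_self
  · simp only [Ioc_eq_empty (not_lt.mpr hT), integrableOn_empty]

theorem integral_primitive_mul_deriv (hQ : ∀ T, IntegrableOn Q (Ioc 0 T))
    (hχ : ContDiff ℝ ∞ χ) (hT : 0 ≤ T) (h0 : χ 0 = 0) (hT0 : χ T = 0) :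
    ∫ t in (0 : ℝ)..T, (∫ r in (0 : ℝ)..t, Q r) * deriv χ t =
      -∫ t in (0 : ℝ)..T, Q t * χ t := by
  have hac := absolutelyContinuousOnInterval_primitive hQ hT
  have hχac : AbsolutelyContinuousOnInterval χ 0 T :=
    (hχ.contDiffOn.of_le (by exact_mod_cast le_top)).absolutelyContinuousOnInterval
  rw [hac.integral_mul_deriv_eq_deriv_mul hχac, h0, hT0, mul_zero, mul_zero, sub_zero, zero_sub]
  congr 1
  refine intervalIntegral.integral_congr_ae ?_
  filter_upwards [(intervalIntegrable_of_integrableOn hQ hT).ae_hasDerivAt_integral] with t ht htm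
  rw [(ht (uIoc_subset_uIcc htm) 0 left_mem_uIcc).deriv]

theorem HasWeakDerivIoi.sub_primitive (h : HasWeakDerivIoi V Q)
    (hV : ∀ T, IntegrableOn V (Ioc 0 T)) (hQ : ∀ T, IntegrableOn Q (Ioc 0 T)) :
    HasWeakDerivIoi (fun t => V t - ∫ r in (0 : ℝ)..t, Q r) 0 := by
  intro χ hχ hχc hχs
  obtain ⟨a, b, ha, hab, hKab⟩ := exists_Icc_of_isCompact hχc.isCompact hχs
  have hb : 0 ≤ b + 1 := by linarith
  have hχ0 : ∀ t ∉ Icc a b, χ t = 0 := fun t ht => eq_zero_of_tsupport_subset_Icc hKab ht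
  have hχ'0 : ∀ t ∉ Icc a b, deriv χ t = 0 := fun t ht =>
    eq_zero_of_tsupport_subset_Icc (tsupport_deriv_subset.trans hKab) ht
  have hχ'c : Continuous (deriv χ) := hχ.continuous_deriv (by simp)
  have hbt : ∀ {t}, b + 1 < t → t ∉ Icc a b := fun ht h2 => by linarith [h2.2]
  have hbyparts := integral_primitive_mul_deriv hQ hχ hb
    (hχ0 0 fun h2 => by linarith [h2.1]) (hχ0 (b + 1) fun h2 => by linarith [h2.2])
  have hweak := h χ hχ hχc hχs
  rw [setIntegral_Ioi_eq_intervalIntegral hb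
    (fun t ht => by rw [hχ0 t (hbt ht), hχ'0 t (hbt ht), mul_zero, mul_zero, add_zero])] at hweak
  have i1 := (intervalIntegrable_of_integrableOn hV hb).mul_continuousOn hχ'c.continuousOn
  have i2 :=
    (intervalIntegrable_of_integrableOn hQ hb).mul_continuousOn hχ.continuous.continuousOn
  have i3 := (intervalIntegrable_of_integrableOn (integrableOn_primitive hQ) hb).mul_continuousOn
    hχ'c.continuousOn
  rw [intervalIntegral.integral_add i1 i2] at hweak
  simp only [Pi.zero_apply, zero_mul, add_zero]
  rw [setIntegral_Ioi_eq_intervalIntegral hb (fun t ht => by rw [hχ'0 t (hbt ht), mul_zero])]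
  simp only [sub_mul]
  rw [intervalIntegral.integral_sub i1 i3, hbyparts]
  linarith

theorem HasWeakDerivIoi.ae_eq_primitive (h : HasWeakDerivIoi V Q)
    (hV : ∀ T, IntegrableOn V (Ioc 0 T)) (hQ : ∀ T, IntegrableOn Q (Ioc 0 T)) :
    ∃ c : ℝ, ∀ᵐ t ∂volume.restrict (Ioi (0 : ℝ)), V t = c + ∫ r in (0 : ℝ)..t, Q r := by
  obtain ⟨c, hc⟩ := (h.sub_primitive hV hQ).ae_eq_const
    fun T => (hV T).sub (integrableOn_primitive hQ T)
  exact ⟨c, hc.mono fun t ht => sub_eq_iff_eq_add.mp ht⟩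

theorem absolutelyContinuousOnInterval_comp {B : ℝ → ℝ} {K : ℝ≥0} (hB : LipschitzWith K B)
    (hf : AbsolutelyContinuousOnInterval f a b) :
    AbsolutelyContinuousOnInterval (fun t => B (f t)) a b := by
  rw [absolutelyContinuousOnInterval_iff] at hf ⊢
  intro ε hε
  obtain ⟨δ, hδ, hδ2⟩ := hf (ε / (K + 1)) (by positivity)
  refine ⟨δ, hδ, fun E hE hE2 => ?_⟩
  have hsum := (lt_div_iff₀ (by positivity)).mp (hδ2 E hE hE2)
  calc ∑ i ∈ Finset.range E.1, dist (B (f (E.2 i).1)) (B (f (E.2 i).2))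
      ≤ ∑ i ∈ Finset.range E.1, K * dist (f (E.2 i).1) (f (E.2 i).2) :=
        Finset.sum_le_sum fun i _ => hB.dist_le_mul _ _
    _ = K * ∑ i ∈ Finset.range E.1, dist (f (E.2 i).1) (f (E.2 i).2) :=
        (Finset.mul_sum _ _ _).symm
    _ ≤ (∑ i ∈ Finset.range E.1, dist (f (E.2 i).1) (f (E.2 i).2)) * (K + 1) := by
        nlinarith [Finset.sum_nonneg fun i (_ : i ∈ Finset.range E.1) =>
          dist_nonneg (x := f (E.2 i).1) (y := f (E.2 i).2)]
    _ < ε := hsum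

theorem comp_primitive_sub_eq_integral (hT : 0 ≤ T) (hf : IntervalIntegrable f volume 0 T)
    {B : ℝ → ℝ} (hB : Differentiable ℝ B) (hB1 : ∀ r, |deriv B r| ≤ 1) (w : ℝ)
    (ha : 0 ≤ a) (hab : a ≤ b) (hb : b ≤ T) :
    B (w + ∫ r in (0 : ℝ)..b, f r) - B (w + ∫ r in (0 : ℝ)..a, f r) =
      ∫ t in a..b, deriv B (w + ∫ r in (0 : ℝ)..t, f r) * f t := by
  have hsub : uIcc a b ⊆ uIcc 0 T := by
    rw [uIcc_of_le hab, uIcc_of_le hT]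
    exact Icc_subset_Icc ha hb
  have hlip : LipschitzWith (1 * 1) fun r => B (w + r) :=
    (lipschitzWith_of_nnnorm_deriv_le hB hB1).comp (isometry_add_left w).lipschitz
  have hac := absolutelyContinuousOnInterval_comp hlip
    ((hf.absolutelyContinuousOnInterval_intervalIntegral (c := 0) left_mem_uIcc).mono hsub)
  rw [← hac.integral_deriv_eq_sub]
  refine intervalIntegral.integral_congr_ae ?_
  filter_upwards [hf.ae_hasDerivAt_integral] with t ht htm
  have hprim := (ht (hsub (uIoc_subset_uIcc htm)) 0 left_mem_uIcc).const_add w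
  exact ((hB _).hasDerivAt.comp t hprim).deriv

end RealLine

section TimeRegularity

variable {d : ℕ} {L κ : ℝ} {F : Type*} [NormedAddCommGroup F]

theorem LocallySquareIntegrable.memLp {f : ℝ → Space d → F} (h : LocallySquareIntegrable L f)
    (T : ℝ) : MemLp (fun p : ℝ × Space d => f p.1 p.2) 2
      ((volume.restrict (Ioo 0 T)).prod (cellMeasure d L)) := by
  rw [cellMeasure, Measure.prod_smul_right]
  exact (h T).smul_measure ENNReal.ofReal_ne_top

theorem LocallySquareIntegrable.integrable {f : ℝ → Space d → F}
    (h : LocallySquareIntegrable L f) (T : ℝ) : Integrable (fun p : ℝ × Space d => f p.1 p.2)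
      ((volume.restrict (Ioo 0 T)).prod (cellMeasure d L)) :=
  (h.memLp T).integrable one_le_two

theorem LocallySquareIntegrable.integrable_inner {v w : ℝ → Space d → Space d}
    (hv : LocallySquareIntegrable L v) (hw : LocallySquareIntegrable L w) (T : ℝ) :
    Integrable (fun p : ℝ × Space d => inner ℝ (v p.1 p.2) (w p.1 p.2))
      ((volume.restrict (Ioo 0 T)).prod (cellMeasure d L)) :=
  ((hv.memLp T).norm.integrable_mul (hw.memLp T).norm).mono'
    ((hv.memLp T).aestronglyMeasurable.inner (hw.memLp T).aestronglyMeasurable)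
    (ae_of_all _ fun _ => norm_inner_le_norm _ _)

theorem measurable_lintegral_enorm_sq [MeasurableSpace F] [BorelSpace F] {f : ℝ → Space d → F}
    (hm : Measurable fun p : ℝ × Space d => f p.1 p.2) :
    Measurable fun t => ∫⁻ x, ‖f t x‖ₑ ^ 2 ∂cellMeasure d L :=
  Measurable.lintegral_prod_right' (f := fun p : ℝ × Space d => ‖f p.1 p.2‖ₑ ^ 2)
    (hm.enorm.pow_const 2)

theorem LocallySquareIntegrable.lintegral_ne_top [MeasurableSpace F] [BorelSpace F]
    {f : ℝ → Space d → F} (h : LocallySquareIntegrable L f)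
    (hm : Measurable fun p : ℝ × Space d => f p.1 p.2) (T : ℝ) :
    ∫⁻ t in Ioo 0 T, ∫⁻ x, ‖f t x‖ₑ ^ 2 ∂cellMeasure d L ≠ ⊤ := by
  have hfin := (h.memLp T).eLpNorm_lt_top
  rw [eLpNorm_lt_top_iff_lintegral_rpow_enorm_lt_top (by simp) (by simp)] at hfin
  simp only [ENNReal.toReal_ofNat, ENNReal.rpow_ofNat] at hfin
  rw [lintegral_prod _ (hm.enorm.pow_const 2).aemeasurable] at hfin
  exact hfin.ne

theorem ae_Ioi_of_forall_Ioo {p : ℝ → Prop} (h : ∀ T : ℝ, ∀ᵐ t ∂volume.restrict (Ioo 0 T), p t) :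
    ∀ᵐ t ∂volume.restrict (Ioi (0 : ℝ)), p t := by
  have hUnion : Ioi (0 : ℝ) = ⋃ n : ℕ, Ioo (0 : ℝ) n := by
    ext t
    simp only [mem_Ioi, mem_iUnion, mem_Ioo, exists_and_left]
    exact ⟨fun ht => ⟨ht, exists_nat_gt t⟩, And.left⟩
  rw [hUnion, ae_restrict_iUnion_iff]
  exact fun n => h n

theorem ae_Ioi_comp_add {p : ℝ → Prop} (h : ∀ᵐ t ∂volume.restrict (Ioi (0 : ℝ)), p t) {T : ℝ}
    (hT : 0 ≤ T) : ∀ᵐ t ∂volume.restrict (Ioi (0 : ℝ)), p (t + T) := by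
  rw [ae_restrict_iff' measurableSet_Ioi] at h ⊢
  filter_upwards [(measurePreserving_add_right volume T).quasiMeasurePreserving.ae h] with t ht h0
  exact ht (add_pos_of_pos_of_nonneg h0 hT)

theorem LocallySquareIntegrable.ae_ne_top [MeasurableSpace F] [BorelSpace F]
    {f : ℝ → Space d → F} (h : LocallySquareIntegrable L f)
    (hm : Measurable fun p : ℝ × Space d => f p.1 p.2) :
    ∀ᵐ t ∂volume.restrict (Ioi (0 : ℝ)), ∫⁻ x, ‖f t x‖ₑ ^ 2 ∂cellMeasure d L ≠ ⊤ :=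
  ae_Ioi_of_forall_Ioo fun T =>
    (ae_lt_top (measurable_lintegral_enorm_sq hm) (h.lintegral_ne_top hm T)).mono fun _ ht => ht.ne

/-- The properties which the velocity `u`, the scalar `θ` and its weak gradient `g` have at almost
every time. -/
structure RegularTime {d : ℕ} (L : ℝ) (u : Space d → Space d) (θ : Space d → ℝ)
    (g : Space d → Space d) : Prop where
  velocity_sq : ∫⁻ x, ‖u x‖ₑ ^ 2 ∂cellMeasure d L ≠ ⊤
  scalar_sq : ∫⁻ x, ‖θ x‖ₑ ^ 2 ∂cellMeasure d L ≠ ⊤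
  grad_sq : ∫⁻ x, ‖g x‖ₑ ^ 2 ∂cellMeasure d L ≠ ⊤
  divFree : WeakDivFree L u
  weakGradient : IsWeakGradient L θ g

theorem RegularTime.integrable_scalar {u g : Space d → Space d} {θ : Space d → ℝ}
    (h : RegularTime L u θ g) (hθ : Measurable θ) :
    Integrable (fun x => (θ x : ℂ)) (cellMeasure d L) :=
  (integrable_of_lintegral_enorm_sq_ne_top hθ.aestronglyMeasurable h.scalar_sq).ofReal

theorem RegularTime.integrable_grad_coord {u g : Space d → Space d} {θ : Space d → ℝ}
    (h : RegularTime L u θ g) (hg : Measurable g) (i : Fin d) :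
    Integrable (fun x => (g x i : ℂ)) (cellMeasure d L) :=
  integrable_of_lintegral_enorm_sq_ne_top (measurable_coord hg i).aestronglyMeasurable
    (lintegral_enorm_sq_coord_ne_top h.grad_sq i)

theorem reTrigPoly_singleton_neg (m : Fin d → ℤ) (z : ℂ) (x : Space d) :
    reTrigPoly L {-m} (fun _ => z) x = (z * planeWave L m (-x)).re := by
  simp only [reTrigPoly, trigPoly, Finset.sum_singleton, planeWave_neg]

theorem integrable_mul_reTrigPoly_singleton {r : Space d → ℝ}
    (hr : Integrable (fun x => (r x : ℂ)) (cellMeasure d L)) (m : Fin d → ℤ) (z : ℂ) :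
    Integrable (fun x => r x * reTrigPoly L {-m} (fun _ => z) x) (cellMeasure d L) := by
  refine ((integrable_mul_planeWave (L := L) hr m).const_mul z).re.congr (ae_of_all _ fun x => ?_)
  simp only [RCLike.re_eq_complex_re, reTrigPoly_singleton_neg]
  rw [mul_left_comm, Complex.re_ofReal_mul]

theorem integral_mul_reTrigPoly_singleton {r : Space d → ℝ}
    (hr : Integrable (fun x => (r x : ℂ)) (cellMeasure d L)) (m : Fin d → ℤ) (z : ℂ) :
    ∫ x, r x * reTrigPoly L {-m} (fun _ => z) x ∂cellMeasure d L =
      (z * cellFourierCoeff L (fun x => (r x : ℂ)) m).re := by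
  simp only [reTrigPoly_singleton_neg]
  exact integral_mul_re_const_mul (integrable_mul_planeWave hr m) z

theorem IsWeakGradient.integral_inner_gradient_singleton (hL : 0 < L) {θ : Space d → ℝ}
    {g : Space d → Space d} (h : IsWeakGradient L θ g)
    (hθ : Integrable (fun x => (θ x : ℂ)) (cellMeasure d L))
    (hg : ∀ i, Integrable (fun x => (g x i : ℂ)) (cellMeasure d L)) (m : Fin d → ℤ) (z : ℂ) :
    ∫ x, inner ℝ (g x) (gradient (reTrigPoly L {-m} (fun _ => z)) x) ∂cellMeasure d L =
      ‖waveVector L m‖ ^ 2 * (z * cellFourierCoeff L (fun x => (θ x : ℂ)) m).re := by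
  have hneg (i : Fin d) : waveVector L (-m) i = -waveVector L m i := by simp [waveVector]
  have hgrad (i : Fin d) (x : Space d) :
      gradient (reTrigPoly L {-m} fun _ => z) x i =
        reTrigPoly L {-m} (fun _ => z * (Complex.I * (waveVector L (-m) i : ℝ))) x := by
    rw [gradient_reTrigPoly]
    simp only [reTrigPoly, trigPoly, Finset.sum_singleton]
  have hsq (i : Fin d) : (z * (Complex.I * (waveVector L (-m) i : ℝ)) *
      (Complex.I * (waveVector L m i : ℝ) * cellFourierCoeff L (fun x => (θ x : ℂ)) m)).re =
        waveVector L m i ^ 2 * (z * cellFourierCoeff L (fun x => (θ x : ℂ)) m).re := by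
    rw [← Complex.re_ofReal_mul, hneg]
    congr 1
    push_cast
    linear_combination (-z * (waveVector L m i : ℂ) ^ 2 *
      cellFourierCoeff L (fun x => (θ x : ℂ)) m) * Complex.I_sq
  simp only [PiLp.inner_apply, RCLike.inner_apply, conj_trivial, hgrad]
  simp only [mul_comm (reTrigPoly L _ _ _)]
  rw [integral_finsetSum _ fun i _ => integrable_mul_reTrigPoly_singleton (hg i) m _]
  simp only [integral_mul_reTrigPoly_singleton (hg _), h.cellFourierCoeff_eq hL hθ hg, hsq]
  rw [← Finset.sum_mul, ← EuclideanSpace.real_norm_sq_eq]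

theorem RegularTime.setIntegral_mode (hL : 0 < L) {u g : Space d → Space d} {θ : Space d → ℝ}
    (h : RegularTime L u θ g) (hθ : Measurable θ) (hu : Measurable u) (hg : Measurable g)
    (m : Fin d → ℤ) (z z' : ℂ) :
    ∫ x in cell d L, (θ x * reTrigPoly L {-m} (fun _ => z') x -
        inner ℝ (u x) (g x) * reTrigPoly L {-m} (fun _ => z) x -
        κ * inner ℝ (g x) (gradient (reTrigPoly L {-m} (fun _ => z)) x)) =
      L ^ d * ((z' - (κ * ‖waveVector L m‖ ^ 2 : ℝ) * z) *
          cellFourierCoeff L (fun x => (θ x : ℂ)) m -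
        z * cellFourierCoeff L (fun x => ((inner ℝ (u x) (g x) : ℝ) : ℂ)) m).re := by
  have hθi := h.integrable_scalar hθ
  have hF := integrable_ofReal_inner hu hg h.velocity_sq h.grad_sq
  have hgi := integrable_of_lintegral_enorm_sq_ne_top hg.aestronglyMeasurable h.grad_sq
  have hθz := integrable_mul_reTrigPoly_singleton hθi m z'
  have hFz := integrable_mul_reTrigPoly_singleton hF m z
  have hgz := (integrable_inner_gradient_reTrigPoly hgi {-m} fun _ => z).const_mul κ
  have hsub : Integrable (fun x => θ x * reTrigPoly L {-m} (fun _ => z') x -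
      inner ℝ (u x) (g x) * reTrigPoly L {-m} (fun _ => z) x) (cellMeasure d L) := hθz.sub hFz
  rw [setIntegral_cell hL, smul_eq_mul, integral_sub hsub hgz, integral_sub hθz hFz,
    integral_const_mul, integral_mul_reTrigPoly_singleton hθi, integral_mul_reTrigPoly_singleton hF,
    h.weakGradient.integral_inner_gradient_singleton hL hθi (h.integrable_grad_coord hg),
    ← mul_assoc κ, ← Complex.re_ofReal_mul, ← Complex.sub_re, ← Complex.sub_re]
  congr 2
  ring

theorem isTestFunction_reTrigPoly_singleton (hL : 0 < L) (k : Fin d → ℤ) (z : ℂ) {p : ℝ → ℝ}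
    (hp : ContDiff ℝ ∞ p) {T : ℝ} (hT : ∀ t, T ≤ t → p t = 0) :
    IsTestFunction L fun t => reTrigPoly L {k} fun _ => (p t : ℂ) * z where
  smooth := by
    have hprod : (fun q : ℝ × Space d => reTrigPoly L {k} (fun _ => (p q.1 : ℂ) * z) q.2) =
        fun q => p q.1 * reTrigPoly L {k} (fun _ => z) q.2 := by
      ext q
      simp only [reTrigPoly, trigPoly, Finset.sum_singleton, mul_assoc, Complex.re_ofReal_mul]
    rw [hprod]
    exact (hp.comp contDiff_fst).mul ((contDiff_reTrigPoly _ _).comp contDiff_snd)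
  periodic t := isPeriodic_reTrigPoly hL _ _
  support := ⟨T, fun t ht x => by simp [hT t ht, reTrigPoly, trigPoly]⟩

theorem deriv_reTrigPoly_singleton (k : Fin d → ℤ) (z : ℂ) {p : ℝ → ℝ} {p' t : ℝ}
    (hp : HasDerivAt p p' t) (x : Space d) :
    deriv (fun τ => reTrigPoly L {k} (fun _ => (p τ : ℂ) * z) x) t =
      reTrigPoly L {k} (fun _ => (p' : ℂ) * z) x := by
  simp only [reTrigPoly, trigPoly, Finset.sum_singleton, mul_assoc, Complex.re_ofReal_mul]
  exact (hp.mul_const _).deriv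

theorem hasDerivAt_exp_mul {χ : ℝ → ℝ} {χ' t : ℝ} (hχ : HasDerivAt χ χ' t) (lam : ℝ) :
    HasDerivAt (fun τ => Real.exp (lam * τ) * χ τ)
      (lam * (Real.exp (lam * t) * χ t) + Real.exp (lam * t) * χ') t := by
  convert! (((hasDerivAt_id t).const_mul lam).exp).mul hχ using 1
  simp only [id_eq, mul_one]
  ring

/-- The Fourier coefficient of `f t` at the wave number `m`, as a function of the time `t`. -/
def timeCoeff {d : ℕ} (L : ℝ) (f : ℝ → Space d → ℝ) (m : Fin d → ℤ) (t : ℝ) : ℂ :=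
  cellFourierCoeff L (fun x => (f t x : ℂ)) m

/-- The Fourier coefficient of `f t` at the wave number `m`, multiplied by the factor which makes it
constant in time if `f` solves the heat equation with diffusivity `κ`. -/
def heatCoeff {d : ℕ} (L κ : ℝ) (f : ℝ → Space d → ℝ) (m : Fin d → ℤ) (t : ℝ) : ℂ :=
  (Real.exp (κ * ‖waveVector L m‖ ^ 2 * t) : ℂ) * timeCoeff L f m t

/-- The transport term `u ⬝ ∇θ`. -/
def transportTerm {d : ℕ} (u Dθ : ℝ → Space d → Space d) (t : ℝ) (x : Space d) : ℝ :=
  inner ℝ (u t x) (Dθ t x)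

@[fun_prop]
theorem measurable_timeCoeff {f : ℝ → Space d → ℝ}
    (hf : Measurable fun p : ℝ × Space d => f p.1 p.2) (m : Fin d → ℤ) :
    Measurable (timeCoeff L f m) := by
  refine (StronglyMeasurable.integral_prod_right'
    (f := fun p : ℝ × Space d => (f p.1 p.2 : ℂ) * planeWave L m (-p.2)) ?_).measurable
  exact ((Complex.measurable_ofReal.comp hf).mul (((continuous_planeWave m).measurable.comp
    measurable_neg).comp measurable_snd)).stronglyMeasurable

@[fun_prop]
theorem measurable_heatCoeff {f : ℝ → Space d → ℝ}
    (hf : Measurable fun p : ℝ × Space d => f p.1 p.2) (m : Fin d → ℤ) :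
    Measurable (heatCoeff L κ f m) := by
  unfold heatCoeff
  fun_prop

theorem integrableOn_timeCoeff {f : ℝ → Space d → ℝ} {T : ℝ}
    (hf : Integrable (fun p : ℝ × Space d => f p.1 p.2)
      ((volume.restrict (Ioo 0 T)).prod (cellMeasure d L))) (m : Fin d → ℤ) :
    IntegrableOn (timeCoeff L f m) (Ioc 0 T) := by
  rw [integrableOn_Ioc_iff_integrableOn_Ioo]
  exact Integrable.integral_prod_left (hf.ofReal.mul_bdd (c := 1)
    (((continuous_planeWave m).comp continuous_neg).comp continuous_snd).aestronglyMeasurable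
    (ae_of_all _ fun _ => (norm_planeWave m _).le))

theorem integrableOn_heatCoeff {f : ℝ → Space d → ℝ} {T : ℝ}
    (hf : Integrable (fun p : ℝ × Space d => f p.1 p.2)
      ((volume.restrict (Ioo 0 T)).prod (cellMeasure d L))) (m : Fin d → ℤ) :
    IntegrableOn (heatCoeff L κ f m) (Ioc 0 T) := by
  have hexp : Continuous fun t : ℝ => (Real.exp (κ * ‖waveVector L m‖ ^ 2 * t) : ℂ) := by fun_prop
  refine IntegrableOn.mono_set ?_ Ioc_subset_Icc_self
  refine IntegrableOn.continuousOn_mul hexp.continuousOn ?_ isCompact_Icc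
  rw [integrableOn_Icc_iff_integrableOn_Ioc]
  exact integrableOn_timeCoeff hf m

variable {u : ℝ → Space d → Space d} {θ₀ : Space d → ℝ} {θ : ℝ → Space d → ℝ}
  {Dθ : ℝ → Space d → Space d}

theorem IsWeakSolution.ae_regularTime (hu : IsVelocityField L u)
    (h : IsWeakSolution L κ u θ₀ θ Dθ) :
    ∀ᵐ t ∂volume.restrict (Ioi (0 : ℝ)), RegularTime L (u t) (θ t) (Dθ t) := by
  filter_upwards [hu.sqIntegrable.ae_ne_top hu.measurable, h.sqIntegrable.ae_ne_top h.measurable,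
    h.grad_sqIntegrable.ae_ne_top h.grad_measurable, hu.divFree, h.weakGradient]
    with t h1 h2 h3 h4 h5
  exact ⟨h1, h2, h3, h4, h5⟩

theorem IsWeakSolution.measurable_transportTerm (hu : IsVelocityField L u)
    (h : IsWeakSolution L κ u θ₀ θ Dθ) :
    Measurable fun p : ℝ × Space d => transportTerm u Dθ p.1 p.2 :=
  hu.measurable.inner h.grad_measurable

theorem IsWeakSolution.integrableOn_heatCoeff_transportTerm (hu : IsVelocityField L u)
    (h : IsWeakSolution L κ u θ₀ θ Dθ) (m : Fin d → ℤ) (T : ℝ) :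
    IntegrableOn (heatCoeff L κ (transportTerm u Dθ) m) (Ioc 0 T) :=
  integrableOn_heatCoeff (hu.sqIntegrable.integrable_inner h.grad_sqIntegrable T) m

theorem IsWeakSolution.hasWeakDerivIoi_heatCoeff (hL : 0 < L) (hu : IsVelocityField L u)
    (h : IsWeakSolution L κ u θ₀ θ Dθ) (m : Fin d → ℤ) (z : ℂ) :
    HasWeakDerivIoi (fun t => (z * heatCoeff L κ θ m t).re)
      fun t => -(z * heatCoeff L κ (transportTerm u Dθ) m t).re := by
  intro χ hχ hχc hχs
  obtain ⟨a, b, ha, -, hKab⟩ := exists_Icc_of_isCompact hχc.isCompact hχs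
  have hχ0 {t : ℝ} (ht : t ∉ Icc a b) : χ t = 0 := eq_zero_of_tsupport_subset_Icc hKab ht
  set lam := κ * ‖waveVector L m‖ ^ 2 with hlam
  set p : ℝ → ℝ := fun t => Real.exp (lam * t) * χ t with hp
  have hpd (t : ℝ) : HasDerivAt p (lam * p t + Real.exp (lam * t) * deriv χ t) t :=
    hasDerivAt_exp_mul (hχ.differentiable (by simp) t).hasDerivAt lam
  have htest : IsTestFunction L fun t => reTrigPoly L {-m} fun _ => (p t : ℂ) * z :=
    isTestFunction_reTrigPoly_singleton hL (-m) z (by fun_prop) (T := b + 1) fun t ht => by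
      simp only [hp]; rw [hχ0 fun h2 => by linarith [h2.2], mul_zero]
  have heq := h.equation _ htest
  have hp0 : p 0 = 0 := by simp only [hp]; rw [hχ0 fun h2 => by linarith [h2.1], mul_zero]
  simp only [hp0, Complex.ofReal_zero, zero_mul, reTrigPoly, trigPoly, Finset.sum_const_zero,
    Complex.zero_re, mul_zero, integral_zero, add_zero] at heq
  refine (mul_eq_zero.mp ?_).resolve_left (pow_pos hL d).ne'
  rw [← integral_const_mul]
  refine Eq.trans (integral_congr_ae ?_) heq
  filter_upwards [h.ae_regularTime hu] with t ht
  have hmode := ht.setIntegral_mode hL (κ := κ) (h.measurable.comp measurable_prodMk_left)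
    (hu.measurable.comp measurable_prodMk_left) (h.grad_measurable.comp measurable_prodMk_left) m
    (p t * z) ((lam * p t + Real.exp (lam * t) * deriv χ t : ℝ) * z)
  simp only [← deriv_reTrigPoly_singleton (-m) z (hpd t)] at hmode
  refine Eq.trans ?_ hmode.symm
  rw [mul_comm _ (deriv χ t), mul_comm _ (χ t), mul_neg, ← sub_eq_add_neg, ← Complex.re_ofReal_mul,
    ← Complex.re_ofReal_mul, ← Complex.sub_re, ← hlam]
  congr 2
  simp only [heatCoeff, timeCoeff, transportTerm, hp, ← hlam]
  push_cast
  ring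

theorem exists_ae_eq_sub_integral_of_hasWeakDerivIoi {V Q : ℝ → ℂ}
    (hV : ∀ T, IntegrableOn V (Ioc 0 T)) (hQ : ∀ T, IntegrableOn Q (Ioc 0 T))
    (h : ∀ z : ℂ, HasWeakDerivIoi (fun t => (z * V t).re) fun t => -(z * Q t).re) :
    ∃ c : ℂ, ∀ᵐ t ∂volume.restrict (Ioi (0 : ℝ)), V t = c - ∫ r in (0 : ℝ)..t, Q r := by
  have hprim (z : ℂ) := (h z).ae_eq_primitive (fun T => ((hV T).const_mul z).re)
    fun T => ((hQ T).const_mul z).re.neg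
  obtain ⟨c₁, hc₁⟩ := hprim 1
  obtain ⟨c₂, hc₂⟩ := hprim (-Complex.I)
  refine ⟨⟨c₁, c₂⟩, ?_⟩
  filter_upwards [hc₁, hc₂, ae_restrict_mem measurableSet_Ioi] with t h₁ h₂ ht
  have hQt : IntervalIntegrable Q volume 0 t :=
    (intervalIntegrable_iff_integrableOn_Ioc_of_le (le_of_lt ht)).mpr (hQ t)
  have hre (z : ℂ) : ∫ r in (0 : ℝ)..t, (z * Q r).re = (z * ∫ r in (0 : ℝ)..t, Q r).re := by
    rw [← intervalIntegral.integral_const_mul]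
    exact Complex.reCLM.intervalIntegral_comp_comm (hQt.const_mul z)
  rw [intervalIntegral.integral_neg, hre, ← sub_eq_add_neg] at h₁ h₂
  apply Complex.ext
  · simpa using h₁
  · simpa using h₂

/-- Duhamel's formula at the time `t`, mode by mode: `c` is the initial datum of the modes of `θ`,
which are driven by the modes of the transport term. -/
def HasDuhamelModes {d : ℕ} (L κ : ℝ) (u : ℝ → Space d → Space d) (θ : ℝ → Space d → ℝ)
    (Dθ : ℝ → Space d → Space d) (c : (Fin d → ℤ) → ℂ) (t : ℝ) : Prop :=
  ∀ m, heatCoeff L κ θ m t = c m - ∫ r in (0 : ℝ)..t, heatCoeff L κ (transportTerm u Dθ) m r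

theorem IsWeakSolution.exists_ae_hasDuhamelModes (hL : 0 < L) (hu : IsVelocityField L u)
    (h : IsWeakSolution L κ u θ₀ θ Dθ) :
    ∃ c, ∀ᵐ t ∂volume.restrict (Ioi (0 : ℝ)), HasDuhamelModes L κ u θ Dθ c t := by
  choose c hc using fun m => exists_ae_eq_sub_integral_of_hasWeakDerivIoi
    (fun T => integrableOn_heatCoeff (h.sqIntegrable.integrable T) m)
    (h.integrableOn_heatCoeff_transportTerm hu m) (h.hasWeakDerivIoi_heatCoeff hL hu m)
  exact ⟨c, ae_all_iff.mpr hc⟩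

end TimeRegularity

section TimePrimitive

variable {X Y : Type*} [MeasurableSpace X] [MeasurableSpace Y] {μ : Measure X}
  {w₀ : X → ℝ} {f : ℝ → X → ℝ} {a b t ε : ℝ}

/-- The smooth approximation `√(ε ^ 2 + w ^ 2)` of `|w|`, used to differentiate `L¹` norms. -/
def smoothAbs (ε w : ℝ) : ℝ := √(ε ^ 2 + w ^ 2)

theorem contDiff_smoothAbs (hε : 0 < ε) : ContDiff ℝ ∞ (smoothAbs ε) :=
  ContDiff.sqrt (by fun_prop) fun w => by positivity

theorem hasDerivAt_smoothAbs (hε : 0 < ε) (w : ℝ) :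
    HasDerivAt (smoothAbs ε) (w / √(ε ^ 2 + w ^ 2)) w := by
  have h1 : HasDerivAt (fun w : ℝ => ε ^ 2 + w ^ 2) (2 * w) w := by
    simpa using (hasDerivAt_pow 2 w).const_add (ε ^ 2)
  convert! h1.sqrt (by positivity) using 1
  field_simp

theorem abs_le_smoothAbs (ε w : ℝ) : |w| ≤ smoothAbs ε w :=
  Real.abs_le_sqrt (le_add_of_nonneg_left (sq_nonneg ε))

theorem smoothAbs_le (hε : 0 < ε) (w : ℝ) : smoothAbs ε w ≤ |w| + ε := by
  refine Real.sqrt_le_iff.2 ⟨by positivity, ?_⟩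
  nlinarith [sq_abs w, abs_nonneg w]

theorem abs_deriv_smoothAbs_le (hε : 0 < ε) (w : ℝ) : |deriv (smoothAbs ε) w| ≤ 1 := by
  rw [(hasDerivAt_smoothAbs hε w).deriv, abs_div, abs_of_nonneg (Real.sqrt_nonneg _)]
  exact div_le_one_of_le₀ (abs_le_smoothAbs ε w) (Real.sqrt_nonneg _)

theorem integrable_smoothAbs_comp [IsFiniteMeasure μ] (hε : 0 < ε) {w : X → ℝ}
    (hw : Integrable w μ) : Integrable (fun x => smoothAbs ε (w x)) μ := by
  refine (hw.abs.add (integrable_const ε)).mono'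
    ((contDiff_smoothAbs hε).continuous.comp_aestronglyMeasurable hw.1) (ae_of_all _ fun x => ?_)
  rw [Real.norm_of_nonneg ((abs_nonneg _).trans (abs_le_smoothAbs ε _))]
  exact smoothAbs_le hε _

theorem measurable_setIntegral_Ioc {g : Y → ℝ → ℝ} (hg : Measurable fun z : Y × ℝ => g z.1 z.2)
    {p q : Y → ℝ} (hp : Measurable p) (hq : Measurable q) :
    Measurable fun y => ∫ r in Ioc (p y) (q y), g y r := by
  have hind : (fun y => ∫ r in Ioc (p y) (q y), g y r) = fun y =>
      ∫ r, {z : Y × ℝ | p z.1 < z.2 ∧ z.2 ≤ q z.1}.indicator (fun z => g z.1 z.2) (y, r) := by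
    ext y
    rw [← integral_indicator measurableSet_Ioc]
    rfl
  have hset : MeasurableSet {z : Y × ℝ | p z.1 < z.2 ∧ z.2 ≤ q z.1} :=
    (measurableSet_lt (hp.comp measurable_fst) measurable_snd).inter
      (measurableSet_le measurable_snd (hq.comp measurable_fst))
  rw [hind]
  exact (hg.indicator hset).stronglyMeasurable.integral_prod_right'.measurable

/-- The function of time and space with time derivative `f` and initial value `w₀`. -/
def timePrimitive (w₀ : X → ℝ) (f : ℝ → X → ℝ) (t : ℝ) (x : X) : ℝ :=
  w₀ x + ∫ r in (0 : ℝ)..t, f r x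

theorem measurable_timePrimitive (hw₀ : Measurable w₀)
    (hf : Measurable fun p : ℝ × X => f p.1 p.2) :
    Measurable fun p : ℝ × X => timePrimitive w₀ f p.1 p.2 := by
  have hg : Measurable fun z : (ℝ × X) × ℝ => f z.2 z.1.2 :=
    hf.comp (measurable_snd.prodMk (measurable_snd.comp measurable_fst))
  exact (hw₀.comp measurable_snd).add
    ((measurable_setIntegral_Ioc hg measurable_const measurable_fst).sub
      (measurable_setIntegral_Ioc hg measurable_fst measurable_const))

variable [IsFiniteMeasure μ]

theorem integrable_timePrimitive (hw₀ : Integrable w₀ μ)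
    (hf : Integrable (fun p : ℝ × X => f p.1 p.2) ((volume.restrict (Ioc 0 b)).prod μ))
    (ht : 0 ≤ t) (htb : t ≤ b) : Integrable (timePrimitive w₀ f t) μ := by
  refine hw₀.add ?_
  simp only [intervalIntegral.integral_of_le ht]
  exact (hf.mono_measure (Measure.prod_mono
    (Measure.restrict_mono (Ioc_subset_Ioc_right htb) le_rfl) le_rfl)).integral_prod_right

theorem integral_comp_timePrimitive_sub_eq (hw₀ : Measurable w₀) (hw₀i : Integrable w₀ μ)
    (hf : Measurable fun p : ℝ × X => f p.1 p.2)
    (hfi : Integrable (fun p : ℝ × X => f p.1 p.2) ((volume.restrict (Ioc 0 b)).prod μ))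
    (ha : 0 ≤ a) (hab : a ≤ b) {B : ℝ → ℝ} (hB : Differentiable ℝ B)
    (hB1 : ∀ r, |deriv B r| ≤ 1)
    (hBi : ∀ w : X → ℝ, Integrable w μ → Integrable (fun x => B (w x)) μ) :
    (∫ x, B (timePrimitive w₀ f b x) ∂μ) - ∫ x, B (timePrimitive w₀ f a x) ∂μ =
      ∫ t in Ioc a b, ∫ x, deriv B (timePrimitive w₀ f t x) * f t x ∂μ := by
  have hpoint : ∀ᵐ x ∂μ, B (timePrimitive w₀ f b x) - B (timePrimitive w₀ f a x) =
      ∫ t in Ioc a b, deriv B (timePrimitive w₀ f t x) * f t x := by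
    filter_upwards [hfi.prod_left_ae] with x hx
    rw [← intervalIntegral.integral_of_le hab]
    exact comp_primitive_sub_eq_integral (ha.trans hab)
      ((intervalIntegrable_iff_integrableOn_Ioc_of_le (ha.trans hab)).2 hx) hB hB1 _ ha hab le_rfl
  have hdom : Integrable (fun p : ℝ × X => deriv B (timePrimitive w₀ f p.1 p.2) * f p.1 p.2)
      ((volume.restrict (Ioc a b)).prod μ) := by
    refine (hfi.mono_measure (Measure.prod_mono
      (Measure.restrict_mono (Ioc_subset_Ioc_left ha) le_rfl) le_rfl)).bdd_mul (c := 1) ?_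
      (ae_of_all _ fun p => hB1 _)
    exact ((measurable_deriv B).comp (measurable_timePrimitive hw₀ hf)).aestronglyMeasurable
  rw [← integral_sub (hBi _ (integrable_timePrimitive hw₀i hfi (ha.trans hab) le_rfl))
    (hBi _ (integrable_timePrimitive hw₀i hfi ha hab)), integral_congr_ae hpoint]
  exact (integral_integral_swap hdom).symm

theorem integral_abs_timePrimitive_le (hw₀ : Measurable w₀) (hw₀i : Integrable w₀ μ)
    (hf : Measurable fun p : ℝ × X => f p.1 p.2)
    (hfi : Integrable (fun p : ℝ × X => f p.1 p.2) ((volume.restrict (Ioc 0 b)).prod μ))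
    (ha : 0 ≤ a) (hab : a ≤ b) (hε : 0 < ε) :
    ∫ x, |timePrimitive w₀ f b x| ∂μ ≤ (∫ x, |timePrimitive w₀ f a x| ∂μ) + ε * μ.real univ +
      ‖∫ t in Ioc a b, ∫ x, deriv (smoothAbs ε) (timePrimitive w₀ f t x) * f t x ∂μ‖ := by
  have hwa : Integrable (timePrimitive w₀ f a) μ := integrable_timePrimitive hw₀i hfi ha hab
  have hwb : Integrable (timePrimitive w₀ f b) μ :=
    integrable_timePrimitive hw₀i hfi (ha.trans hab) le_rfl
  have hupper : ∫ x, smoothAbs ε (timePrimitive w₀ f a x) ∂μ ≤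
      (∫ x, |timePrimitive w₀ f a x| ∂μ) + ε * μ.real univ := by
    refine (integral_mono (integrable_smoothAbs_comp hε hwa) (hwa.abs.add (integrable_const ε))
      fun x => smoothAbs_le hε _).trans_eq ?_
    rw [integral_add' hwa.abs (integrable_const ε), integral_const, smul_eq_mul, mul_comm ε]
  have hlower : ∫ x, |timePrimitive w₀ f b x| ∂μ ≤ ∫ x, smoothAbs ε (timePrimitive w₀ f b x) ∂μ :=
    integral_mono hwb.abs (integrable_smoothAbs_comp hε hwb) fun x => abs_le_smoothAbs _ _
  have hdiff := integral_comp_timePrimitive_sub_eq hw₀ hw₀i hf hfi ha hab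
    ((contDiff_smoothAbs hε).differentiable (by simp)) (abs_deriv_smoothAbs_le hε)
    fun w hw => integrable_smoothAbs_comp hε hw
  rw [← hdiff]
  linarith [Real.le_norm_self ((∫ x, smoothAbs ε (timePrimitive w₀ f b x) ∂μ) -
    ∫ x, smoothAbs ε (timePrimitive w₀ f a x) ∂μ)]

theorem lintegral_enorm_timePrimitive_le (hw₀ : Measurable w₀) (hw₀i : Integrable w₀ μ)
    (hf : Measurable fun p : ℝ × X => f p.1 p.2)
    (hfi : Integrable (fun p : ℝ × X => f p.1 p.2) ((volume.restrict (Ioc 0 b)).prod μ))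
    (ha : 0 ≤ a) (hab : a ≤ b) {K : ℝ → ℝ≥0∞}
    (hK : ∀ B : ℝ → ℝ, ContDiff ℝ ∞ B → (∀ r, |deriv B r| ≤ 1) →
      ∀ᵐ t ∂volume.restrict (Ioc a b),
        ‖∫ x, deriv B (timePrimitive w₀ f t x) * f t x ∂μ‖ₑ ≤ K t) :
    ∫⁻ x, ‖timePrimitive w₀ f b x‖ₑ ∂μ ≤
      (∫⁻ x, ‖timePrimitive w₀ f a x‖ₑ ∂μ) + ∫⁻ t in Ioc a b, K t := by
  refine ENNReal.le_of_forall_pos_le_add fun δ hδ _ => ?_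
  set ε : ℝ := δ / (μ.real univ + 1)
  have hε : 0 < ε := by positivity
  have hεδ : ε * μ.real univ ≤ δ := by
    rw [div_mul_eq_mul_div, div_le_iff₀ (by positivity)]
    gcongr
    simp
  have hpairing : ‖∫ t in Ioc a b, ∫ x, deriv (smoothAbs ε) (timePrimitive w₀ f t x) * f t x ∂μ‖ₑ ≤
      ∫⁻ t in Ioc a b, K t :=
    (enorm_integral_le_lintegral_enorm _).trans (lintegral_mono_ae
      (hK _ (contDiff_smoothAbs hε) (abs_deriv_smoothAbs_le hε)))
  rw [← ofReal_integral_norm_eq_lintegral_enorm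
      (integrable_timePrimitive hw₀i hfi (ha.trans hab) le_rfl),
    ← ofReal_integral_norm_eq_lintegral_enorm (integrable_timePrimitive hw₀i hfi ha hab)]
  simp only [Real.norm_eq_abs]
  have hreal := (integral_abs_timePrimitive_le hw₀ hw₀i hf hfi ha hab hε).trans
    (add_le_add_left (add_le_add_right hεδ _) _)
  refine (ENNReal.ofReal_le_ofReal hreal).trans ?_
  rw [ENNReal.ofReal_add (by positivity) (norm_nonneg _), ENNReal.ofReal_add (by positivity)
    δ.coe_nonneg, ofReal_norm, ENNReal.ofReal_coe_nnreal, add_right_comm]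
  gcongr

end TimePrimitive

section Recursion

variable {d : ℕ} {L κ s R ρ a b t T : ℝ} {u : ℝ → Space d → Space d} {θ₀ : Space d → ℝ}
  {θ : ℝ → Space d → ℝ} {Dθ : ℝ → Space d → Space d} {k k₀ : Space d → ℂ}
  {S : Finset (Fin d → ℤ)} {c : (Fin d → ℤ) → ℂ} {D G : ℝ≥0∞}

theorem kernelFourier_const_mul (z : ℂ) (k : Space d → ℂ) (ξ : Space d) :
    kernelFourier (fun y => z * k y) ξ = z * kernelFourier k ξ := by
  simp only [kernelFourier, mul_assoc, integral_const_mul]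

theorem HasHeatFlowBound.const_mul (h : HasHeatFlowBound k₀ s R D) {z : ℂ} (hz : ‖z‖ = 1) :
    HasHeatFlowBound (fun y => z * k₀ y) s R D := by
  intro ρ hρ hρR
  obtain ⟨k, hk, hki, hkF, hkD⟩ := h ρ hρ hρR
  refine ⟨fun y => z * k y, hk.const_mul z, hki.const_mul z, fun ξ => ?_, ?_⟩
  · rw [kernelFourier_const_mul, kernelFourier_const_mul, hkF, mul_left_comm]
  · simpa only [enorm_mul, ← ofReal_norm z, hz, ENNReal.ofReal_one, one_mul] using hkD

theorem timePrimitive_reTrigPoly {f : (Fin d → ℤ) → ℝ → ℂ}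
    (hf : ∀ m, IntervalIntegrable (f m) volume 0 t) :
    timePrimitive (reTrigPoly L S c) (fun r => reTrigPoly L S fun m => f m r) t =
      reTrigPoly L S fun m => c m + ∫ r in (0 : ℝ)..t, f m r := by
  ext x
  have hmode (m : Fin d → ℤ) : IntervalIntegrable (fun r => f m r * planeWave L m x) volume 0 t :=
    (hf m).mul_const _
  have hre : ∫ r in (0 : ℝ)..t, reTrigPoly L S (fun m => f m r) x =
      (∫ r in (0 : ℝ)..t, trigPoly L S (fun m => f m r) x).re :=
    Complex.reCLM.intervalIntegral_comp_comm (by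
      simpa only [Finset.sum_fn, trigPoly] using IntervalIntegrable.sum S fun m _ => hmode m)
  rw [timePrimitive, hre, reTrigPoly, ← Complex.add_re]
  simp only [trigPoly, reTrigPoly, add_mul, Finset.sum_add_distrib,
    intervalIntegral.integral_finsetSum fun m _ => hmode m, intervalIntegral.integral_mul_const]

theorem reTrigPoly_neg (S : Finset (Fin d → ℤ)) (c : (Fin d → ℤ) → ℂ) (x : Space d) :
    reTrigPoly L S (fun m => -c m) x = -reTrigPoly L S c x := by
  simp only [reTrigPoly, trigPoly, neg_mul, Finset.sum_neg_distrib, Complex.neg_re]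

theorem measurable_reTrigPoly {f : (Fin d → ℤ) → ℝ → ℂ} (hf : ∀ m, Measurable (f m)) :
    Measurable fun p : ℝ × Space d => reTrigPoly L S (fun m => f m p.1) p.2 :=
  Complex.measurable_re.comp <| Finset.measurable_fun_sum _ fun m _ =>
    ((hf m).comp measurable_fst).mul ((continuous_planeWave m).measurable.comp measurable_snd)

theorem integrable_reTrigPoly_prod {f : (Fin d → ℤ) → ℝ → ℂ} (hf : ∀ m, Measurable (f m))
    {ν : Measure ℝ} (hfi : ∀ m, Integrable (f m) ν) :
    Integrable (fun p : ℝ × Space d => reTrigPoly L S (fun m => f m p.1) p.2)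
      (ν.prod (cellMeasure d L)) := by
  have hdom : Integrable (fun p : ℝ × Space d => (∑ m ∈ S, ‖f m p.1‖) * 1)
      (ν.prod (cellMeasure d L)) :=
    (integrable_finsetSum S fun m _ => (hfi m).norm).mul_prod (integrable_const (1 : ℝ))
  refine hdom.mono' (measurable_reTrigPoly hf).aestronglyMeasurable (ae_of_all _ fun p => ?_)
  rw [mul_one]
  exact norm_reTrigPoly_le S _ _

theorem integrable_reTrigPoly (S : Finset (Fin d → ℤ)) (c : (Fin d → ℤ) → ℂ) :
    Integrable (reTrigPoly L S c) (cellMeasure d L) :=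
  (integrable_trigPoly S c).re

/-- The multiplier of the backward heat flow from time `b`, with terminal value the multiplier of
`k₀`, divided by the factor which defines `heatCoeff`. -/
def terminalCoeff {d : ℕ} (L κ : ℝ) (k₀ : Space d → ℂ) (b : ℝ) (m : Fin d → ℤ) : ℂ :=
  (Real.exp (-(κ * ‖waveVector L m‖ ^ 2 * b)) : ℂ) * kernelFourier k₀ (waveVector L m)

theorem terminalCoeff_mul_heatCoeff (f : ℝ → Space d → ℝ) (m : Fin d → ℤ) :
    terminalCoeff L κ k₀ b m * heatCoeff L κ f m t =
      (Real.exp (-(κ * (b - t) * ‖waveVector L m‖ ^ 2)) : ℂ) *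
        kernelFourier k₀ (waveVector L m) * timeCoeff L f m t := by
  have hexp : Real.exp (-(κ * (b - t) * ‖waveVector L m‖ ^ 2)) =
      Real.exp (-(κ * ‖waveVector L m‖ ^ 2 * b)) * Real.exp (κ * ‖waveVector L m‖ ^ 2 * t) := by
    rw [← Real.exp_add]
    ring_nf
  rw [terminalCoeff, heatCoeff, hexp, Complex.ofReal_mul]
  ring

theorem reTrigPoly_terminalCoeff_mul_heatCoeff
    (hk : ∀ ξ, kernelFourier k ξ =
      ((Real.exp (-(κ * (b - t) * ‖ξ‖ ^ 2)) : ℝ) : ℂ) * kernelFourier k₀ ξ)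
    (f : ℝ → Space d → ℝ) :
    reTrigPoly L S (fun m => terminalCoeff L κ k₀ b m * heatCoeff L κ f m t) =
      reBandMultiplier L S k (f t) := by
  simp only [terminalCoeff_mul_heatCoeff, ← hk]
  rfl

theorem HasDuhamelModes.timePrimitive_eq (hu : IsVelocityField L u)
    (h : IsWeakSolution L κ u θ₀ θ Dθ) (ht : HasDuhamelModes L κ u θ Dθ c t) (h0 : 0 ≤ t)
    (α : (Fin d → ℤ) → ℂ) :
    timePrimitive (reTrigPoly L S fun m => α m * c m)
        (fun r => reTrigPoly L S fun m => -(α m * heatCoeff L κ (transportTerm u Dθ) m r)) t =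
      reTrigPoly L S fun m => α m * heatCoeff L κ θ m t := by
  have hf (m : Fin d → ℤ) : IntervalIntegrable
      (fun r => -(α m * heatCoeff L κ (transportTerm u Dθ) m r)) volume 0 t :=
    (((intervalIntegrable_iff_integrableOn_Ioc_of_le h0).2
      (h.integrableOn_heatCoeff_transportTerm hu m t)).const_mul (α m)).neg
  rw [timePrimitive_reTrigPoly hf]
  simp only [intervalIntegral.integral_neg, intervalIntegral.integral_const_mul, ht _,
    sub_eq_add_neg, mul_add, mul_neg]

theorem IsWeakSolution.enorm_integral_terminalCoeff_le (hL : 0 < L) (hκ : 0 < κ)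
    (hs : s ∈ Icc (0 : ℝ) 1) (hu : IsVelocityField L u) (h : IsWeakSolution L κ u θ₀ θ Dθ)
    (hS : ∀ m, m ∉ S → kernelFourier k₀ (waveVector L m) = 0)
    (hheat : HasHeatFlowBound k₀ s R D) (hr : RegularTime L (u t) (θ t) (Dθ t))
    (htb : t < b) (hR : κ * (b - t) ≤ R) {B : ℝ → ℝ} (hB : ContDiff ℝ ∞ B)
    (hB1 : ∀ r, |deriv B r| ≤ 1) :
    ‖∫ x, deriv B (reTrigPoly L S (fun m => terminalCoeff L κ k₀ b m * heatCoeff L κ θ m t) x) *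
        reTrigPoly L S (fun m => terminalCoeff L κ k₀ b m *
          heatCoeff L κ (transportTerm u Dθ) m t) x ∂cellMeasure d L‖ₑ ≤
      D * fracGradSq L s (u t) ^ (1 / 2 : ℝ) *
        (∫⁻ x, ‖Dθ t x‖ₑ ^ 2 ∂cellMeasure d L) ^ (1 / 2 : ℝ) := by
  obtain ⟨k, hk, hki, hkF, hkD⟩ := hheat (κ * (b - t)) (mul_pos hκ (sub_pos.2 htb)) hR
  rw [reTrigPoly_terminalCoeff_mul_heatCoeff hkF, reTrigPoly_terminalCoeff_mul_heatCoeff hkF]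
  refine (enorm_integral_transport_le hL hs
    (hu.measurable.comp measurable_prodMk_left) (hu.periodic t) hr.velocity_sq hr.divFree
    (h.grad_measurable.comp measurable_prodMk_left) (h.grad_periodic t) hr.grad_sq
    (hr.integrable_scalar (h.measurable.comp measurable_prodMk_left)) hr.weakGradient hk hki
    (fun m hm => by rw [hkF, hS m hm, mul_zero]) hB hB1).trans
    (mul_le_mul' (mul_le_mul' hkD le_rfl) le_rfl)

theorem IsWeakSolution.lintegral_enorm_reBandMultiplier_le (hL : 0 < L) (hκ : 0 < κ)
    (hs : s ∈ Icc (0 : ℝ) 1) (hu : IsVelocityField L u) (h : IsWeakSolution L κ u θ₀ θ Dθ)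
    (hG : ∀ᵐ t ∂volume.restrict (Ioi (0 : ℝ)), fracGradSq L s (u t) ^ (1 / 2 : ℝ) ≤ G)
    (hS : ∀ m, m ∉ S → kernelFourier k₀ (waveVector L m) = 0)
    (hheat : HasHeatFlowBound k₀ s R D)
    (hc : ∀ᵐ t ∂volume.restrict (Ioi (0 : ℝ)), HasDuhamelModes L κ u θ Dθ c t)
    (ha : 0 ≤ a) (hab : a ≤ b) (hR : κ * (b - a) ≤ R)
    (hca : HasDuhamelModes L κ u θ Dθ c a) (hcb : HasDuhamelModes L κ u θ Dθ c b) :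
    ∫⁻ x, ‖reBandMultiplier L S k₀ (θ b) x‖ₑ ∂cellMeasure d L ≤
      (∫⁻ x, ‖reTrigPoly L S (fun m => terminalCoeff L κ k₀ b m * heatCoeff L κ θ m a) x‖ₑ
        ∂cellMeasure d L) +
      ∫⁻ r in Ioc a b, D * G * (∫⁻ x, ‖Dθ r x‖ₑ ^ 2 ∂cellMeasure d L) ^ (1 / 2 : ℝ) := by
  set α := terminalCoeff L κ k₀ b
  have hFm (m : Fin d → ℤ) :
      Measurable fun r => -(α m * heatCoeff L κ (transportTerm u Dθ) m r) :=
    ((measurable_heatCoeff (h.measurable_transportTerm hu) m).const_mul _).neg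
  have hend : reTrigPoly L S (fun m => α m * heatCoeff L κ θ m b) =
      reBandMultiplier L S k₀ (θ b) := reTrigPoly_terminalCoeff_mul_heatCoeff (by simp) θ
  have hsub : Ioc a b ⊆ Ioi 0 := fun r hr => ha.trans_lt hr.1
  rw [← hend, ← hca.timePrimitive_eq hu h ha, ← hcb.timePrimitive_eq hu h (ha.trans hab)]
  refine lintegral_enorm_timePrimitive_le (contDiff_reTrigPoly S _).continuous.measurable
    (integrable_reTrigPoly S _) (measurable_reTrigPoly hFm) (integrable_reTrigPoly_prod hFm
      fun m => ((h.integrableOn_heatCoeff_transportTerm hu m b).const_mul _).neg) ha hab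
    fun B hB hB1 => ?_
  have hne : ∀ᵐ t ∂volume.restrict (Ioc a b), t ≠ b :=
    ae_restrict_of_ae (by simp [ae_iff, measure_singleton])
  filter_upwards [hne, ae_restrict_mem measurableSet_Ioc,
    ae_restrict_of_ae_restrict_of_subset hsub hc, ae_restrict_of_ae_restrict_of_subset hsub hG,
    ae_restrict_of_ae_restrict_of_subset hsub (h.ae_regularTime hu)] with t htb htm ht htG htr
  have hbound := h.enorm_integral_terminalCoeff_le hL hκ hs hu hS hheat htr
    (lt_of_le_of_ne htm.2 htb) ((by gcongr; exact htm.1.le : κ * (b - t) ≤ κ * (b - a)).trans hR)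
    hB hB1
  rw [ht.timePrimitive_eq hu h (ha.trans htm.1.le)]
  simp only [reTrigPoly_neg, mul_neg, integral_neg, enorm_neg]
  exact hbound.trans (by gcongr)

theorem lintegral_enorm_reTrigPoly_terminalCoeff_le (hL : 0 < L) {A : Space d → ℂ}
    (hA : Measurable A) (hAi : Integrable A)
    (hAF : ∀ ξ, kernelFourier A ξ * kernelFourier k₀ ξ =
      ((Real.exp (-(κ * (b - a) * ‖ξ‖ ^ 2)) : ℝ) : ℂ) * kernelFourier k₀ ξ)
    (f : ℝ → Space d → ℝ) :
    ∫⁻ x, ‖reTrigPoly L S (fun m => terminalCoeff L κ k₀ b m * heatCoeff L κ f m a) x‖ₑ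
        ∂cellMeasure d L ≤
      (∫⁻ y, ‖A y‖ₑ) *
        ∫⁻ x, ‖bandMultiplier L S k₀ (fun x => (f a x : ℂ)) x‖ₑ ∂cellMeasure d L := by
  refine (lintegral_mono fun x => ?_).trans (lintegral_enorm_conv_le hL hA
    (continuous_trigPoly S _).measurable (isPeriodic_trigPoly hL S _))
  rw [bandMultiplier, conv_trigPoly hAi]
  simp only [terminalCoeff_mul_heatCoeff, ← hAF]
  simp only [mul_assoc]
  exact enorm_le_iff_norm_le.2 (Complex.abs_re_le_norm _)

theorem bandMultiplier_const_mul (z : ℂ) (k f : Space d → ℂ) (x : Space d) :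
    bandMultiplier L S (fun y => z * k y) f x = z * bandMultiplier L S k f x := by
  simp only [bandMultiplier, trigPoly, kernelFourier_const_mul, Finset.mul_sum, mul_assoc]

theorem enorm_bandMultiplier_le (k : Space d → ℂ) (f : Space d → ℝ) (x : Space d) :
    ‖bandMultiplier L S k (fun x => (f x : ℂ)) x‖ₑ ≤ ‖reBandMultiplier L S k f x‖ₑ +
      ‖reBandMultiplier L S (fun y => -Complex.I * k y) f x‖ₑ := by
  set w := bandMultiplier L S k (fun x => (f x : ℂ)) x
  have him : reBandMultiplier L S (fun y => -Complex.I * k y) f x = w.im := by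
    refine (congrArg Complex.re (bandMultiplier_const_mul _ k _ x)).trans ?_
    simp [w]
  rw [him, show reBandMultiplier L S k f x = w.re from rfl, ← ofReal_norm, ← ofReal_norm,
    ← ofReal_norm, ← ENNReal.ofReal_add (norm_nonneg _) (norm_nonneg _)]
  exact ENNReal.ofReal_le_ofReal (Complex.norm_le_abs_re_add_abs_im w)

theorem IsWeakSolution.lintegral_enorm_bandMultiplier_le (hL : 0 < L) (hκ : 0 < κ)
    (hs : s ∈ Icc (0 : ℝ) 1) (hu : IsVelocityField L u) (h : IsWeakSolution L κ u θ₀ θ Dθ)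
    (hG : ∀ᵐ t ∂volume.restrict (Ioi (0 : ℝ)), fracGradSq L s (u t) ^ (1 / 2 : ℝ) ≤ G)
    (hS : ∀ m, m ∉ S → kernelFourier k₀ (waveVector L m) = 0)
    (hheat : HasHeatFlowBound k₀ s (κ * (b - a)) D) {A : Space d → ℂ} (hA : Measurable A)
    (hAi : Integrable A)
    (hAF : ∀ ξ, kernelFourier A ξ * kernelFourier k₀ ξ =
      ((Real.exp (-(κ * (b - a) * ‖ξ‖ ^ 2)) : ℝ) : ℂ) * kernelFourier k₀ ξ)
    (hc : ∀ᵐ t ∂volume.restrict (Ioi (0 : ℝ)), HasDuhamelModes L κ u θ Dθ c t)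
    (ha : 0 ≤ a) (hab : a ≤ b) (hca : HasDuhamelModes L κ u θ Dθ c a)
    (hcb : HasDuhamelModes L κ u θ Dθ c b) :
    ∫⁻ x, ‖bandMultiplier L S k₀ (fun x => (θ b x : ℂ)) x‖ₑ ∂cellMeasure d L ≤
      2 * ((∫⁻ y, ‖A y‖ₑ) *
        ∫⁻ x, ‖bandMultiplier L S k₀ (fun x => (θ a x : ℂ)) x‖ₑ ∂cellMeasure d L) +
      2 * ∫⁻ r in Ioc a b, D * G * (∫⁻ x, ‖Dθ r x‖ₑ ^ 2 ∂cellMeasure d L) ^ (1 / 2 : ℝ) := by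
  set q := (∫⁻ y, ‖A y‖ₑ) *
    ∫⁻ x, ‖bandMultiplier L S k₀ (fun x => (θ a x : ℂ)) x‖ₑ ∂cellMeasure d L with hq
  have hI : ‖Complex.I‖ₑ = 1 := by rw [← ofReal_norm, Complex.norm_I, ENNReal.ofReal_one]
  set E := ∫⁻ r in Ioc a b, D * G * (∫⁻ x, ‖Dθ r x‖ₑ ^ 2 ∂cellMeasure d L) ^ (1 / 2 : ℝ)
  have hre : ∫⁻ x, ‖reBandMultiplier L S k₀ (θ b) x‖ₑ ∂cellMeasure d L ≤ q + E := by
    refine (h.lintegral_enorm_reBandMultiplier_le hL hκ hs hu hG hS hheat hc ha hab le_rfl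
      hca hcb).trans ?_
    gcongr
    exact lintegral_enorm_reTrigPoly_terminalCoeff_le hL hA hAi hAF θ
  have him : ∫⁻ x, ‖reBandMultiplier L S (fun y => -Complex.I * k₀ y) (θ b) x‖ₑ
      ∂cellMeasure d L ≤ q + E := by
    refine (h.lintegral_enorm_reBandMultiplier_le hL hκ hs hu hG
      (fun m hm => by rw [kernelFourier_const_mul, hS m hm, mul_zero])
      (hheat.const_mul (by simp)) hc ha hab le_rfl hca hcb).trans ?_
    gcongr
    refine (lintegral_enorm_reTrigPoly_terminalCoeff_le hL hA hAi
      (fun ξ => by rw [kernelFourier_const_mul, mul_left_comm, hAF, mul_left_comm]) θ).trans_eq ?_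
    simp only [hq, bandMultiplier_const_mul, enorm_mul, enorm_neg, hI, one_mul]
  have hmeas : Measurable (reBandMultiplier L S k₀ (θ b)) :=
    (contDiff_reTrigPoly S _).continuous.measurable
  calc ∫⁻ x, ‖bandMultiplier L S k₀ (fun x => (θ b x : ℂ)) x‖ₑ ∂cellMeasure d L
      ≤ ∫⁻ x, (‖reBandMultiplier L S k₀ (θ b) x‖ₑ +
          ‖reBandMultiplier L S (fun y => -Complex.I * k₀ y) (θ b) x‖ₑ) ∂cellMeasure d L :=
        lintegral_mono fun x => enorm_bandMultiplier_le _ _ x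
    _ ≤ (q + E) + (q + E) := by
        rw [lintegral_add_left hmeas.enorm]
        exact add_le_add hre him
    _ = 2 * q + 2 * E := by ring

variable {Φ : ℤ → 𝓢(Space d, ℂ)} {v g : Space d → Space d} {f : Space d → ℝ} {l : ℤ}
  {δ : ℝ≥0∞}

theorem RegularTime.lintegral_enorm_lpProj_eq (hL : 0 < L) (h : RegularTime L v f g)
    (hf : Measurable f) (hfp : IsPeriodic L f)
    (hS : ∀ m, m ∉ S → kernelFourier (Φ l) (waveVector L m) = 0) :
    ∫⁻ x, ‖lpProj Φ l f x‖ₑ ∂cellMeasure d L =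
      ∫⁻ x, ‖bandMultiplier L S (Φ l) (fun x => (f x : ℂ)) x‖ₑ ∂cellMeasure d L :=
  lintegral_congr_ae <| (conv_ae_eq_bandMultiplier hL (measurable_schwartz (Φ l)) (Φ l).integrable
    (Complex.measurable_ofReal.comp hf) (hfp.postcomp _) (h.integrable_scalar hf) hS).fun_comp _

theorem IsWeakSolution.ae_lintegral_lpProj_add_le (hL : 0 < L) (hκ : 0 < κ)
    (hs : s ∈ Icc (0 : ℝ) 1) (hu : IsVelocityField L u) (h : IsWeakSolution L κ u θ₀ θ Dθ)
    (hG : ∀ᵐ t ∂volume.restrict (Ioi (0 : ℝ)), fracGradSq L s (u t) ^ (1 / 2 : ℝ) ≤ G)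
    (hΦ : IsLittlewoodPaleyFamily Φ) (hT : 0 ≤ T) (hheat : HasHeatFlowBound (Φ l) s (κ * T) D)
    (hδ : HasHeatContraction (Φ l) (κ * T) δ) :
    ∀ᵐ a ∂volume.restrict (Ioi (0 : ℝ)),
      ∫⁻ x, ‖lpProj Φ l (θ (a + T)) x‖ₑ ∂cellMeasure d L ≤
        2 * (δ * ∫⁻ x, ‖lpProj Φ l (θ a) x‖ₑ ∂cellMeasure d L) +
        2 * ∫⁻ r in Ioc a (a + T), D * G *
          (∫⁻ x, ‖Dθ r x‖ₑ ^ 2 ∂cellMeasure d L) ^ (1 / 2 : ℝ) := by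
  obtain ⟨A, hA, hAi, hAδ, hAF⟩ := hδ
  obtain ⟨S, hS⟩ := hΦ.exists_finset hL l
  obtain ⟨c, hc⟩ := h.exists_ae_hasDuhamelModes hL hu
  filter_upwards [ae_restrict_mem measurableSet_Ioi, hc, ae_Ioi_comp_add hc hT,
    h.ae_regularTime hu, ae_Ioi_comp_add (h.ae_regularTime hu) hT] with a ha hca hcb hra hrb
  have hθm (t : ℝ) : Measurable (θ t) := h.measurable.comp measurable_prodMk_left
  have hTa : a + T - a = T := add_sub_cancel_left a T
  rw [hra.lintegral_enorm_lpProj_eq hL (hθm a) (h.periodic a) hS,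
    hrb.lintegral_enorm_lpProj_eq hL (hθm _) (h.periodic _) hS]
  refine (h.lintegral_enorm_bandMultiplier_le hL hκ hs hu hG hS (hTa.symm ▸ hheat) hA hAi
    (hTa.symm ▸ hAF) hc ha.le (le_add_of_nonneg_right hT) hca hcb).trans ?_
  gcongr

theorem RegularTime.lintegral_lpProj_le (hL : 0 < L) (hΦ : IsLittlewoodPaleyFamily Φ)
    (h : RegularTime L v f g) (hf : Measurable f) (hfp : IsPeriodic L f) (hg : Measurable g)
    (hgp : IsPeriodic L g) (l : ℤ) :
    ∫⁻ x, ‖lpProj Φ l f x‖ₑ ∂cellMeasure d L ≤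
      2 * weightedNorm (Φ 0) * ENNReal.ofReal (((2 : ℝ) ^ l) ^ (-1 : ℝ)) *
        (∫⁻ x, ‖g x‖ₑ ^ 2 ∂cellMeasure d L) ^ (1 / 2 : ℝ) := by
  have hl : (0 : ℝ) < 2 ^ l := by positivity
  obtain ⟨S, hS⟩ := hΦ.exists_finset hL l
  set ψ := dilate ((2 : ℝ) ^ l) (Φ 0)
  have hψ : Measurable ψ := measurable_dilate _ (measurable_schwartz (Φ 0))
  have hψi : Integrable ψ := integrable_dilate hl (measurable_schwartz (Φ 0)) (Φ 0).integrable
  have hband : bandMultiplier L S (Φ l) (fun x => (f x : ℂ)) =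
      bandMultiplier L S ψ fun x => (f x : ℂ) := by
    simp only [bandMultiplier, hΦ.kernelFourier_eq l, ψ]
  have hconv : conv ψ (fun x => (f x : ℂ)) =ᵐ[cellMeasure d L]
      bandMultiplier L S ψ fun x => (f x : ℂ) :=
    conv_ae_eq_bandMultiplier hL hψ hψi (Complex.measurable_ofReal.comp hf) (hfp.postcomp _)
      (h.integrable_scalar hf) fun m hm => by rw [← hΦ.kernelFourier_eq, hS m hm]
  have hnorm : ∫⁻ x, ‖bandMultiplier L S ψ (fun x => (f x : ℂ)) x‖ₑ ∂cellMeasure d L =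
      ∫⁻ x, ‖conv ψ (fun x => (f x : ℂ)) x‖ₑ ∂cellMeasure d L :=
    lintegral_congr_ae (hconv.symm.fun_comp fun z => ‖z‖ₑ)
  have hmoment := lintegral_dilate_rpow_le hl (s := 1) (by simp) (measurable_schwartz (Φ 0))
  simp only [Real.rpow_one] at hmoment
  rw [h.lintegral_enorm_lpProj_eq hL hf hfp hS, hband, hnorm]
  exact (lintegral_enorm_conv_le_gradient hL h.weakGradient hf hfp h.scalar_sq hg hgp h.grad_sq hψ
    hψi (hΦ.integral_dilate_eq_zero l)).trans (mul_le_mul_left hmoment _)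

end Recursion

section LongTime

open scoped Topology

variable {φ : ℝ → ℝ} {q Y Z : ℝ → ℝ≥0∞} {δ E K c : ℝ≥0∞} {a τ T : ℝ}

theorem limsup_add_le_of_tendsto_zero {u v : ℝ → ℝ≥0∞} (hu : Tendsto u atTop (𝓝 0)) :
    limsup (fun T => u T + v T) atTop ≤ limsup v atTop := by
  refine ENNReal.le_of_forall_pos_le_add fun ε hε hv => ?_
  have hε2 : (0 : ℝ≥0∞) < ((ε / 2 : ℝ≥0) : ℝ≥0∞) := by
    rw [ENNReal.coe_pos]
    positivity
  refine limsup_le_of_le (h := ?_)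
  filter_upwards [hu.eventually_lt_const hε2,
    eventually_lt_of_limsup_lt (ENNReal.lt_add_right hv.ne hε2.ne')] with T huT hvT
  calc u T + v T ≤ ((ε / 2 : ℝ≥0) : ℝ≥0∞) + (limsup v atTop + ((ε / 2 : ℝ≥0) : ℝ≥0∞)) :=
        add_le_add huT.le hvT.le
    _ = limsup v atTop + (((ε / 2 : ℝ≥0) : ℝ≥0∞) + ((ε / 2 : ℝ≥0) : ℝ≥0∞)) := by ring
    _ = limsup v atTop + ε := by rw [← ENNReal.coe_add, add_halves]

theorem tendsto_ofReal_inv_mul_const (hc : c ≠ ⊤) :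
    Tendsto (fun T : ℝ => ENNReal.ofReal T⁻¹ * c) atTop (𝓝 0) := by
  have hinv : Tendsto (fun T : ℝ => ENNReal.ofReal T⁻¹) atTop (𝓝 0) := by
    simpa [Function.comp_def] using
      (ENNReal.continuous_ofReal.tendsto 0).comp (tendsto_inv_atTop_zero (𝕜 := ℝ))
  simpa using ENNReal.Tendsto.mul_const hinv (Or.inr hc)

theorem setLIntegral_Ioc_comp_add (f : ℝ → ℝ≥0∞) (a b c : ℝ) :
    ∫⁻ t in Ioc a b, f (t + c) = ∫⁻ t in Ioc (a + c) (b + c), f t := by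
  have h := (measurePreserving_add_right volume c).setLIntegral_comp_preimage_emb
    (measurableEmbedding_addRight c) f (Ioc (a + c) (b + c))
  simpa using h

theorem setLIntegral_window_eq (Z : ℝ → ℝ≥0∞) (a τ : ℝ) :
    ∫⁻ r in Ioc a (a + τ), Z r = ∫⁻ r in Ioc 0 τ, Z (a + r) := by
  simp only [add_comm a, setLIntegral_Ioc_comp_add, zero_add]

theorem measurable_setLIntegral_window (hZ : Measurable Z) (τ : ℝ) :
    Measurable fun a => ∫⁻ r in Ioc a (a + τ), Z r := by
  simp only [setLIntegral_window_eq]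
  exact Measurable.lintegral_prod_right' (f := fun p : ℝ × ℝ => Z (p.1 + p.2))
    (hZ.comp measurable_add)

theorem setLIntegral_window_le (hZ : Measurable Z) (τ T : ℝ) :
    ∫⁻ a in Ioc 0 (T - τ), ∫⁻ r in Ioc a (a + τ), Z r ≤
      ENNReal.ofReal τ * ∫⁻ r in Ioc 0 T, Z r := by
  simp only [setLIntegral_window_eq]
  rw [lintegral_lintegral_swap (f := fun a r => Z (a + r)) (hZ.comp measurable_add).aemeasurable]
  calc ∫⁻ r in Ioc 0 τ, ∫⁻ a in Ioc 0 (T - τ), Z (a + r)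
      ≤ ∫⁻ _ in Ioc 0 τ, ∫⁻ t in Ioc 0 T, Z t := by
        refine setLIntegral_mono' measurableSet_Ioc fun r hr => ?_
        rw [setLIntegral_Ioc_comp_add]
        exact lintegral_mono_set
          (Ioc_subset_Ioc (by linarith [hr.1]) (by linarith [hr.2]))
    _ = ENNReal.ofReal τ * ∫⁻ r in Ioc 0 T, Z r := by
        rw [setLIntegral_const, Real.volume_Ioc, sub_zero, mul_comm]

theorem le_two_mul_of_le_half_add {x y : ℝ≥0∞} (hx : x ≠ ⊤) (h : x ≤ 2⁻¹ * x + y) :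
    x ≤ 2 * y := by
  have hhalf : 2⁻¹ * x + 2⁻¹ * x = x := by rw [← add_mul, ENNReal.inv_two_add_inv_two, one_mul]
  have hy : 2⁻¹ * x ≤ y :=
    (ENNReal.add_le_add_iff_left (ENNReal.mul_ne_top (by simp) hx)).1 (hhalf.trans_le h)
  calc x = 2⁻¹ * x + 2⁻¹ * x := hhalf.symm
    _ ≤ y + y := add_le_add hy hy
    _ = 2 * y := (two_mul y).symm

theorem setLIntegral_le_of_recursion {Q : ℝ → ℝ≥0∞} (hZ : Measurable Z) (hτ : 0 ≤ τ)
    (hrec : ∀ᵐ a ∂volume.restrict (Ioi (0 : ℝ)),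
      Q (a + τ) ≤ 2⁻¹ * Q a + ∫⁻ r in Ioc a (a + τ), Z r)
    (hQ : ∫⁻ t in Ioc 0 T, Q t ≠ ⊤) :
    ∫⁻ t in Ioc 0 T, Q t ≤
      2 * ((∫⁻ t in Ioc 0 τ, Q t) + ENNReal.ofReal τ * ∫⁻ t in Ioc 0 T, Z t) := by
  have hshift : ∫⁻ t in Ioc τ T, Q t = ∫⁻ a in Ioc 0 (T - τ), Q (a + τ) := by
    rw [setLIntegral_Ioc_comp_add, zero_add, sub_add_cancel]
  have hbound : ∫⁻ a in Ioc 0 (T - τ), Q (a + τ) ≤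
      2⁻¹ * (∫⁻ t in Ioc 0 T, Q t) + ENNReal.ofReal τ * ∫⁻ t in Ioc 0 T, Z t :=
    calc ∫⁻ a in Ioc 0 (T - τ), Q (a + τ)
        ≤ ∫⁻ a in Ioc 0 (T - τ), (2⁻¹ * Q a + ∫⁻ r in Ioc a (a + τ), Z r) :=
          lintegral_mono_ae (ae_restrict_of_ae_restrict_of_subset Ioc_subset_Ioi_self hrec)
      _ = 2⁻¹ * (∫⁻ a in Ioc 0 (T - τ), Q a) +
            ∫⁻ a in Ioc 0 (T - τ), ∫⁻ r in Ioc a (a + τ), Z r := by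
          rw [lintegral_add_right _ (measurable_setLIntegral_window hZ τ),
            lintegral_const_mul' _ _ (by simp)]
      _ ≤ 2⁻¹ * (∫⁻ t in Ioc 0 T, Q t) + ENNReal.ofReal τ * ∫⁻ t in Ioc 0 T, Z t := by
          gcongr
          · linarith
          · exact setLIntegral_window_le hZ τ T
  refine le_two_mul_of_le_half_add hQ ?_
  calc ∫⁻ t in Ioc 0 T, Q t
      ≤ (∫⁻ t in Ioc 0 τ, Q t) + ∫⁻ t in Ioc τ T, Q t :=
        (lintegral_mono_set Ioc_subset_Ioc_union_Ioc).trans (lintegral_union_le _ _ _)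
    _ ≤ (∫⁻ t in Ioc 0 τ, Q t) +
          (2⁻¹ * (∫⁻ t in Ioc 0 T, Q t) + ENNReal.ofReal τ * ∫⁻ t in Ioc 0 T, Z t) := by
        rw [hshift]
        gcongr
    _ = 2⁻¹ * (∫⁻ t in Ioc 0 T, Q t) +
          ((∫⁻ t in Ioc 0 τ, Q t) + ENNReal.ofReal τ * ∫⁻ t in Ioc 0 T, Z t) := by ring

/-- The weight of `longTimeAvg`, made constant on negative times: a time weight exponent is
arbitrary there. -/
def expWeight (φ : ℝ → ℝ) (t : ℝ) : ℝ≥0∞ := ENNReal.ofReal (Real.exp (φ (max t 0)))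

theorem longTimeAvg_eq_limsup_expWeight (φ : ℝ → ℝ) (f : ℝ → ℝ≥0∞) :
    longTimeAvg φ f = limsup (fun T : ℝ => ENNReal.ofReal T⁻¹ *
      ∫⁻ t in Ioc 0 T, f t * expWeight φ t) atTop := by
  have hw (T : ℝ) : ∫⁻ t in Ioc 0 T, f t * ENNReal.ofReal (Real.exp (φ t)) =
      ∫⁻ t in Ioc 0 T, f t * expWeight φ t :=
    setLIntegral_congr_fun measurableSet_Ioc fun t ht => by
      simp only [expWeight, max_eq_left ht.1.le]
  simp only [longTimeAvg, hw]

theorem expWeight_ne_top (φ : ℝ → ℝ) (t : ℝ) : expWeight φ t ≠ ⊤ := ENNReal.ofReal_ne_top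

theorem IsTimeWeight.monotone_expWeight (hφ : IsTimeWeight φ) : Monotone (expWeight φ) :=
  fun _ _ h => ENNReal.ofReal_le_ofReal <| Real.exp_le_exp.2 <|
    hφ.monotone (mem_Ici.2 (le_max_right _ _)) (mem_Ici.2 (le_max_right _ _)) (max_le_max_right _ h)

theorem IsTimeWeight.expWeight_add_le (hφ : IsTimeWeight φ) (hτ : 0 ≤ τ)
    (h : eLpNorm (deriv φ) ⊤ (volume.restrict (Ioi (0 : ℝ))) * ENNReal.ofReal τ ≤ 1)
    (ha : 0 ≤ a) : expWeight φ (a + τ) ≤ ENNReal.ofReal (Real.exp 1) * expWeight φ a := by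
  have haτ : a ≤ a + τ := le_add_of_nonneg_right hτ
  have hac : AbsolutelyContinuousOnInterval φ a (a + τ) := by
    refine (hφ.absCont (a + τ + 1) (by positivity)).mono ?_
    rw [uIcc_of_le haτ, uIcc_of_le (by positivity)]
    exact Icc_subset_Icc ha (by linarith)
  have hderiv : ∀ᵐ t ∂volume.restrict (Ioc a (a + τ)),
      ‖deriv φ t‖ₑ ≤ eLpNorm (deriv φ) ⊤ (volume.restrict (Ioi (0 : ℝ))) := by
    rw [eLpNorm_exponent_top]
    exact ae_restrict_of_ae_restrict_of_subset (fun r hr => ha.trans_lt hr.1) ae_le_eLpNormEssSup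
  have hincr : ‖φ (a + τ) - φ a‖ₑ ≤ 1 := by
    rw [← hac.integral_deriv_eq_sub, intervalIntegral.integral_of_le haτ]
    refine (enorm_integral_le_lintegral_enorm _).trans ((lintegral_mono_ae hderiv).trans ?_)
    rwa [setLIntegral_const, Real.volume_Ioc, add_sub_cancel_left]
  have hle : φ (a + τ) - φ a ≤ 1 := by
    rw [← ofReal_norm, ENNReal.ofReal_le_one] at hincr
    exact (Real.le_norm_self _).trans hincr
  rw [expWeight, expWeight, max_eq_left ha, max_eq_left (ha.trans haτ),
    ← ENNReal.ofReal_mul (Real.exp_pos _).le, ← Real.exp_add]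
  gcongr
  linarith

theorem IsTimeWeight.setLIntegral_mul_expWeight_ne_top (hφ : IsTimeWeight φ)
    (hY : ∫⁻ t in Ioc 0 T, Y t ≠ ⊤) : ∫⁻ t in Ioc 0 T, Y t * expWeight φ t ≠ ⊤ := by
  refine ne_top_of_le_ne_top (ENNReal.mul_ne_top hY (expWeight_ne_top φ T)) ?_
  rw [← lintegral_mul_const' _ _ (expWeight_ne_top φ T)]
  refine setLIntegral_mono' measurableSet_Ioc fun t ht => ?_
  gcongr
  exact hφ.monotone_expWeight ht.2

theorem longTimeAvg_le_of_setLIntegral_le (hc : c ≠ ⊤) (hK : K ≠ ⊤)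
    (h : ∀ T, ∫⁻ t in Ioc 0 T, q t * expWeight φ t ≤
      c + K * ∫⁻ t in Ioc 0 T, Y t * expWeight φ t) :
    longTimeAvg φ q ≤ K * longTimeAvg φ Y := by
  simp only [longTimeAvg_eq_limsup_expWeight]
  rw [← ENNReal.limsup_const_mul_of_ne_top hK]
  refine (limsup_le_limsup (Eventually.of_forall fun T => ?_)).trans
    (limsup_add_le_of_tendsto_zero (tendsto_ofReal_inv_mul_const hc))
  calc ENNReal.ofReal T⁻¹ * ∫⁻ t in Ioc 0 T, q t * expWeight φ t
      ≤ ENNReal.ofReal T⁻¹ * (c + K * ∫⁻ t in Ioc 0 T, Y t * expWeight φ t) := by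
        gcongr
        exact h T
    _ = ENNReal.ofReal T⁻¹ * c +
          K * (ENNReal.ofReal T⁻¹ * ∫⁻ t in Ioc 0 T, Y t * expWeight φ t) := by ring

theorem setLIntegral_mul_expWeight_le (hK : K ≠ ⊤)
    (h : ∀ᵐ t ∂volume.restrict (Ioi (0 : ℝ)), q t ≤ K * Y t) (T : ℝ) :
    ∫⁻ t in Ioc 0 T, q t * expWeight φ t ≤ K * ∫⁻ t in Ioc 0 T, Y t * expWeight φ t := by
  rw [← lintegral_const_mul' _ _ hK]
  refine lintegral_mono_ae ?_
  filter_upwards [ae_restrict_of_ae_restrict_of_subset Ioc_subset_Ioi_self h] with t ht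
  rw [← mul_assoc]
  gcongr

theorem longTimeAvg_le_const_mul (hK : K ≠ ⊤)
    (h : ∀ᵐ t ∂volume.restrict (Ioi (0 : ℝ)), q t ≤ K * Y t) :
    longTimeAvg φ q ≤ K * longTimeAvg φ Y :=
  longTimeAvg_le_of_setLIntegral_le ENNReal.zero_ne_top hK fun T =>
    (setLIntegral_mul_expWeight_le hK h T).trans le_add_self

theorem IsTimeWeight.mul_expWeight_add_le (hφ : IsTimeWeight φ) (hE : E ≠ ⊤)
    (hδ : δ * ENNReal.ofReal (Real.exp 1) ≤ 2⁻¹)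
    (hw : expWeight φ (a + τ) ≤ ENNReal.ofReal (Real.exp 1) * expWeight φ a)
    (h : q (a + τ) ≤ δ * q a + E * ∫⁻ r in Ioc a (a + τ), Y r) :
    q (a + τ) * expWeight φ (a + τ) ≤ 2⁻¹ * (q a * expWeight φ a) +
      ∫⁻ r in Ioc a (a + τ), E * ENNReal.ofReal (Real.exp 1) * (Y r * expWeight φ r) := by
  set e := ENNReal.ofReal (Real.exp 1)
  have hsource : (E * ∫⁻ r in Ioc a (a + τ), Y r) * (e * expWeight φ a) ≤
      ∫⁻ r in Ioc a (a + τ), E * e * (Y r * expWeight φ r) := by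
    rw [← lintegral_const_mul' _ _ hE, ← lintegral_mul_const' _ _
      (ENNReal.mul_ne_top ENNReal.ofReal_ne_top (expWeight_ne_top φ a))]
    refine setLIntegral_mono' measurableSet_Ioc fun r hr => ?_
    calc E * Y r * (e * expWeight φ a) ≤ E * Y r * (e * expWeight φ r) := by
          gcongr
          exact hφ.monotone_expWeight hr.1.le
      _ = E * e * (Y r * expWeight φ r) := by ring
  calc q (a + τ) * expWeight φ (a + τ)
      ≤ (δ * q a + E * ∫⁻ r in Ioc a (a + τ), Y r) * (e * expWeight φ a) := mul_le_mul' h hw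
    _ = δ * e * (q a * expWeight φ a) +
          (E * ∫⁻ r in Ioc a (a + τ), Y r) * (e * expWeight φ a) := by ring
    _ ≤ _ := add_le_add (by gcongr) hsource

theorem IsTimeWeight.longTimeAvg_le_of_recursion (hφ : IsTimeWeight φ) (hY : Measurable Y)
    (hYi : ∀ T, ∫⁻ t in Ioc 0 T, Y t ≠ ⊤) (hK : K ≠ ⊤)
    (hqY : ∀ᵐ t ∂volume.restrict (Ioi (0 : ℝ)), q t ≤ K * Y t) (hE : E ≠ ⊤)
    (hδ : δ * ENNReal.ofReal (Real.exp 1) ≤ 2⁻¹) (hτ : 0 ≤ τ)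
    (hφτ : eLpNorm (deriv φ) ⊤ (volume.restrict (Ioi (0 : ℝ))) * ENNReal.ofReal τ ≤ 1)
    (hrec : ∀ᵐ a ∂volume.restrict (Ioi (0 : ℝ)),
      q (a + τ) ≤ δ * q a + E * ∫⁻ r in Ioc a (a + τ), Y r) :
    longTimeAvg φ q ≤
      2 * ENNReal.ofReal (Real.exp 1) * E * ENNReal.ofReal τ * longTimeAvg φ Y := by
  set e := ENNReal.ofReal (Real.exp 1)
  have hEe : E * e ≠ ⊤ := ENNReal.mul_ne_top hE ENNReal.ofReal_ne_top
  have hq (T : ℝ) : ∫⁻ t in Ioc 0 T, q t * expWeight φ t ≠ ⊤ :=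
    ne_top_of_le_ne_top (ENNReal.mul_ne_top hK (hφ.setLIntegral_mul_expWeight_ne_top (hYi T)))
      (setLIntegral_mul_expWeight_le hK hqY T)
  have hZ : Measurable fun r => E * e * (Y r * expWeight φ r) :=
    (hY.mul hφ.monotone_expWeight.measurable).const_mul _
  have hQ : ∀ᵐ a ∂volume.restrict (Ioi (0 : ℝ)),
      q (a + τ) * expWeight φ (a + τ) ≤ 2⁻¹ * (q a * expWeight φ a) +
        ∫⁻ r in Ioc a (a + τ), E * e * (Y r * expWeight φ r) := by
    filter_upwards [hrec, ae_restrict_mem measurableSet_Ioi] with a ha ha0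
    exact hφ.mul_expWeight_add_le hE hδ (hφ.expWeight_add_le hτ hφτ ha0.le) ha
  refine longTimeAvg_le_of_setLIntegral_le (c := 2 * ∫⁻ t in Ioc 0 τ, q t * expWeight φ t)
    (ENNReal.mul_ne_top ENNReal.ofNat_ne_top (hq τ)) (ENNReal.mul_ne_top (ENNReal.mul_ne_top
      (ENNReal.mul_ne_top ENNReal.ofNat_ne_top ENNReal.ofReal_ne_top) hE) ENNReal.ofReal_ne_top)
    fun T => (setLIntegral_le_of_recursion hZ hτ hQ (hq T)).trans_eq ?_
  rw [lintegral_const_mul' _ _ hEe]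
  ring

end LongTime

section Estimate

variable {d : ℕ} {L κ s N : ℝ} {u : ℝ → Space d → Space d} {θ₀ : Space d → ℝ}
  {θ : ℝ → Space d → ℝ} {Dθ : ℝ → Space d → Space d} {Φ : ℤ → 𝓢(Space d, ℂ)} {φ : ℝ → ℝ}
  {C G : ℝ≥0}

/-- The spatial mean of the modulus of the `l`-th Littlewood--Paley projection. -/
def lpMean {d : ℕ} (L : ℝ) (Φ : ℤ → 𝓢(Space d, ℂ)) (l : ℤ) (f : Space d → ℝ) : ℝ≥0∞ :=
  spaceAvg L fun x => ‖lpProj Φ l f x‖ₑ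

/-- The root mean square over the cell of a vector field, such as the gradient of the scalar. -/
def rootMeanSq {d : ℕ} (L : ℝ) (g : Space d → Space d) : ℝ≥0∞ :=
  (spaceAvg L fun x => ‖g x‖ₑ ^ 2) ^ (1 / 2 : ℝ)

/-- The time after which diffusion has damped the frequencies of size `2 ^ l`; the factor `N`
measures by how much. -/
def dissipationTime (N κ : ℝ) (l : ℤ) : ℝ := N / ((2 : ℝ) ^ l) ^ 2 / κ

theorem dissipationTime_nonneg (hN : 0 ≤ N) (hκ : 0 ≤ κ) (l : ℤ) : 0 ≤ dissipationTime N κ l := by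
  unfold dissipationTime
  positivity

theorem mul_dissipationTime (hκ : κ ≠ 0) (N : ℝ) (l : ℤ) :
    κ * dissipationTime N κ l = N / ((2 : ℝ) ^ l) ^ 2 := mul_div_cancel₀ _ hκ

theorem ofReal_rpow_mul_dissipationTime (hN : 0 ≤ N) (κ r : ℝ) (l : ℤ) :
    ENNReal.ofReal (((2 : ℝ) ^ l) ^ r) * ENNReal.ofReal (dissipationTime N κ l) =
      ENNReal.ofReal N * ENNReal.ofReal κ⁻¹ * ENNReal.ofReal ((2 : ℝ) ^ ((r - 2) * (l : ℝ))) := by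
  have hl : (0 : ℝ) < 2 ^ l := by positivity
  have hpow : (2 : ℝ) ^ ((r - 2) * (l : ℝ)) = ((2 : ℝ) ^ l) ^ r / ((2 : ℝ) ^ l) ^ 2 := by
    rw [mul_comm, Real.rpow_mul zero_le_two, Real.rpow_intCast, Real.rpow_sub hl, Real.rpow_ofNat]
  rw [hpow, ← ENNReal.ofReal_mul (by positivity), ← ENNReal.ofReal_mul hN,
    ← ENNReal.ofReal_mul' (by positivity), dissipationTime]
  congr 1
  ring

theorem IsWeakSolution.ae_lpMean_le (hL : 0 < L) (hu : IsVelocityField L u)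
    (h : IsWeakSolution L κ u θ₀ θ Dθ) (hΦ : IsLittlewoodPaleyFamily Φ) (l : ℤ) :
    ∀ᵐ t ∂volume.restrict (Ioi (0 : ℝ)), lpMean L Φ l (θ t) ≤
      2 * weightedNorm (Φ 0) * ENNReal.ofReal (((2 : ℝ) ^ l) ^ (-1 : ℝ)) *
        rootMeanSq L (Dθ t) := by
  filter_upwards [h.ae_regularTime hu] with t ht
  simp only [lpMean, rootMeanSq, spaceAvg_eq_lintegral]
  exact ht.lintegral_lpProj_le hL hΦ (h.measurable.comp measurable_prodMk_left) (h.periodic t)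
    (h.grad_measurable.comp measurable_prodMk_left) (h.grad_periodic t) l

theorem IsWeakSolution.measurable_rootMeanSq (h : IsWeakSolution L κ u θ₀ θ Dθ) :
    Measurable fun t => rootMeanSq L (Dθ t) := by
  simp only [rootMeanSq, spaceAvg_eq_lintegral]
  exact (measurable_lintegral_enorm_sq h.grad_measurable).pow_const _

theorem IsWeakSolution.setLIntegral_rootMeanSq_ne_top (h : IsWeakSolution L κ u θ₀ θ Dθ)
    (T : ℝ) : ∫⁻ t in Ioc 0 T, rootMeanSq L (Dθ t) ≠ ⊤ := by
  have hle (t : ℝ) :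
      rootMeanSq L (Dθ t) ≤ 1 + ∫⁻ x, ‖Dθ t x‖ₑ ^ 2 ∂cellMeasure d L := by
    rw [rootMeanSq, spaceAvg_eq_lintegral]
    refine (ENNReal.rpow_le_rpow (le_add_self (b := 1)) (by norm_num)).trans ?_
    exact (ENNReal.rpow_le_rpow_of_exponent_le le_self_add (by norm_num)).trans_eq
      (ENNReal.rpow_one _)
  rw [setLIntegral_congr Ioo_ae_eq_Ioc.symm]
  refine ne_top_of_le_ne_top ?_ (lintegral_mono hle)
  rw [lintegral_add_left measurable_const]
  exact ENNReal.add_ne_top.2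
    ⟨by simp, h.grad_sqIntegrable.lintegral_ne_top h.grad_measurable T⟩

theorem IsWeakSolution.longTimeAvg_lpMean_le_of_one_le (hL : 0 < L)
    (hu : IsVelocityField L u) (h : IsWeakSolution L κ u θ₀ θ Dθ)
    (hΦ : IsLittlewoodPaleyFamily Φ) (hN : 0 ≤ N) {l : ℤ} {M : ℝ≥0∞}
    (hM : 1 ≤ M * ENNReal.ofReal (dissipationTime N κ l)) :
    longTimeAvg φ (fun t => lpMean L Φ l (θ t)) ≤
      2 * weightedNorm (Φ 0) * ENNReal.ofReal N * ENNReal.ofReal κ⁻¹ *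
        (ENNReal.ofReal ((2 : ℝ) ^ (-3 * (l : ℝ))) * M) *
        longTimeAvg φ fun t => rootMeanSq L (Dθ t) := by
  have hw : 2 * weightedNorm (Φ 0) ≠ ⊤ :=
    ENNReal.mul_ne_top ENNReal.ofNat_ne_top (weightedNorm_schwartz_ne_top (Φ 0))
  refine (longTimeAvg_le_const_mul (ENNReal.mul_ne_top hw ENNReal.ofReal_ne_top)
    (h.ae_lpMean_le hL hu hΦ l)).trans ?_
  gcongr ?_ * _
  calc 2 * weightedNorm (Φ 0) * ENNReal.ofReal (((2 : ℝ) ^ l) ^ (-1 : ℝ))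
      ≤ 2 * weightedNorm (Φ 0) * ENNReal.ofReal (((2 : ℝ) ^ l) ^ (-1 : ℝ)) *
          (M * ENNReal.ofReal (dissipationTime N κ l)) := le_mul_of_one_le_right' hM
    _ = 2 * weightedNorm (Φ 0) * M * (ENNReal.ofReal (((2 : ℝ) ^ l) ^ (-1 : ℝ)) *
          ENNReal.ofReal (dissipationTime N κ l)) := by ring
    _ = 2 * weightedNorm (Φ 0) * ENNReal.ofReal N * ENNReal.ofReal κ⁻¹ *
          (ENNReal.ofReal ((2 : ℝ) ^ (-3 * (l : ℝ))) * M) := by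
        rw [ofReal_rpow_mul_dissipationTime hN, show (-1 : ℝ) - 2 = -3 by norm_num]
        ring

theorem two_mul_ofReal_inv_four_exp_mul :
    2 * ENNReal.ofReal (4 * Real.exp 1)⁻¹ * ENNReal.ofReal (Real.exp 1) = 2⁻¹ := by
  rw [mul_assoc, ← ENNReal.ofReal_mul (by positivity), mul_inv,
    inv_mul_cancel_right₀ (Real.exp_ne_zero 1), ← ENNReal.ofReal_ofNat 2,
    ← ENNReal.ofReal_mul zero_le_two, ← ENNReal.ofReal_inv_of_pos zero_lt_two]
  norm_num

theorem IsWeakSolution.ae_lpMean_add_le (hL : 0 < L) (hκ : 0 < κ) (hs : s ∈ Icc (0 : ℝ) 1)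
    (hu : IsVelocityField L u) (h : IsWeakSolution L κ u θ₀ θ Dθ)
    (hG : ∀ᵐ t ∂volume.restrict (Ioi (0 : ℝ)), fracGradSq L s (u t) ^ (1 / 2 : ℝ) ≤ G)
    (hΦ : IsLittlewoodPaleyFamily Φ) {l : ℤ} {T : ℝ} {D δ : ℝ≥0∞} (hT : 0 ≤ T) (hD : D ≠ ⊤)
    (hheat : HasHeatFlowBound (Φ l) s (κ * T) D) (hδ : HasHeatContraction (Φ l) (κ * T) δ) :
    ∀ᵐ a ∂volume.restrict (Ioi (0 : ℝ)), lpMean L Φ l (θ (a + T)) ≤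
      2 * δ * lpMean L Φ l (θ a) +
        2 * (D * G) * ∫⁻ r in Ioc a (a + T), rootMeanSq L (Dθ r) := by
  filter_upwards [h.ae_lintegral_lpProj_add_le hL hκ hs hu hG hΦ hT hheat hδ] with a ha
  simp only [lpMean, rootMeanSq, spaceAvg_eq_lintegral]
  rwa [lintegral_const_mul' _ _ (ENNReal.mul_ne_top hD ENNReal.coe_ne_top), ← mul_assoc,
    ← mul_assoc] at ha

theorem IsWeakSolution.longTimeAvg_lpMean_le_of_le_one (hL : 0 < L) (hκ : 0 < κ)
    (hs : s ∈ Icc (0 : ℝ) 1) (hu : IsVelocityField L u) (h : IsWeakSolution L κ u θ₀ θ Dθ)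
    (hG : ∀ᵐ t ∂volume.restrict (Ioi (0 : ℝ)), fracGradSq L s (u t) ^ (1 / 2 : ℝ) ≤ G)
    (hΦ : IsLittlewoodPaleyFamily Φ) (hφ : IsTimeWeight φ) {l : ℤ} (hN : 0 ≤ N)
    (hheat : HasHeatFlowBound (Φ l) s (N / ((2 : ℝ) ^ l) ^ 2)
      (C * ENNReal.ofReal (((2 : ℝ) ^ l) ^ (-s))))
    (hδ : HasHeatContraction (Φ l) (N / ((2 : ℝ) ^ l) ^ 2) (ENNReal.ofReal (4 * Real.exp 1)⁻¹))
    (hφN : eLpNorm (deriv φ) ⊤ (volume.restrict (Ioi (0 : ℝ))) *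
      ENNReal.ofReal (dissipationTime N κ l) ≤ 1) :
    longTimeAvg φ (fun t => lpMean L Φ l (θ t)) ≤
      4 * ENNReal.ofReal (Real.exp 1) * C * ENNReal.ofReal N * ENNReal.ofReal κ⁻¹ *
        (ENNReal.ofReal ((2 : ℝ) ^ (-(s + 2) * (l : ℝ))) * G) *
        longTimeAvg φ fun t => rootMeanSq L (Dθ t) := by
  set D : ℝ≥0∞ := C * ENNReal.ofReal (((2 : ℝ) ^ l) ^ (-s)) with hDdef
  have hD : D ≠ ⊤ := ENNReal.mul_ne_top ENNReal.coe_ne_top ENNReal.ofReal_ne_top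
  have hw : 2 * weightedNorm (Φ 0) ≠ ⊤ :=
    ENNReal.mul_ne_top ENNReal.ofNat_ne_top (weightedNorm_schwartz_ne_top (Φ 0))
  have hτ := dissipationTime_nonneg hN hκ.le l
  rw [← mul_dissipationTime hκ.ne'] at hheat hδ
  refine (hφ.longTimeAvg_le_of_recursion h.measurable_rootMeanSq h.setLIntegral_rootMeanSq_ne_top
    (ENNReal.mul_ne_top hw ENNReal.ofReal_ne_top) (h.ae_lpMean_le hL hu hΦ l)
    (ENNReal.mul_ne_top ENNReal.ofNat_ne_top (ENNReal.mul_ne_top hD ENNReal.coe_ne_top))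
    two_mul_ofReal_inv_four_exp_mul.le hτ hφN
    (h.ae_lpMean_add_le hL hκ hs hu hG hΦ hτ hD hheat hδ)).trans_eq ?_
  congr 1
  calc 2 * ENNReal.ofReal (Real.exp 1) * (2 * (D * G)) * ENNReal.ofReal (dissipationTime N κ l)
      = 4 * ENNReal.ofReal (Real.exp 1) * C * G * (ENNReal.ofReal (((2 : ℝ) ^ l) ^ (-s)) *
          ENNReal.ofReal (dissipationTime N κ l)) := by
        rw [hDdef]
        ring
    _ = 4 * ENNReal.ofReal (Real.exp 1) * C * ENNReal.ofReal N * ENNReal.ofReal κ⁻¹ *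
          (ENNReal.ofReal ((2 : ℝ) ^ (-(s + 2) * (l : ℝ))) * G) := by
        rw [ofReal_rpow_mul_dissipationTime hN, show -s - 2 = -(s + 2) by ring]
        ring

end Estimate

end PassiveScalar

end

theorem theorem1_general (d : ℕ) (Φ : ℤ → 𝓢(PassiveScalar.Space d, ℂ))
    (hΦ : PassiveScalar.IsLittlewoodPaleyFamily Φ) :
    ∃ C : ℝ≥0, ∀ (L κ s : ℝ), 0 < L → 0 < κ → s ∈ Icc (0 : ℝ) 1 →
      ∀ (u : ℝ → PassiveScalar.Space d → PassiveScalar.Space d) (G : ℝ≥0),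
        PassiveScalar.IsVelocityField L u →
        (∀ᵐ t ∂volume.restrict (Ioi (0 : ℝ)),
          PassiveScalar.fracGradSq L s (u t) ^ (1 / 2 : ℝ) ≤ (G : ℝ≥0∞)) →
      ∀ (θ₀ : PassiveScalar.Space d → ℝ) (θ : ℝ → PassiveScalar.Space d → ℝ)
        (Dθ : ℝ → PassiveScalar.Space d → PassiveScalar.Space d),
        PassiveScalar.IsWeakSolution L κ u θ₀ θ Dθ →
      ∀ φ : ℝ → ℝ, PassiveScalar.IsTimeWeight φ →
      ∀ l : ℤ,
        PassiveScalar.longTimeAvg φ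
            (fun t => PassiveScalar.spaceAvg L fun x => ‖PassiveScalar.lpProj Φ l (θ t) x‖ₑ)
          ≤ (C : ℝ≥0∞) * ENNReal.ofReal κ⁻¹ *
            (ENNReal.ofReal ((2 : ℝ) ^ (-(s + 2) * (l : ℝ))) * (G : ℝ≥0∞)
              + ENNReal.ofReal ((2 : ℝ) ^ (-3 * (l : ℝ))) *
                eLpNorm (deriv φ) ∞ (volume.restrict (Ioi (0 : ℝ)))) *
            PassiveScalar.longTimeAvg φ
              (fun t => (PassiveScalar.spaceAvg L fun x => ‖Dθ t x‖ₑ ^ 2) ^ (1 / 2 : ℝ)) := by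
  obtain ⟨N, hN, hδ⟩ := hΦ.exists_hasHeatContraction (δ := (4 * Real.exp 1)⁻¹) (by positivity)
  obtain ⟨C, hheat⟩ := hΦ.exists_hasHeatFlowBound hN
  have hN0 : 0 ≤ N := zero_le_one.trans hN
  have hw := PassiveScalar.weightedNorm_schwartz_ne_top (Φ 0)
  obtain ⟨K, hK⟩ : ∃ K : ℝ≥0,
      K = max (2 * PassiveScalar.weightedNorm (Φ 0) * ENNReal.ofReal N)
        (4 * ENNReal.ofReal (Real.exp 1) * C * ENNReal.ofReal N) :=
    ⟨_, ENNReal.coe_toNNReal (max_lt (by finiteness) (by finiteness)).ne⟩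
  refine ⟨K, fun L κ s hL hκ hs u G hu hG θ₀ θ Dθ h φ hφ l => ?_⟩
  rw [hK]
  rcases le_total 1 (eLpNorm (deriv φ) ∞ (volume.restrict (Ioi (0 : ℝ))) *
    ENNReal.ofReal (PassiveScalar.dissipationTime N κ l)) with hφN | hφN
  · refine (h.longTimeAvg_lpMean_le_of_one_le hL hu hΦ hN0 hφN).trans ?_
    exact mul_le_mul_left (mul_le_mul' (mul_le_mul_left (le_max_left _ _) _) le_add_self) _
  · refine (h.longTimeAvg_lpMean_le_of_le_one hL hκ hs hu hG hΦ hφ hN0 (hheat l s hs) (hδ l)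
      hφN).trans ?_
    exact mul_le_mul_left (mul_le_mul' (mul_le_mul_left (le_max_right _ _) _) le_self_add) _

theorem theorem1 (d : ℕ) (hd : 1 ≤ d) (Φ : ℤ → 𝓢(PassiveScalar.Space d, ℂ))
    (hΦ : PassiveScalar.IsLittlewoodPaleyFamily Φ) :
    ∃ C : ℝ≥0, ∀ (L κ s : ℝ), 0 < L → 0 < κ → s ∈ Icc (0 : ℝ) 1 →
      ∀ (u : ℝ → PassiveScalar.Space d → PassiveScalar.Space d) (G : ℝ≥0),
        PassiveScalar.IsVelocityField L u →
        (∀ᵐ t ∂volume.restrict (Ioi (0 : ℝ)),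
          PassiveScalar.fracGradSq L s (u t) ^ (1 / 2 : ℝ) = (G : ℝ≥0∞)) →
      ∀ (θ₀ : PassiveScalar.Space d → ℝ) (θ : ℝ → PassiveScalar.Space d → ℝ)
        (Dθ : ℝ → PassiveScalar.Space d → PassiveScalar.Space d),
        PassiveScalar.IsWeakSolution L κ u θ₀ θ Dθ →
      ∀ φ : ℝ → ℝ, PassiveScalar.IsTimeWeight φ →
      ∀ l : ℤ,
        PassiveScalar.longTimeAvg φ
            (fun t => PassiveScalar.spaceAvg L fun x => ‖PassiveScalar.lpProj Φ l (θ t) x‖ₑ)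
          ≤ (C : ℝ≥0∞) * ENNReal.ofReal κ⁻¹ *
            (ENNReal.ofReal ((2 : ℝ) ^ (-(s + 2) * (l : ℝ))) * (G : ℝ≥0∞)
              + ENNReal.ofReal ((2 : ℝ) ^ (-3 * (l : ℝ))) *
                eLpNorm (deriv φ) ∞ (volume.restrict (Ioi (0 : ℝ)))) *
            PassiveScalar.longTimeAvg φ
              (fun t => (PassiveScalar.spaceAvg L fun x => ‖Dθ t x‖ₑ ^ 2) ^ (1 / 2 : ℝ)) := by
  obtain ⟨C, hC⟩ := theorem1_general d Φ hΦ
  exact ⟨C, fun L κ s hL hκ hs u G hu hG =>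
    hC L κ s hL hκ hs u G hu (hG.mono fun _ ht => ht.le)⟩
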